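/- Let $K$ be a non-archimedean local field with ring of integers $\mathcal O_K$, let $B$ be a central division algebra over $K$ with $\dim_K B=n^2$, let $\mathcal O_B$ be its ring of integers (the elements integral over $\mathcal O_K$) and $\pi_B$ a uniformizer of $\mathcal O_B$. A maximal order of $\mathbb M_2(B)$ is a maximal element among the subrings of $\mathbb M_2(B)$ that contain $\mathcal O_K$, are finitely generated as $\mathcal O_K$-modules and span $\mathbb M_2(B)$ over $K$. The Bruhat--Tits tree $\mathfrak T(B)$ is the graph whose vertices are the maximal orders of $\mathbb M_2(B)$, two of them being neighbors if they are the endomorphism rings $\mathrm{End}_{\mathcal O_B}(\Lambda)$, $\mathrm{End}_{\mathcal O_B}(\Lambda')$ of right $\mathcal O_B$-lattices $\Lambda,\Lambda'$ in the column space $B^2$ with $\Lambda\pi_B\subsetneq\Lambda'\subsetneq\Lambda$. For a subring $\mathfrak H\supseteq\mathcal O_K$ of $\mathbb M_2(B)$, the branch $\mathfrak S(\mathfrak H)$ is the full subgraph of $\mathfrak T(B)$ whose vertices are the maximal orders containing $\mathfrak H$. Let $L\subseteq\mathbb M_2(B)$ be a commutative semisimple $K$-subalgebra with $\dim_K L=2n$,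 and let $\mathcal O_L$ be its ring of integers, i.e. the integral closure of $\mathcal O_K$ in $L$. For finite field extensions, $e(\cdot/\cdot)$ denotes the ramification index. Then: 1. If $L$ is a field and $e(L/K)$ is odd, then $\mathcal O_L$ is contained in a unique maximal order of $\mathbb M_2(B)$. 2. If $L$ is a field containing a degree $n$ extension $F$ of $K$ with $e(L/F)=2$, then $e(L/K)$ divides $2n$ and $\mathfrak S(\mathcal O_L)$ is a path of length $\frac{2n}{e(L/K)}$, i.e. it is isomorphic to the graph with vertices $0,1,\dots,\frac{2n}{e(L/K)}$ in which $i$ and $j$ are adjacent exactly when $|i-j|=1$. 3. If $L$ is not a field, then $\mathfrak S(\mathcal O_L)$ is a maximal (bi-infinite) path, i.e. it is isomorphic to the graph with vertex set $\mathbb Z$ in which $i$ and $j$ are adjacent exactly when $|i-j|=1$. -/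

import Mathlib

open scoped ValuativeRel IsMulCommutative

noncomputable section

namespace LocalOrders

section Orders

variable (K : Type*) [Field K] [ValuativeRel K] {A : Type*} [Ring A] [Algebra K A]

/-- A (full) `𝒪[K]`-order in a `K`-algebra `A`: a subring containing `𝒪[K]`, finitely generated as
an `𝒪[K]`-module, that spans `A` over `K`. -/
def IsFullOrder (D : Subalgebra 𝒪[K] A) : Prop :=
  Module.Finite 𝒪[K] D ∧ Submodule.span K (D : Set A) = ⊤

/-- A maximal order: a full order that is not properly contained in another one. -/
def IsMaximalOrder (D : Subalgebra 𝒪[K] A) : Prop :=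
  Maximal (IsFullOrder K) D

variable (A) in
/-- The type of maximal orders of `A`. -/
def MaximalOrder : Type _ := {D : Subalgebra 𝒪[K] A // IsMaximalOrder K D}

/-- The ring of integers `𝒪_L` of a commutative subalgebra `L` of `A`, i.e. the integral closure of
`𝒪[K]` in `L`, viewed inside `A`. -/
def ringOfIntegers (L : Subalgebra K A) [IsMulCommutative L] : Subalgebra 𝒪[K] A :=
  (integralClosure 𝒪[K] L).map (L.val.restrictScalars 𝒪[K])

end Orders

section Ramification

variable (K : Type*) [Field K] [ValuativeRel K]

/-- The maximal ideal of the ring of integers (the integral closure of `𝒪[K]`) of a finite field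
extension `E` of a local field `K`. That ring is local, so its Jacobson radical is its unique
maximal ideal. -/
def maxIdeal (E : Type*) [CommRing E] [Algebra K E] : Ideal (integralClosure 𝒪[K] E) :=
  (⊥ : Ideal (integralClosure 𝒪[K] E)).jacobson

variable {K} in
/-- The ramification index of an extension `f : F → L` of finite extensions of `K`: the largest `e`
such that `𝔪_F 𝒪_L ⊆ 𝔪_L ^ e`. -/
def ramificationIndex {F L : Type*} [CommRing F] [CommRing L] [Algebra K F] [Algebra K L]
    (f : F →ₐ[K] L) : ℕ :=
  sSup {e : ℕ | (maxIdeal K F).map (f.restrictScalars 𝒪[K]).mapIntegralClosure ≤ maxIdeal K L ^ e}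

end Ramification

section Tree

variable (K : Type*) [Field K] [ValuativeRel K] {B : Type*} [DivisionRing B] [Algebra K B]

/-- `π` is a uniformizer of the division algebra `B`, whose ring of integers `𝒪_B` consists of the
elements integral over `𝒪[K]`: `π` is a nonzero non-unit of `𝒪_B` and every non-unit of `𝒪_B` is a
multiple of `π`. -/
def IsUniformizer (π : B) : Prop :=
  π ≠ 0 ∧ IsIntegral 𝒪[K] π ∧ ¬ IsIntegral 𝒪[K] π⁻¹ ∧
    ∀ b : B, IsIntegral 𝒪[K] b → ¬ IsIntegral 𝒪[K] b⁻¹ →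
      ∃ c : B, IsIntegral 𝒪[K] c ∧ b = π * c

/-- An `𝒪_B`-lattice in the column space `B²`: a finitely generated `𝒪[K]`-submodule that spans
`B²` over `K` and is stable under right multiplication by the scalars in `𝒪_B`. -/
def IsLattice (Λ : Submodule 𝒪[K] (Fin 2 → B)) : Prop :=
  Λ.FG ∧ Submodule.span K (Λ : Set (Fin 2 → B)) = ⊤ ∧
    ∀ v ∈ Λ, ∀ b : B, IsIntegral 𝒪[K] b → (fun i => v i * b) ∈ Λ

variable {K} in
/-- The set of matrices preserving `Λ` by left multiplication; for an `𝒪_B`-lattice `Λ` in `B²` it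
is the endomorphism ring of the right `𝒪_B`-module `Λ`. -/
def endSet (Λ : Submodule 𝒪[K] (Fin 2 → B)) : Set (Matrix (Fin 2) (Fin 2) B) :=
  {M | ∀ v ∈ Λ, Matrix.mulVec M v ∈ Λ}

/-- Two maximal orders of `M₂(B)` are neighbors if they are the endomorphism rings of
`𝒪_B`-lattices `Λ` and `Λ'` with `Λ π_B ⊊ Λ' ⊊ Λ`. -/
def IsNeighbor (D D' : MaximalOrder K (Matrix (Fin 2) (Fin 2) B)) : Prop :=
  ∃ (Λ Λ' : Submodule 𝒪[K] (Fin 2 → B)) (π : B), IsLattice K Λ ∧ IsLattice K Λ' ∧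
    IsUniformizer K π ∧ (D.1 : Set (Matrix (Fin 2) (Fin 2) B)) = endSet Λ ∧
    (D'.1 : Set (Matrix (Fin 2) (Fin 2) B)) = endSet Λ' ∧
    (fun (v : Fin 2 → B) (i : Fin 2) => v i * π) '' (Λ : Set (Fin 2 → B)) ⊂ Λ' ∧
    (Λ' : Set (Fin 2 → B)) ⊂ Λ

variable (B) in
/-- The Bruhat–Tits tree of `PSL₂(B)`, with the maximal orders of `M₂(B)` as vertices. (The
neighbor relation is already symmetric and irreflexive; `fromRel` only records this.) -/
def bruhatTitsTree : SimpleGraph (MaximalOrder K (Matrix (Fin 2) (Fin 2) B)) :=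
  SimpleGraph.fromRel (IsNeighbor K)

variable {K} in
/-- The vertices of the branch of `H`: the maximal orders containing `H`. -/
def branchVertices (H : Subalgebra 𝒪[K] (Matrix (Fin 2) (Fin 2) B)) :
    Set (MaximalOrder K (Matrix (Fin 2) (Fin 2) B)) :=
  {D | H ≤ D.1}

variable {K} in
/-- The branch of `H`: the full subgraph of the Bruhat–Tits tree on the maximal orders
containing `H`. -/
def branch (H : Subalgebra 𝒪[K] (Matrix (Fin 2) (Fin 2) B)) :
    SimpleGraph (branchVertices H) :=
  (bruhatTitsTree K B).induce (branchVertices H)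

end Tree

/-- `G` is a path of length `ℓ`: it is isomorphic to the interval with vertices `0, …, ℓ`. -/
def IsPathOfLength {V : Type*} (G : SimpleGraph V) (l : ℕ) : Prop :=
  Nonempty (SimpleGraph.pathGraph (l + 1) ≃g G)

/-- `G` is a maximal path: it is isomorphic to the real line graph, with vertex set `ℤ` and edges
joining `i` and `i + 1`. -/
def IsMaximalPath {V : Type*} (G : SimpleGraph V) : Prop :=
  Nonempty (SimpleGraph.hasse ℤ ≃g G)

end LocalOrders

end

set_option linter.unusedSectionVars false

namespace LocalOrders

open ValuativeRel
open scoped RightActions Matrix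

/-! ### The normalized valuation of the base field. -/

section LocalField

variable (K : Type*) [Field K] [ValuativeRel K] [TopologicalSpace K] [IsNonarchimedeanLocalField K]

/-! Everything is governed by the valuation of a finite-dimensional division algebra `D` over `K`.
An element of `D` is integral exactly when its norm is (`isIntegral_iff_norm_mem_integer`), which
rests on compactness of the set of primitive coordinate vectors (`exists_fg_of_norm_mem`). This
makes the integers a ring, normalizes a valuation `ord`, and yields `e f = [D : K]`
(`ram_mul_resDeg`) together with a Teichmüller generator of the residue field
(`exists_isTeichmuller`). For the central algebra `B` it also yields the cyclic presentation
`exists_centralData`: `e = f = n`, and a uniformizer `π` with `π ^ n` in `K` acts on a root of unity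
`ζ` by a generating power of Frobenius.

Lattices in `B²` are free, and maximal orders are their endomorphism rings up to homothety
(`isMaximalOrder_iff`, `exists_homothety`). For a fixed basis `x, y`, the lattices `x 𝔪ᵃ + y 𝔪ᵇ`
give an apartment, a line of vertices indexed by `b - a`. A branch is therefore known once all
lattices stable under `𝒪_L` are placed in one apartment and the admissible differences `b - a` are
found (`exists_equiv_branch`).

If `L` is not a field, a nontrivial idempotent of `L` is integral. It splits `B²` into two lines and
splits every stable lattice along them, so the branch is a whole apartment.

If `L` is a field, let `e` and `f` be its ramification index and residue degree. As `e f = 2n`, the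
index `e` is even exactly when `f` divides `n`, and only this dichotomy matters. When `f` does not
divide `n`, two stable lattices that are not homothetic would produce a stable one-dimensional
quotient over the residue field of `B`; a Teichmüller generator of `L` would act on it by a scalar,
forcing `f ∣ n` (`eq_of_stable_of_not_dvd`).

When `f` divides `n`, a Teichmüller generator `η` of `L` has an eigenspace `U` in `B²` for an
eigenvalue in the powers of `ζ`, and `B²` is the direct sum of the `U πⁱ` for `i < f`. Counting
shows that the successive layers `𝔪_L ^ c X ∩ U` of a stable lattice `X` have quotients that are
lines over the residue field of `B` (`exists_sub_mem_layer`), so a stable lattice is determined by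
how deep it reaches in each `U πⁱ`. Since `π ^ f` shifts layers by exactly two, vectors `x` of level
0 and `τ x` of level 1, with `τ` a uniformizer of `L`, form a basis adapted to all stable lattices.
These are the `x 𝔪ᵃ + τ x 𝔪ᵇ` with `b ≤ a ≤ b + f` (`exists_eq_std`, `isStable_std`), which is a
path of length `f = 2n / e`. -/

lemma t2Space_of_localField : T2Space K := by
  let := IsTopologicalAddGroup.rightUniformSpace K
  have := isUniformAddGroup_of_addCommGroup (G := K)
  infer_instance

variable {K} in
/-- The normalized additive valuation of a local field, with the convention `ordBase 0 = 0`. -/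
noncomputable def ordBase (x : K) : ℤ :=
  -WithZero.log (IsNonarchimedeanLocalField.valueGroupWithZeroIsoInt K (valuation K x))

variable {K}

lemma ordBase_mul {x y : K} (hx : x ≠ 0) (hy : y ≠ 0) :
    ordBase (x * y) = ordBase x + ordBase y := by
  unfold ordBase
  rw [map_mul, map_mul, WithZero.log_mul]
  · ring
  · simpa using hx
  · simpa using hy

lemma mem_integer_iff_ordBase {x : K} (hx : x ≠ 0) : x ∈ 𝒪[K] ↔ 0 ≤ ordBase x := by
  unfold ordBase
  rw [Valuation.mem_integer_iff,
    ← map_le_map_iff (IsNonarchimedeanLocalField.valueGroupWithZeroIsoInt K), map_one,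
    ← WithZero.log_le_log (by simpa using hx) one_ne_zero, WithZero.log_one]
  constructor <;> intro h <;> linarith

omit [TopologicalSpace K] [IsNonarchimedeanLocalField K] in
lemma mem_integer_or_inv_mem (x : K) : x ∈ 𝒪[K] ∨ x⁻¹ ∈ 𝒪[K] := by
  rw [Valuation.mem_integer_iff, Valuation.mem_integer_iff, map_inv₀]
  rcases le_total ((valuation K) x) 1 with h | h
  · exact Or.inl h
  · exact Or.inr (inv_le_one_of_one_le₀ h)

end LocalField

/-! ### Boundedness of the elements of integral norm. -/

section Bounded

variable (K : Type*) [Field K] [ValuativeRel K] [TopologicalSpace K] [IsNonarchimedeanLocalField K]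
  (D : Type*) [DivisionRing D] [Algebra K D] [FiniteDimensional K D]

/-- This is the unit sphere of the sup norm: a closed condition inside the compact unit box, since
the valuation is locally constant away from zero. -/
lemma isCompact_primitive_vectors (m : Type*) [Fintype m] :
    IsCompact {c : m → K | (∀ i, valuation K (c i) ≤ 1) ∧ ∃ i, valuation K (c i) = 1} := by
  have := t2Space_of_localField K
  have h1 : IsCompact {c : m → K | ∀ i, valuation K (c i) ≤ 1} := by
    have := isCompact_univ_pi (fun _ : m => IsNonarchimedeanLocalField.isCompact_closedBall K 1)
    convert this using 1
    ext c
    simp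
  have h2 : IsClosed {x : K | valuation K x = 1} := by
    rw [← isOpen_compl_iff, isOpen_iff_mem_nhds]
    intro x hx
    let := IsTopologicalAddGroup.rightUniformSpace K
    have := isUniformAddGroup_of_addCommGroup (G := K)
    by_cases h0 : x = 0
    · subst h0
      refine Filter.mem_of_superset
        ((IsValuativeTopology.hasBasis_nhds_zero' K).mem_of_mem (i := 1) one_ne_zero) ?_
      intro y hy
      exact ne_of_lt hy
    · refine Filter.mem_of_superset (IsValuativeTopology.mem_nhds_iff.mpr
        ⟨Units.mk0 (valuation K x) (by simpa using h0), subset_rfl⟩) ?_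
      rintro z ⟨y, hy, rfl⟩ h
      apply hx
      have hy' : valuation K y < valuation K x := hy
      have h' : valuation K (x + y) = 1 := h
      rwa [Valuation.map_add_eq_of_lt_left (valuation K) hy'] at h'
  have h3 : {c : m → K | (∀ i, valuation K (c i) ≤ 1) ∧ ∃ i, valuation K (c i) = 1}
      = {c : m → K | ∀ i, valuation K (c i) ≤ 1} ∩ ⋃ i, {c : m → K | valuation K (c i) = 1} := by
    ext c; simp
  rw [h3]
  exact h1.inter_right (isClosed_iUnion_of_finite fun i =>
    IsClosed.preimage (f := fun c : m → K => c i) (continuous_apply i) h2)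

/-- In coordinates the norm is a continuous form of degree `r = [D : K]`. It has no zero on
primitive vectors because `D` is a division ring, so by compactness it is bounded away from zero
there, and homogeneity bounds the coordinates of every element of integral norm. -/
lemma exists_fg_of_norm_mem :
    ∃ M : Submodule 𝒪[K] D, M.FG ∧ ∀ x : D, Algebra.norm K x ∈ 𝒪[K] → x ∈ M := by
  have := t2Space_of_localField K
  let b := Module.finBasis K D
  set r := Module.finrank K D with hr
  have hr0 : r ≠ 0 := Module.finrank_pos.ne'
  let g : (Fin r → K) → K := fun c => Algebra.norm K (∑ i, c i • b i)
  have hg : Continuous g := by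
    have : g = fun c => (∑ i, c i • Algebra.leftMulMatrix b (b i)).det := by
      funext c
      simp only [g, Algebra.norm_eq_matrix_det b, map_sum, map_smul]
    rw [this]
    refine Continuous.matrix_det ?_
    refine continuous_finsetSum _ fun i _ => ?_
    exact (continuous_apply i).smul continuous_const
  have hK := (isCompact_primitive_vectors K (Fin r)).image hg
  have h0 : (0 : K) ∉ g '' {c : Fin r → K | (∀ i, valuation K (c i) ≤ 1) ∧
      ∃ i, valuation K (c i) = 1} := by
    rintro ⟨c, ⟨-, i, hi⟩, hc⟩
    rw [Algebra.norm_eq_zero_iff] at hc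
    have := Fintype.linearIndependent_iff.mp b.linearIndependent c hc i
    rw [this] at hi
    simp at hi
  obtain ⟨γ, hγ, hsub⟩ := (IsValuativeTopology.hasBasis_nhds_zero' K).mem_iff.mp
    (hK.isClosed.isOpen_compl.mem_nhds h0)
  -- If the largest coordinate `c` has valuation at least one, then `|c| γ ≤ |c| ^ r γ ≤ |N x| ≤ 1`;
  -- so `max 1 γ⁻¹` bounds it in all cases.
  obtain ⟨s, hs⟩ := ValuativeRel.valuation_surjective (max 1 γ⁻¹)
  refine ⟨Submodule.span 𝒪[K] (Set.range fun i => s • b i),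
    Submodule.fg_span (Set.finite_range _), fun x hx => ?_⟩
  by_cases hx0 : x = 0
  · subst hx0; exact zero_mem _
  have hcoord : b.repr x ≠ 0 := by simpa using hx0
  have : Nonempty (Fin r) := ⟨⟨0, Nat.pos_of_ne_zero hr0⟩⟩
  obtain ⟨i, hi⟩ := Finite.exists_max fun i => valuation K (b.repr x i)
  have hci : b.repr x i ≠ 0 := by
    intro h
    apply hcoord
    ext j
    have := hi j
    rw [h, map_zero] at this
    simpa using this
  have hvi : valuation K (b.repr x i) ≠ 0 := by simpa using hci
  set c : Fin r → K := fun j => (b.repr x i)⁻¹ * b.repr x j with hc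
  have hcmem : c ∈ {c : Fin r → K | (∀ i, valuation K (c i) ≤ 1) ∧ ∃ i, valuation K (c i) = 1} := by
    refine ⟨fun j => ?_, i, ?_⟩
    · simp only [hc, map_mul, map_inv₀]
      rw [inv_mul_le_iff₀ (zero_lt_iff.mpr hvi), mul_one]
      exact hi j
    · simp [hc, inv_mul_cancel₀ hci]
  have hgc : γ ≤ valuation K (g c) := by
    by_contra hlt
    exact hsub (not_le.mp hlt) ⟨c, hcmem, rfl⟩
  have hxc : x = (b.repr x i) • ∑ j, c j • b j := by
    conv_lhs => rw [← b.sum_repr x]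
    rw [Finset.smul_sum]
    refine Finset.sum_congr rfl fun j _ => ?_
    rw [smul_smul, hc, mul_inv_cancel_left₀ hci]
  have hnorm : Algebra.norm K x = (b.repr x i) ^ r * g c := by
    conv_lhs => rw [hxc, Algebra.smul_def, map_mul, Algebra.norm_algebraMap]
  have hbound : valuation K (b.repr x i) ≤ valuation K s := by
    rw [hs]
    rcases le_total (valuation K (b.repr x i)) 1 with h1 | h1
    · exact h1.trans (le_max_left _ _)
    · refine le_trans ?_ (le_max_right _ _)
      rw [Valuation.mem_integer_iff, hnorm, map_mul, map_pow] at hx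
      have h2 : valuation K (b.repr x i) * γ ≤ 1 :=
        (mul_le_mul' (le_self_pow₀ h1 hr0) hgc).trans hx
      rwa [← one_div, le_div_iff₀ (zero_lt_iff.mpr hγ)]
  have hs0 : s ≠ 0 := by
    rintro rfl
    rw [map_zero] at hs
    exact absurd (hs ▸ le_max_left (1 : ValueGroupWithZero K) γ⁻¹) (by simp)
  rw [← b.sum_repr x]
  refine Submodule.sum_mem _ fun j _ => ?_
  have hmem : s⁻¹ * b.repr x j ∈ 𝒪[K] := by
    rw [Valuation.mem_integer_iff, map_mul, map_inv₀,
      inv_mul_le_iff₀ (zero_lt_iff.mpr (by simpa using hs0)), mul_one]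
    exact (hi j).trans hbound
  have : b.repr x j • b j = (⟨_, hmem⟩ : 𝒪[K]) • (s • b j) := by
    rw [Subring.smul_def, smul_smul]
    congr 1
    field_simp
  rw [this]
  exact Submodule.smul_mem _ _ (Submodule.subset_span ⟨j, rfl⟩)

end Bounded

/-! ### The ring of integers and the valuation of a division algebra. -/

section Integers

variable {K : Type*} [Field K] [ValuativeRel K] [TopologicalSpace K] [IsNonarchimedeanLocalField K]

/-- An `𝒪[K]`-basis of the lattice is a `K`-basis of the space, and the matrix of `f` in it has
integral entries. -/
lemma det_mem_integer_of_stable_lattice {V : Type*} [AddCommGroup V] [Module K V]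
    [Module 𝒪[K] V] [IsScalarTower 𝒪[K] K V] [FiniteDimensional K V]
    (N : Submodule 𝒪[K] V) [Submodule.IsLattice K N] (f : V →ₗ[K] V) (hf : ∀ v ∈ N, f v ∈ N) :
    LinearMap.det f ∈ 𝒪[K] := by
  classical
  let c := Module.Free.chooseBasis 𝒪[K] N
  let b := c.extendOfIsLattice K
  let g : N →ₗ[𝒪[K]] N := (f.restrictScalars 𝒪[K]).restrict hf
  have key : LinearMap.toMatrix b b f = (LinearMap.toMatrix c c g).map (algebraMap 𝒪[K] K) := by
    ext i j
    rw [LinearMap.toMatrix_apply, Matrix.map_apply, LinearMap.toMatrix_apply]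
    have h1 : f (b j) = ∑ k, algebraMap 𝒪[K] K (c.repr (g (c j)) k) • b k := by
      have h2 : b j = (c j : V) := Module.Basis.extendOfIsLattice_apply K c j
      have h3 : f (b j) = (g (c j) : V) := by rw [h2]; rfl
      rw [h3]
      conv_lhs => rw [← c.sum_repr (g (c j))]
      rw [AddSubmonoidClass.coe_finsetSum]
      refine Finset.sum_congr rfl fun k _ => ?_
      rw [algebraMap_smul, Module.Basis.extendOfIsLattice_apply]
      rfl
    rw [h1, map_sum, Finsupp.finsetSum_apply]
    simp only [map_smul, Module.Basis.repr_self, Finsupp.smul_apply, Finsupp.single_apply]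
    simp
  rw [← LinearMap.det_toMatrix b, key]
  have := RingHom.map_det (algebraMap 𝒪[K] K) (LinearMap.toMatrix c c g)
  rw [RingHom.mapMatrix_apply] at this
  rw [← this]
  exact Subtype.property _

variable {D : Type*} [DivisionRing D] [Algebra K D] [FiniteDimensional K D]

/-- Left multiplication by `x` preserves the lattice generated over `𝒪[K][x]` by a `K`-basis of `D`.
-/
lemma norm_mem_integer_of_isIntegral {x : D} (hx : IsIntegral 𝒪[K] x) :
    Algebra.norm K x ∈ 𝒪[K] := by
  let b := Module.finBasis K D
  let N : Submodule 𝒪[K] D :=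
    Subalgebra.toSubmodule (Algebra.adjoin 𝒪[K] {x}) * Submodule.span 𝒪[K] (Set.range b)
  have hN : Submodule.IsLattice K N := by
    refine ⟨hx.fg_adjoin_singleton.mul (Submodule.fg_span (Set.finite_range _)), ?_⟩
    rw [eq_top_iff, ← b.span_eq, Submodule.span_le]
    rintro _ ⟨i, rfl⟩
    refine Submodule.subset_span ?_
    rw [← one_mul (b i)]
    exact Submodule.mul_mem_mul (Subalgebra.one_mem _) (Submodule.subset_span ⟨i, rfl⟩)
  rw [Algebra.norm_apply]
  refine det_mem_integer_of_stable_lattice N _ fun v hv => ?_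
  change x * v ∈ N
  induction hv using Submodule.mul_induction_on' with
  | mem_mul_mem m hm n hn =>
    rw [← mul_assoc]
    exact Submodule.mul_mem_mul
      (Subalgebra.mul_mem _ (Algebra.self_mem_adjoin_singleton _ _) hm) hn
  | add y _ z _ hy hz => rw [mul_add]; exact add_mem hy hz

/-- All powers of `x` have integral norm, so `𝒪[K][x]` lies in the finitely generated module of
`exists_fg_of_norm_mem`. -/
lemma isIntegral_of_norm_mem_integer {x : D} (hx : Algebra.norm K x ∈ 𝒪[K]) :
    IsIntegral 𝒪[K] x := by
  obtain ⟨M, hM, h⟩ := exists_fg_of_norm_mem K D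
  have hle : Subalgebra.toSubmodule (Algebra.adjoin 𝒪[K] {x}) ≤ M := by
    rw [Algebra.adjoin_eq_span, Submodule.span_le]
    intro y hy
    obtain ⟨k, rfl⟩ := Submonoid.mem_closure_singleton.mp hy
    exact h _ (by rw [map_pow]; exact pow_mem hx k)
  exact IsIntegral.of_mem_of_fg _ (hM.of_le hle) x (Algebra.self_mem_adjoin_singleton _ _)

lemma isIntegral_iff_norm_mem_integer {x : D} :
    IsIntegral 𝒪[K] x ↔ Algebra.norm K x ∈ 𝒪[K] :=
  ⟨norm_mem_integer_of_isIntegral, isIntegral_of_norm_mem_integer⟩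

lemma isIntegral_mul {x y : D} (hx : IsIntegral 𝒪[K] x) (hy : IsIntegral 𝒪[K] y) :
    IsIntegral 𝒪[K] (x * y) := by
  rw [isIntegral_iff_norm_mem_integer, map_mul] at *
  exact mul_mem hx hy

lemma isIntegral_or_isIntegral_inv (x : D) : IsIntegral 𝒪[K] x ∨ IsIntegral 𝒪[K] x⁻¹ := by
  rw [isIntegral_iff_norm_mem_integer, isIntegral_iff_norm_mem_integer]
  have h : Algebra.norm K x⁻¹ = (Algebra.norm K x)⁻¹ := by
    by_cases hx : x = 0
    · simp [hx]
    · exact eq_inv_of_mul_eq_one_left (by rw [← map_mul, inv_mul_cancel₀ hx, map_one])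
  rw [h]
  exact mem_integer_or_inv_mem _

lemma isIntegral_add_one {x : D} (hx : IsIntegral 𝒪[K] x) : IsIntegral 𝒪[K] (x + 1) := by
  refine IsIntegral.of_mem_of_fg _ hx.fg_adjoin_singleton _ ?_
  exact add_mem (Algebra.self_mem_adjoin_singleton _ _) (one_mem _)

/-- As `D` need not be commutative, this is not formal. One of `x y⁻¹` and its inverse is integral,
and the sum factors as `(x y⁻¹ + 1) y` or symmetrically. -/
lemma isIntegral_add {x y : D} (hx : IsIntegral 𝒪[K] x) (hy : IsIntegral 𝒪[K] y) :
    IsIntegral 𝒪[K] (x + y) := by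
  by_cases hx0 : x = 0
  · simpa [hx0] using hy
  by_cases hy0 : y = 0
  · simpa [hy0] using hx
  rcases isIntegral_or_isIntegral_inv (K := K) (x * y⁻¹) with h | h
  · have := isIntegral_mul (isIntegral_add_one h) hy
    rwa [add_mul, mul_assoc, inv_mul_cancel₀ hy0, mul_one, one_mul] at this
  · have := isIntegral_mul (isIntegral_add_one h) hx
    rwa [mul_inv_rev, inv_inv, add_mul, mul_assoc, inv_mul_cancel₀ hx0, mul_one, one_mul,
      add_comm] at this

variable (K D) in
/-- The ring of integers of a finite-dimensional division algebra over a local field. -/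
def integers : Subalgebra 𝒪[K] D where
  carrier := {x | IsIntegral 𝒪[K] x}
  mul_mem' := isIntegral_mul
  add_mem' := isIntegral_add
  algebraMap_mem' _ := isIntegral_algebraMap

lemma mem_integers {x : D} : x ∈ integers K D ↔ IsIntegral 𝒪[K] x := Iff.rfl

lemma fg_integers : (Subalgebra.toSubmodule (integers K D)).FG := by
  obtain ⟨M, hM, h⟩ := exists_fg_of_norm_mem K D
  exact hM.of_le fun x hx => h x (norm_mem_integer_of_isIntegral hx)

variable (K) in
/-- The valuation of the norm of an element of a division algebra. -/
noncomputable def normOrd (x : D) : ℤ := ordBase (Algebra.norm K x)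

lemma normOrd_mul {x y : D} (hx : x ≠ 0) (hy : y ≠ 0) :
    normOrd K (x * y) = normOrd K x + normOrd K y := by
  unfold normOrd
  rw [map_mul, ordBase_mul] <;> simpa

lemma mem_integers_iff_normOrd {x : D} (hx : x ≠ 0) : x ∈ integers K D ↔ 0 ≤ normOrd K x := by
  rw [mem_integers, isIntegral_iff_norm_mem_integer, mem_integer_iff_ordBase (by simpa)]
  rfl

variable (K D) in
-- The inverse of a non-unit of `𝒪[K]` is not integral in `D`, because `𝒪[K]` is integrally closed.
lemma exists_normOrd_pos : ∃ d : ℕ, 0 < d ∧ ∃ x : D, x ≠ 0 ∧ normOrd K x = d := by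
  obtain ⟨t, ht0, ht⟩ := Valuation.IsNontrivial.exists_lt_one (v := valuation K)
  have ht0 : t ≠ 0 := by simpa using ht0
  have ht' : t⁻¹ ∉ 𝒪[K] := by
    rw [Valuation.mem_integer_iff, map_inv₀, not_le]
    exact (one_lt_inv₀ (zero_lt_iff.mpr (by simpa using ht0))).mpr ht
  let x : D := algebraMap K D t
  have hx : x ≠ 0 := by simpa [x] using ht0
  have hneg : ¬ 0 ≤ normOrd K x⁻¹ := by
    rw [← mem_integers_iff_normOrd (inv_ne_zero hx), mem_integers, ← map_inv₀]
    rw [isIntegral_algebraMap_iff (algebraMap K D).injective]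
    intro h
    obtain ⟨y, hy⟩ := IsIntegrallyClosed.isIntegral_iff.mp h
    exact ht' (hy ▸ y.2)
  have h1 : normOrd K (1 : D) = 0 := by
    have := normOrd_mul (K := K) (one_ne_zero (α := D)) one_ne_zero
    rw [mul_one] at this
    linarith
  have h2 := normOrd_mul (K := K) hx (inv_ne_zero hx)
  rw [mul_inv_cancel₀ hx, h1] at h2
  exact ⟨(normOrd K x).toNat, by omega, x, hx, by omega⟩

open Classical in
variable (K D) in
/-- The smallest positive valuation of a norm from a division algebra. -/
noncomputable def normStep : ℕ := Nat.find (exists_normOrd_pos K D)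

variable (K D) in
lemma normStep_spec : 0 < normStep K D ∧ ∃ x : D, x ≠ 0 ∧ normOrd K x = normStep K D := by
  classical exact Nat.find_spec (exists_normOrd_pos K D)

lemma normStep_le {x : D} (hx : x ≠ 0) (h : 0 < normOrd K x) :
    (normStep K D : ℤ) ≤ normOrd K x := by
  classical
  have : normStep K D ≤ (normOrd K x).toNat :=
    Nat.find_min' (exists_normOrd_pos K D) ⟨by omega, x, hx, by omega⟩
  omega

variable (K) in
/-- The normalized valuation of a division algebra, with the convention `ord K 0 = 0`. -/
noncomputable def ord (x : D) : ℤ := normOrd K x / normStep K D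

lemma normOrd_one : normOrd K (1 : D) = 0 := by
  have := normOrd_mul (K := K) (one_ne_zero (α := D)) one_ne_zero
  rw [mul_one] at this
  linarith

lemma normOrd_inv {x : D} (hx : x ≠ 0) : normOrd K x⁻¹ = -normOrd K x := by
  have := normOrd_mul (K := K) hx (inv_ne_zero hx)
  rw [mul_inv_cancel₀ hx, normOrd_one] at this
  linarith

lemma normOrd_zpow {x : D} (hx : x ≠ 0) (k : ℤ) : normOrd K (x ^ k) = k * normOrd K x := by
  have hnat : ∀ m : ℕ, normOrd K (x ^ m) = m * normOrd K x := by
    intro m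
    induction m with
    | zero => simp [normOrd_one]
    | succ m ih =>
      rw [pow_succ, normOrd_mul (pow_ne_zero _ hx) hx, ih]
      push_cast
      ring
  cases k with
  | ofNat m => simpa using hnat m
  | negSucc m =>
    rw [zpow_negSucc, normOrd_inv (pow_ne_zero _ hx), hnat, Int.negSucc_eq]
    push_cast
    ring

/-- Euclidean division: dividing `x` by a power of an element of minimal positive value leaves the
remainder as a value, which minimality forces to be zero. -/
lemma normStep_dvd {x : D} (hx : x ≠ 0) : (normStep K D : ℤ) ∣ normOrd K x := by
  obtain ⟨hd, y, hy, hyd⟩ := normStep_spec K D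
  rw [Int.dvd_iff_emod_eq_zero]
  by_contra hne
  set k := normOrd K x / normStep K D
  have hval : normOrd K (x * y ^ (-k)) = normOrd K x % normStep K D := by
    rw [normOrd_mul hx (zpow_ne_zero _ hy), normOrd_zpow hy, hyd, Int.emod_def]
    ring
  have hlt := Int.emod_lt_of_pos (normOrd K x) (b := normStep K D) (by exact_mod_cast hd)
  have hnn := Int.emod_nonneg (normOrd K x) (b := normStep K D) (by exact_mod_cast hd.ne')
  have := normStep_le (K := K) (mul_ne_zero hx (zpow_ne_zero (-k) hy)) (by omega)
  omega

lemma normOrd_eq {x : D} (hx : x ≠ 0) : normOrd K x = normStep K D * ord K x :=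
  (Int.mul_ediv_cancel' (normStep_dvd hx)).symm

lemma normStep_pos : 0 < (normStep K D : ℤ) := by exact_mod_cast (normStep_spec K D).1

lemma ord_mul {x y : D} (hx : x ≠ 0) (hy : y ≠ 0) : ord K (x * y) = ord K x + ord K y := by
  have h := normOrd_mul (K := K) hx hy
  rw [normOrd_eq hx, normOrd_eq hy, normOrd_eq (mul_ne_zero hx hy), ← mul_add] at h
  exact mul_left_cancel₀ normStep_pos.ne' h

lemma mem_integers_iff {x : D} : x ∈ integers K D ↔ x = 0 ∨ 0 ≤ ord K x := by
  by_cases hx : x = 0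
  · simp [hx]
  · rw [mem_integers_iff_normOrd hx, normOrd_eq hx, mul_nonneg_iff_of_pos_left normStep_pos]
    simp [hx]

@[simp]
lemma ord_one : ord K (1 : D) = 0 := by
  have := ord_mul (K := K) (one_ne_zero (α := D)) one_ne_zero
  rw [mul_one] at this
  linarith

lemma ord_inv {x : D} (hx : x ≠ 0) : ord K x⁻¹ = -ord K x := by
  have := ord_mul (K := K) hx (inv_ne_zero hx)
  rw [mul_inv_cancel₀ hx, ord_one] at this
  linarith

lemma ord_zpow {x : D} (hx : x ≠ 0) (k : ℤ) : ord K (x ^ k) = k * ord K x := by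
  have h := normOrd_zpow (K := K) hx k
  rw [normOrd_eq hx, normOrd_eq (zpow_ne_zero _ hx), mul_left_comm] at h
  exact mul_left_cancel₀ normStep_pos.ne' h

lemma ord_pow {x : D} (hx : x ≠ 0) (k : ℕ) : ord K (x ^ k) = k * ord K x := by
  simpa using ord_zpow hx k

variable (K D) in
lemma exists_ord_eq_one : ∃ x : D, x ≠ 0 ∧ ord K x = 1 := by
  obtain ⟨hd, y, hy, hyd⟩ := normStep_spec K D
  exact ⟨y, hy, by rw [ord, hyd, Int.ediv_self (by exact_mod_cast hd.ne')]⟩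

variable (K D) in
/-- The fractional ideal of elements of valuation at least `k`. -/
def fil (k : ℤ) : Submodule 𝒪[K] D where
  carrier := {x | x = 0 ∨ k ≤ ord K x}
  zero_mem' := Or.inl rfl
  add_mem' {x y} hx hy := by
    obtain ⟨p, hp, hp1⟩ := exists_ord_eq_one K D
    -- Scaling by a power of a uniformizer reduces the claim to additivity of the ring of integers.
    have key : ∀ z : D, (z = 0 ∨ k ≤ ord K z) ↔ p ^ (-k) * z ∈ integers K D := by
      intro z
      by_cases hz : z = 0
      · simp [hz]
      · rw [mem_integers_iff, ord_mul (zpow_ne_zero _ hp) hz, ord_zpow hp, hp1]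
        simp [hz, zpow_ne_zero _ hp]
    have hx' := (key x).mp hx
    have hy' := (key y).mp hy
    refine (key (x + y)).mpr ?_
    rw [mul_add]
    exact add_mem hx' hy'
  smul_mem' c x hx := by
    rcases hx with rfl | hx
    · exact Or.inl (smul_zero _)
    · by_cases hc : algebraMap 𝒪[K] D c = 0
      · exact Or.inl (by rw [Algebra.smul_def, hc, zero_mul])
      · by_cases hx0 : x = 0
        · exact Or.inl (by rw [hx0, smul_zero])
        · have h1 : algebraMap 𝒪[K] D c ∈ integers K D := Subalgebra.algebraMap_mem _ c
          rw [mem_integers_iff] at h1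
          refine Or.inr ?_
          rw [Algebra.smul_def, ord_mul hc hx0]
          have := h1.resolve_left hc
          omega

lemma mem_fil {k : ℤ} {x : D} : x ∈ fil K D k ↔ x = 0 ∨ k ≤ ord K x := Iff.rfl

lemma mem_fil_of_ne {k : ℤ} {x : D} (hx : x ≠ 0) : x ∈ fil K D k ↔ k ≤ ord K x := by
  simp [mem_fil, hx]

lemma mem_fil_ord (x : D) : x ∈ fil K D (ord K x) := Or.inr le_rfl

lemma mem_integers_iff_fil {x : D} : x ∈ integers K D ↔ x ∈ fil K D 0 := mem_integers_iff

lemma fil_zero : fil K D 0 = Subalgebra.toSubmodule (integers K D) := by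
  ext x
  exact mem_integers_iff_fil.symm

lemma fil_mono {a b : ℤ} (h : a ≤ b) : fil K D b ≤ fil K D a := by
  rintro x (rfl | hx)
  · exact zero_mem _
  · exact Or.inr (h.trans hx)

lemma mul_mem_fil {a b : ℤ} {x y : D} (hx : x ∈ fil K D a) (hy : y ∈ fil K D b) :
    x * y ∈ fil K D (a + b) := by
  by_cases hx0 : x = 0
  · simp [hx0]
  by_cases hy0 : y = 0
  · simp [hy0]
  rw [mem_fil_of_ne hx0] at hx
  rw [mem_fil_of_ne hy0] at hy
  rw [mem_fil_of_ne (mul_ne_zero hx0 hy0), ord_mul hx0 hy0]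
  omega

lemma mul_mem_fil_left {a : ℤ} {x y : D} (hx : x ∈ fil K D 0) (hy : y ∈ fil K D a) :
    x * y ∈ fil K D a := by
  simpa using mul_mem_fil hx hy

lemma mul_mem_fil_right {a : ℤ} {x y : D} (hx : x ∈ fil K D a) (hy : y ∈ fil K D 0) :
    x * y ∈ fil K D a := by
  simpa using mul_mem_fil hx hy

lemma mul_mem_fil_iff_left {a : ℤ} {x y : D} (hx : x ≠ 0) :
    x * y ∈ fil K D a ↔ y ∈ fil K D (a - ord K x) := by
  by_cases hy : y = 0
  · simp [hy]
  rw [mem_fil_of_ne hy, mem_fil_of_ne (mul_ne_zero hx hy), ord_mul hx hy]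
  omega

lemma mul_mem_fil_iff_right {a : ℤ} {x y : D} (hy : y ≠ 0) :
    x * y ∈ fil K D a ↔ x ∈ fil K D (a - ord K y) := by
  by_cases hx : x = 0
  · simp [hx]
  rw [mem_fil_of_ne hx, mem_fil_of_ne (mul_ne_zero hx hy), ord_mul hx hy]
  omega

lemma one_mem_fil : (1 : D) ∈ fil K D 0 := Or.inr (by simp)

lemma pow_mem_fil {a : ℤ} {x : D} (hx : x ∈ fil K D a) (k : ℕ) : x ^ k ∈ fil K D (k * a) := by
  induction k with
  | zero => simpa using one_mem_fil
  | succ k ih =>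
    rw [pow_succ]
    convert mul_mem_fil ih hx using 2
    push_cast
    ring

lemma zpow_mem_fil {x : D} (hx : x ≠ 0) (h1 : ord K x = 1) (k : ℤ) : x ^ k ∈ fil K D k :=
  Or.inr (by rw [ord_zpow hx, h1, mul_one])

lemma ord_eq_of_mem_fil {a : ℤ} {x : D} (h : x ∈ fil K D a) (h' : x ∉ fil K D (a + 1)) :
    ord K x = a := by
  have hx : x ≠ 0 := by rintro rfl; exact h' (zero_mem _)
  rw [mem_fil_of_ne hx] at h h'
  omega

lemma not_mem_fil_of_lt {a : ℤ} {x : D} (hx : x ≠ 0) (h : ord K x < a) : x ∉ fil K D a := by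
  rw [mem_fil_of_ne hx]
  omega

lemma ord_eq_of_sub_mem {x y : D} {a : ℤ} (hx : x ≠ 0) (h : ord K x < a)
    (hxy : x - y ∈ fil K D a) : ord K y = ord K x := by
  have hy : y = x - (x - y) := by abel
  refine ord_eq_of_mem_fil ?_ ?_
  · rw [hy]
    exact sub_mem (mem_fil_ord x) (fil_mono (by omega) hxy)
  · intro h'
    have : x ∈ fil K D (ord K x + 1) := by
      have := add_mem (fil_mono (show ord K x + 1 ≤ a by omega) hxy) h'
      rwa [sub_add_cancel] at this
    rw [mem_fil_of_ne hx] at this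
    omega

lemma eq_zero_of_forall_mem_fil {x : D} (h : ∀ k : ℕ, x ∈ fil K D k) : x = 0 := by
  by_contra hx
  have := (mem_fil_of_ne hx).mp (h ((ord K x).toNat + 1))
  push_cast at this
  omega

/-- Translates the uniformizers occurring in the neighbor relation into valuations. -/
lemma isUniformizer_iff {p : D} : IsUniformizer K p ↔ p ≠ 0 ∧ ord K p = 1 := by
  constructor
  · rintro ⟨h0, h1, h2, h3⟩
    refine ⟨h0, ?_⟩
    change p ∈ integers K D at h1
    change p⁻¹ ∉ integers K D at h2
    rw [mem_integers_iff] at h1 h2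
    rw [ord_inv h0] at h2
    have h1 := h1.resolve_left h0
    push Not at h2
    obtain ⟨y, hy, hy1⟩ := exists_ord_eq_one K D
    obtain ⟨c, hc, hyc⟩ := h3 y (mem_integers_iff.mpr (Or.inr (by omega))) (by
      intro h
      have := mem_integers_iff.mp h
      rw [ord_inv hy, hy1] at this
      simp [hy] at this)
    have hc0 : c ≠ 0 := by rintro rfl; simp [hy] at hyc
    have hc := (mem_integers_iff.mp hc).resolve_left hc0
    have := ord_mul (K := K) h0 hc0
    rw [← hyc] at this
    omega
  · rintro ⟨h0, h1⟩
    refine ⟨h0, mem_integers_iff.mpr (Or.inr (by omega)), fun h => ?_, fun b hb hb' => ?_⟩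
    · have := mem_integers_iff.mp h
      rw [ord_inv h0, h1] at this
      simp [h0] at this
    · refine ⟨p⁻¹ * b, ?_, by rw [mul_inv_cancel_left₀ h0]⟩
      by_cases hb0 : b = 0
      · simp [hb0, isIntegral_zero]
      refine mem_integers_iff.mpr (Or.inr ?_)
      rw [ord_mul (inv_ne_zero h0) hb0, ord_inv h0, h1]
      change b⁻¹ ∉ integers K D at hb'
      change b ∈ integers K D at hb
      rw [mem_integers_iff] at hb hb'
      rw [ord_inv hb0] at hb'
      push Not at hb'
      have := hb.resolve_left hb0
      omega

end Integers

/-! ### Indices of images of injective endomorphisms. -/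

section Index

lemma index_range_comp {X : Type*} [AddCommGroup X] (g h : X →+ X) (hg : Function.Injective g) :
    (g.comp h).range.index = g.range.index * h.range.index := by
  have hle : (g.comp h).range ≤ g.range := by
    rintro _ ⟨x, rfl⟩
    exact ⟨h x, rfl⟩
  have h1 : (g.comp h).range.relIndex g.range = h.range.index := by
    have := AddSubgroup.relIndex_map_map_of_injective h.range ⊤ hg
    rw [AddSubgroup.relIndex_top_right, ← AddMonoidHom.range_eq_map] at this
    rw [← this, AddMonoidHom.range_eq_map, ← AddSubgroup.map_map, ← AddMonoidHom.range_eq_map]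
  rw [← AddSubgroup.relIndex_mul_index hle, h1, mul_comm]

lemma index_range_pow {X : Type*} [AddCommGroup X] (g : AddMonoid.End X)
    (hg : Function.Injective g) (e : ℕ) :
    (AddMonoidHom.range (g ^ e)).index = (AddMonoidHom.range g).index ^ e := by
  induction e with
  | zero =>
    rw [pow_zero, pow_zero, AddSubgroup.index_eq_one, eq_top_iff]
    intro x _
    exact ⟨x, rfl⟩
  | succ e ih =>
    rw [pow_succ', pow_succ', ← ih]
    exact index_range_comp g (g ^ e) hg

variable {K : Type*} [Field K] [ValuativeRel K] [TopologicalSpace K] [IsNonarchimedeanLocalField K]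

lemma card_quotient_maximalIdeal_smul (X : Type*) [AddCommGroup X] [Module 𝒪[K] X]
    [Module.Free 𝒪[K] X] [Module.Finite 𝒪[K] X] :
    Nat.card (X ⧸ (𝓂[K] • ⊤ : Submodule 𝒪[K] X)) =
      Nat.card 𝓀[K] ^ Module.finrank 𝒪[K] X := by
  rw [← Nat.card_congr (TensorProduct.quotTensorEquivQuotSMul X 𝓂[K]).toEquiv]
  change Nat.card (TensorProduct 𝒪[K] 𝓀[K] X) = _
  rw [Module.natCard_eq_pow_finrank (K := 𝓀[K]), Module.finrank_baseChange]

/-- Indices of images multiply under composition of injective maps, and `ϖ X` has index `q ^ rank`.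
This is the counting behind `e f = [D : K]`, applied to multiplication by a uniformizer both on
`𝒪_D` and on lattices in eigenspaces. -/
lemma index_pow_eq_of_pow_eq {X : Type*} [AddCommGroup X] [Module 𝒪[K] X]
    [Module.Free 𝒪[K] X] [Module.Finite 𝒪[K] X] {ϖ : 𝒪[K]} (hϖ : Irreducible ϖ)
    (g : AddMonoid.End X) (hg : Function.Injective g) (e : ℕ)
    (h : ∀ x : X, (∃ y, (g ^ e) y = x) ↔ ∃ y, ϖ • y = x) :
    (AddMonoidHom.range g).index ^ e = Nat.card 𝓀[K] ^ Module.finrank 𝒪[K] X := by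
  rw [← index_range_pow g hg, ← card_quotient_maximalIdeal_smul]
  have : AddMonoidHom.range (g ^ e) = (𝓂[K] • ⊤ : Submodule 𝒪[K] X).toAddSubgroup := by
    ext x
    rw [hϖ.maximalIdeal_eq, Submodule.ideal_span_singleton_smul, Submodule.mem_toAddSubgroup,
      Submodule.mem_smul_pointwise_iff_exists]
    exact (h x).trans (by simp)
  rw [this]
  rfl

end Index

/-! ### The residue ring and its cardinality. -/

section Residue

variable {K : Type*} [Field K] [ValuativeRel K] [TopologicalSpace K] [IsNonarchimedeanLocalField K]
  {D : Type*} [DivisionRing D] [Algebra K D] [FiniteDimensional K D]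

variable (D) in
/-- The ramification index of a division algebra: the valuation of a uniformizer of `K`. -/
noncomputable def ram (ϖ : 𝒪[K]) : ℕ := (ord K (algebraMap 𝒪[K] D ϖ)).toNat

lemma algebraMap_ne_zero_of_irreducible {ϖ : 𝒪[K]} (hϖ : Irreducible ϖ) :
    algebraMap 𝒪[K] D ϖ ≠ 0 := by
  rw [IsScalarTower.algebraMap_apply 𝒪[K] K D]
  simpa using hϖ.ne_zero

lemma algebraMap_isIntegral_iff {x : K} : algebraMap K D x ∈ integers K D ↔ x ∈ 𝒪[K] := by
  rw [mem_integers, isIntegral_algebraMap_iff (algebraMap K D).injective]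
  constructor
  · intro h
    obtain ⟨y, hy⟩ := IsIntegrallyClosed.isIntegral_iff.mp h
    exact hy ▸ y.2
  · intro h
    exact isIntegral_algebraMap (R := 𝒪[K]) (x := ⟨x, h⟩)

lemma ord_algebraMap_pos {ϖ : 𝒪[K]} (hϖ : Irreducible ϖ) :
    0 < ord K (algebraMap 𝒪[K] D ϖ) := by
  by_contra hle
  have h0 := algebraMap_ne_zero_of_irreducible (D := D) hϖ
  have : (algebraMap 𝒪[K] D ϖ)⁻¹ ∈ integers K D := by
    rw [mem_integers_iff, ord_inv h0]
    right; omega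
  rw [IsScalarTower.algebraMap_apply 𝒪[K] K D, ← map_inv₀, algebraMap_isIntegral_iff] at this
  refine hϖ.not_isUnit (IsUnit.of_mul_eq_one (⟨_, this⟩ : 𝒪[K]) (Subtype.ext ?_))
  exact mul_inv_cancel₀ (by simpa using hϖ.ne_zero)

lemma ram_pos {ϖ : 𝒪[K]} (hϖ : Irreducible ϖ) : 0 < ram D ϖ := by
  have := ord_algebraMap_pos (D := D) hϖ
  unfold ram
  omega

lemma ord_algebraMap_eq_ram {ϖ : 𝒪[K]} (hϖ : Irreducible ϖ) :
    ord K (algebraMap 𝒪[K] D ϖ) = ram D ϖ := by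
  have := ord_algebraMap_pos (D := D) hϖ
  unfold ram
  omega

variable (K D) in
/-- The maximal ideal of the ring of integers of a division algebra. -/
def nonunits : Ideal (integers K D) where
  carrier := {x | (x : D) ∈ fil K D 1}
  zero_mem' := zero_mem (fil K D 1)
  add_mem' {x y} hx hy := (fil K D 1).add_mem (x := (x : D)) (y := (y : D)) hx hy
  smul_mem' c _ hx := mul_mem_fil_left (mem_integers_iff_fil.mp c.2) hx

lemma mem_nonunits {x : integers K D} : x ∈ nonunits K D ↔ (x : D) ∈ fil K D 1 := Iff.rfl

instance : (nonunits K D).IsTwoSided where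
  mul_mem_of_left {_} b ha := mul_mem_fil_right ha (mem_integers_iff_fil.mp b.2)

/-- An integer outside the maximal ideal has valuation zero, so multiplying by it does not change
membership in the ideal. Together with finiteness, this makes the residue ring a field. -/
instance : IsDomain (integers K D ⧸ nonunits K D) := by
  have h1 : Nontrivial (integers K D ⧸ nonunits K D) := by
    refine ⟨⟨Ideal.Quotient.mk _ 1, 0, fun h => ?_⟩⟩
    rw [Ideal.Quotient.eq_zero_iff_mem, mem_nonunits] at h
    exact not_mem_fil_of_lt one_ne_zero (by simp) h
  have h2 : NoZeroDivisors (integers K D ⧸ nonunits K D) := by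
    refine ⟨fun {a b} hab => ?_⟩
    obtain ⟨x, rfl⟩ := Ideal.Quotient.mk_surjective a
    obtain ⟨y, rfl⟩ := Ideal.Quotient.mk_surjective b
    rw [← map_mul, Ideal.Quotient.eq_zero_iff_mem, mem_nonunits] at hab
    rw [Ideal.Quotient.eq_zero_iff_mem, Ideal.Quotient.eq_zero_iff_mem, mem_nonunits, mem_nonunits]
    by_cases hx : (x : D) = 0
    · left; rw [hx]; exact zero_mem _
    by_cases hxu : 1 ≤ ord K (x : D)
    · left; exact Or.inr hxu
    · right
      have hx' := (mem_integers_iff.mp x.2).resolve_left hx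
      have : ord K (x : D) = 0 := by omega
      have hab : (x : D) * y ∈ fil K D 1 := hab
      rwa [mul_mem_fil_iff_left hx, this, sub_zero] at hab
  exact NoZeroDivisors.to_isDomain _

instance : Submodule.IsLattice K (Subalgebra.toSubmodule (integers K D)) where
  fg := fg_integers
  span_eq_top := by
    obtain ⟨ϖ, hϖ⟩ := IsDiscreteValuationRing.exists_irreducible 𝒪[K]
    rw [eq_top_iff]
    intro x _
    have h0 := algebraMap_ne_zero_of_irreducible (D := D) hϖ
    have hpos := ord_algebraMap_pos (D := D) hϖ
    set N := (-ord K x).toNat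
    have hmem : algebraMap 𝒪[K] D ϖ ^ N * x ∈ integers K D := by
      by_cases hx : x = 0
      · simp [hx]
      rw [mem_integers_iff, ord_mul (pow_ne_zero _ h0) hx, ord_pow h0]
      right
      have : (N : ℤ) ≤ N * ord K (algebraMap 𝒪[K] D ϖ) := by nlinarith
      omega
    have hK : (algebraMap 𝒪[K] K ϖ) ≠ 0 := by simpa using hϖ.ne_zero
    have : x = ((algebraMap 𝒪[K] K ϖ) ^ N)⁻¹ • (algebraMap 𝒪[K] D ϖ ^ N * x) := by
      rw [IsScalarTower.algebraMap_apply 𝒪[K] K D, ← map_pow (algebraMap K D), ← Algebra.smul_def,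
        smul_smul,
        inv_mul_cancel₀ (pow_ne_zero _ hK), one_smul]
    rw [this]
    exact Submodule.smul_mem _ _ (Submodule.subset_span hmem)

instance : Module.Finite 𝒪[K] (integers K D) :=
  Submodule.IsLattice.finite (A := K) (M := Subalgebra.toSubmodule (integers K D))

instance : Module.Free 𝒪[K] (integers K D) :=
  Submodule.IsLattice.free K (Subalgebra.toSubmodule (integers K D))

variable (K D) in
lemma finrank_integers : Module.finrank 𝒪[K] (integers K D) = Module.finrank K D := by
  have := Submodule.IsLattice.rank' K (Subalgebra.toSubmodule (integers K D))
  exact congrArg Cardinal.toNat this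

lemma exists_mul_pow_of_mem_fil {ϖ : 𝒪[K]} (hϖ : Irreducible ϖ) {x : D} (i : ℕ)
    (hx : x ∈ fil K D (ram D ϖ * i)) : ∃ y ∈ integers K D, x = ϖ ^ i • y := by
  have h0 := algebraMap_ne_zero_of_irreducible (D := D) hϖ
  refine ⟨(algebraMap 𝒪[K] D ϖ ^ i)⁻¹ * x, ?_, ?_⟩
  · rw [mem_integers_iff_fil, mul_mem_fil_iff_left (inv_ne_zero (pow_ne_zero _ h0)),
      ord_inv (pow_ne_zero _ h0), ord_pow h0, ord_algebraMap_eq_ram hϖ]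
    convert hx using 2
    ring
  · rw [Algebra.smul_def, map_pow, mul_inv_cancel_left₀ (pow_ne_zero _ h0)]

/-- Multiplication by a uniformizer `p` of `D` has the maximal ideal as image, and `p ^ e` has the
same image as `ϖ` because they have the same valuation. -/
lemma card_residue_pow_ram {ϖ : 𝒪[K]} (hϖ : Irreducible ϖ) :
    Nat.card (integers K D ⧸ nonunits K D) ^ ram D ϖ =
      Nat.card 𝓀[K] ^ Module.finrank K D := by
  obtain ⟨p, hp, hp1⟩ := exists_ord_eq_one K D
  have hpO : p ∈ integers K D := mem_integers_iff.mpr (Or.inr (by omega))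
  let P : integers K D := ⟨p, hpO⟩
  let g : AddMonoid.End (integers K D) := AddMonoidHom.mulLeft P
  have hpow : ∀ (k : ℕ) (y : integers K D), (((g ^ k) y : integers K D) : D) = p ^ k * y := by
    intro k
    induction k with
    | zero => intro y; simp
    | succ k ih =>
      intro y
      rw [pow_succ', pow_succ', mul_assoc, ← ih]
      rfl
  have hg : Function.Injective g := by
    intro x y hxy
    have : p * (x : D) = p * y := congrArg Subtype.val hxy
    exact Subtype.ext (mul_left_cancel₀ hp this)
  rw [← finrank_integers K D, ← index_pow_eq_of_pow_eq hϖ g hg]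
  · congr 1
    have : AddMonoidHom.range g = (nonunits K D).toAddSubgroup := by
      ext x
      constructor
      · rintro ⟨y, rfl⟩
        change p * (y : D) ∈ fil K D 1
        rw [mul_mem_fil_iff_left hp, hp1]
        exact mem_integers_iff_fil.mp y.2
      · intro hx
        have hx : (x : D) ∈ fil K D 1 := hx
        have hy : p⁻¹ * (x : D) ∈ integers K D := by
          rw [mem_integers_iff_fil, mul_mem_fil_iff_left (inv_ne_zero hp), ord_inv hp, hp1]
          simpa using hx
        exact ⟨⟨_, hy⟩, Subtype.ext (mul_inv_cancel_left₀ hp _)⟩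
    rw [this]
    rfl
  · intro x
    have h0 := algebraMap_ne_zero_of_irreducible (D := D) hϖ
    constructor
    · rintro ⟨y, rfl⟩
      obtain ⟨z, hz, hz'⟩ := exists_mul_pow_of_mem_fil hϖ (x := p ^ (ram D ϖ) * y) 1 (by
        refine mul_mem_fil_right ?_ (mem_integers_iff_fil.mp y.2)
        simpa [hp1] using pow_mem_fil (mem_fil_ord (K := K) p) (ram D ϖ))
      refine ⟨⟨z, hz⟩, Subtype.ext ?_⟩
      rw [hpow, hz', pow_one]
      rfl
    · rintro ⟨y, rfl⟩
      have hz : (p ^ (ram D ϖ))⁻¹ * (algebraMap 𝒪[K] D ϖ * (y : D)) ∈ integers K D := by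
        rw [mem_integers_iff_fil, mul_mem_fil_iff_left (inv_ne_zero (pow_ne_zero _ hp)),
          ord_inv (pow_ne_zero _ hp), ord_pow hp, hp1, mul_mem_fil_iff_left h0,
          ord_algebraMap_eq_ram hϖ]
        simpa using mem_integers_iff_fil.mp y.2
      refine ⟨⟨_, hz⟩, Subtype.ext ?_⟩
      rw [hpow]
      simp only
      rw [mul_inv_cancel_left₀ (pow_ne_zero _ hp), ← Algebra.smul_def]
      rfl

instance : Finite (integers K D ⧸ nonunits K D) := by
  obtain ⟨ϖ, hϖ⟩ := IsDiscreteValuationRing.exists_irreducible 𝒪[K]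
  refine Nat.finite_of_card_ne_zero fun h => ?_
  have := card_residue_pow_ram (D := D) hϖ
  rw [h, zero_pow (ram_pos hϖ).ne'] at this
  exact pow_ne_zero _ Nat.card_pos.ne' this.symm

end Residue

/-! ### Completeness and Teichmüller representatives. -/

section Teichmuller

variable {K : Type*} [Field K] [ValuativeRel K] [TopologicalSpace K] [IsNonarchimedeanLocalField K]
  {D : Type*} [DivisionRing D] [Algebra K D] [FiniteDimensional K D]

lemma exists_limit_integer (f : ℕ → 𝒪[K]) (hf : ∀ i, f (i + 1) - f i ∈ 𝓂[K] ^ i) :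
    ∃ a : 𝒪[K], ∀ i, a - f i ∈ 𝓂[K] ^ i := by
  let := IsTopologicalAddGroup.rightUniformSpace K
  have := isUniformAddGroup_of_addCommGroup (G := K)
  have hstep : ∀ i k, f (i + k) - f i ∈ 𝓂[K] ^ i := by
    intro i k
    induction k with
    | zero => simp
    | succ k ih =>
      have := add_mem (Ideal.pow_le_pow_right (Nat.le_add_right i k) (hf (i + k))) ih
      rwa [sub_add_sub_cancel] at this
  obtain ⟨a, ha⟩ := IsPrecomplete.prec (I := 𝓂[K]) (M := 𝒪[K]) inferInstance (f := f) (by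
    intro m n hmn
    obtain ⟨k, rfl⟩ := Nat.exists_eq_add_of_le hmn
    rw [SModEq.sub_mem, smul_eq_mul, Ideal.mul_top, ← neg_mem_iff, neg_sub]
    exact hstep m k)
  refine ⟨a, fun i => ?_⟩
  have := ha i
  rwa [SModEq.sub_mem, smul_eq_mul, Ideal.mul_top, ← neg_mem_iff, neg_sub] at this

/-- Elements of valuation at least `e i` are divisible by `ϖ ^ i`, so the coordinates in an
`𝒪[K]`-basis are Cauchy sequences in `𝒪[K]`. -/
lemma exists_limit_integers {ϖ : 𝒪[K]} (hϖ : Irreducible ϖ) (s : ℕ → D)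
    (hs : ∀ i, s i ∈ integers K D) (h : ∀ i : ℕ, s (i + 1) - s i ∈ fil K D (ram D ϖ * i)) :
    ∃ t ∈ integers K D, ∀ i : ℕ, t - s i ∈ fil K D (ram D ϖ * i) := by
  let c := Module.Free.chooseBasis 𝒪[K] (integers K D)
  let S : ℕ → integers K D := fun i => ⟨s i, hs i⟩
  have hlim : ∀ k, ∃ a : 𝒪[K], ∀ i, a - c.repr (S i) k ∈ 𝓂[K] ^ i := by
    intro k
    refine exists_limit_integer _ fun i => ?_
    obtain ⟨y, hy, hy'⟩ := exists_mul_pow_of_mem_fil hϖ i (h i)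
    have : S (i + 1) - S i = ϖ ^ i • (⟨y, hy⟩ : integers K D) := Subtype.ext hy'
    rw [← Finsupp.sub_apply, ← map_sub, this, map_smul, Finsupp.smul_apply, smul_eq_mul,
      hϖ.maximalIdeal_eq, Ideal.span_singleton_pow]
    exact Ideal.mul_mem_right _ _ (Ideal.mem_span_singleton_self _)
  choose a ha using hlim
  refine ⟨(∑ k, a k • c k : integers K D), Subtype.property _, fun i => ?_⟩
  have h1 : (∑ k, a k • c k) - S i = ∑ k, (a k - c.repr (S i) k) • c k := by
    simp only [sub_smul, Finset.sum_sub_distrib, c.sum_repr]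
  have h2 : (((∑ k, a k • c k : integers K D) : D) - s i)
      = ∑ k, (a k - c.repr (S i) k) • (c k : D) := by
    have := congrArg (Subtype.val) h1
    simpa using this
  rw [h2]
  refine sum_mem fun k _ => ?_
  have := ha k i
  rw [hϖ.maximalIdeal_eq, Ideal.span_singleton_pow, Ideal.mem_span_singleton] at this
  obtain ⟨z, hz⟩ := this
  rw [hz, Algebra.smul_def, map_mul, map_pow]
  refine mul_mem_fil_right (mul_mem_fil_right ?_ ?_) (mem_integers_iff_fil.mp (c k).2)
  · have := pow_mem_fil (mem_fil_ord (K := K) (algebraMap 𝒪[K] D ϖ)) i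
    rwa [ord_algebraMap_eq_ram hϖ, mul_comm] at this
  · exact mem_integers_iff_fil.mp (Subalgebra.algebraMap_mem _ z)

lemma pow_sub_pow_mem_fil {m : ℤ} {x y : D} (hx : x ∈ fil K D 0) (hy : y ∈ fil K D 0)
    (h : x - y ∈ fil K D m) (k : ℕ) : x ^ k - y ^ k ∈ fil K D m := by
  induction k with
  | zero => simp
  | succ k ih =>
    have : x ^ (k + 1) - y ^ (k + 1) = x ^ k * (x - y) + (x ^ k - y ^ k) * y := by
      rw [pow_succ, pow_succ]; noncomm_ring
    rw [this]
    refine add_mem (mul_mem_fil_left ?_ h) (mul_mem_fil_right ih hy)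
    simpa using pow_mem_fil hx k

/-- The cofactor of `x - y` in `x ^ Q - y ^ Q` is congruent to `Q y ^ (Q - 1)`, hence to zero,
modulo the maximal ideal. -/
lemma pow_sub_pow_mem_fil_succ {m : ℤ} {x y : D} (hx : x ∈ fil K D 0) (hy : y ∈ fil K D 0)
    (hm : 1 ≤ m) (hxy : Commute x y) (h : x - y ∈ fil K D m) {Q : ℕ} (hQ : (Q : D) ∈ fil K D 1) :
    x ^ Q - y ^ Q ∈ fil K D (m + 1) := by
  rw [← hxy.mul_geom_sum₂ Q]
  refine mul_mem_fil h ?_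
  have : ∑ i ∈ Finset.range Q, x ^ i * y ^ (Q - 1 - i)
      = ∑ i ∈ Finset.range Q, (x ^ i - y ^ i) * y ^ (Q - 1 - i) + Q * y ^ (Q - 1) := by
    have h2 : (Q : D) * y ^ (Q - 1) = ∑ i ∈ Finset.range Q, y ^ i * y ^ (Q - 1 - i) := by
      rw [Finset.sum_congr rfl (g := fun _ => y ^ (Q - 1))]
      · simp
      · intro i hi
        rw [← pow_add]
        congr 1
        have := Finset.mem_range.mp hi
        omega
    rw [h2, ← Finset.sum_add_distrib]
    exact Finset.sum_congr rfl fun i _ => by rw [sub_mul, sub_add_cancel]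
  rw [this]
  refine add_mem (sum_mem fun i _ => mul_mem_fil_right ?_ ?_) (mul_mem_fil_right hQ ?_)
  · exact pow_sub_pow_mem_fil hx hy (fil_mono hm h) i
  · simpa using pow_mem_fil hy (Q - 1 - i)
  · simpa using pow_mem_fil hy (Q - 1)

variable (K D) in
/-- The cardinality of the residue field of a division algebra. -/
noncomputable def resCard : ℕ := Nat.card (integers K D ⧸ nonunits K D)

lemma resCard_pow_ram {ϖ : 𝒪[K]} (hϖ : Irreducible ϖ) :
    resCard K D ^ ram D ϖ = Nat.card 𝓀[K] ^ Module.finrank K D := card_residue_pow_ram hϖ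

variable (K D) in
lemma one_lt_resCard : 1 < resCard K D :=
  have : Nontrivial (integers K D ⧸ nonunits K D) := IsDomain.toNontrivial
  Finite.one_lt_card (α := integers K D ⧸ nonunits K D)

variable (K D) in
lemma resCard_cast_mem : (resCard K D : D) ∈ fil K D 1 := by
  have h : ((resCard K D : ℕ) : integers K D) ∈ nonunits K D := by
    rw [← Ideal.Quotient.eq_zero_iff_mem, map_natCast]
    let := Fintype.ofFinite (integers K D ⧸ nonunits K D)
    unfold resCard
    rw [Nat.card_eq_fintype_card]
    exact Nat.cast_card_eq_zero _
  simpa [mem_nonunits] using h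

lemma pow_resCard_sub_mem {x : D} (hx : x ∈ integers K D) : x ^ resCard K D - x ∈ fil K D 1 := by
  let := (Finite.isDomain_to_isField (integers K D ⧸ nonunits K D)).toField
  let := Fintype.ofFinite (integers K D ⧸ nonunits K D)
  have h := FiniteField.pow_card (Ideal.Quotient.mk (nonunits K D) ⟨x, hx⟩)
  rw [← Nat.card_eq_fintype_card, ← map_pow, Ideal.Quotient.mk_eq_mk_iff_sub_mem,
    mem_nonunits] at h
  exact h

variable (K D) in
lemma exists_residue_generator : ∃ a ∈ integers K D,
    (∀ x ∈ integers K D, x ∈ fil K D 1 ∨ ∃ j : ℕ, x - a ^ j ∈ fil K D 1) ∧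
    (∀ j : ℕ, a ^ j - 1 ∈ fil K D 1 → (resCard K D - 1) ∣ j) ∧ a ∉ fil K D 1 := by
  let := (Finite.isDomain_to_isField (integers K D ⧸ nonunits K D)).toField
  let := Fintype.ofFinite (integers K D ⧸ nonunits K D)
  obtain ⟨u, hu⟩ := IsCyclic.exists_generator (α := (integers K D ⧸ nonunits K D)ˣ)
  obtain ⟨a, ha⟩ := Ideal.Quotient.mk_surjective (u : integers K D ⧸ nonunits K D)
  refine ⟨a, a.2, fun x hx => ?_, fun j hj => ?_, fun h => ?_⟩
  · by_cases h0 : Ideal.Quotient.mk (nonunits K D) ⟨x, hx⟩ = 0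
    · left
      rwa [Ideal.Quotient.eq_zero_iff_mem, mem_nonunits] at h0
    · right
      obtain ⟨j, hj⟩ := (mem_powers_iff_mem_zpowers).mpr (hu (Units.mk0 _ h0))
      have hj' : (u : integers K D ⧸ nonunits K D) ^ j
          = Ideal.Quotient.mk (nonunits K D) ⟨x, hx⟩ := by
        have := congrArg Units.val hj
        simpa using this
      refine ⟨j, ?_⟩
      rw [← ha, ← map_pow, eq_comm, Ideal.Quotient.mk_eq_mk_iff_sub_mem, mem_nonunits] at hj'
      exact hj'
  · have h1 : (u : integers K D ⧸ nonunits K D) ^ j = 1 := by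
      rw [← ha, ← map_pow, ← map_one (Ideal.Quotient.mk (nonunits K D)),
        Ideal.Quotient.mk_eq_mk_iff_sub_mem, mem_nonunits]
      exact hj
    have h2 : u ^ j = 1 := Units.ext (by simpa using h1)
    have h3 := orderOf_dvd_of_pow_eq_one h2
    rwa [orderOf_eq_card_of_forall_mem_zpowers hu, Nat.card_units] at h3
  · rw [← mem_nonunits, ← Ideal.Quotient.eq_zero_iff_mem, ha] at h
    exact u.ne_zero h

variable (K) in
/-- `ζ` generates a group of Teichmüller representatives of the residue field of `D`. -/
structure IsTeichmuller (ζ : D) : Prop where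
  pow_eq_one : ζ ^ (resCard K D - 1) = 1
  exists_sub_mem : ∀ x ∈ integers K D, x ∈ fil K D 1 ∨ ∃ j : ℕ, x - ζ ^ j ∈ fil K D 1
  dvd_of_pow_sub_one_mem : ∀ j : ℕ, ζ ^ j - 1 ∈ fil K D 1 → (resCard K D - 1) ∣ j

variable (K D) in
-- For a lift `a` of a generator of the residual unit group, the powers `a ^ Q ^ j` converge; the
-- limit is congruent to `a` and is fixed by `t ↦ t ^ Q`.
theorem exists_isTeichmuller : ∃ ζ : D, IsTeichmuller K ζ := by
  obtain ⟨ϖ, hϖ⟩ := IsDiscreteValuationRing.exists_irreducible 𝒪[K]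
  obtain ⟨a, haO, ha1, ha2, ha3⟩ := exists_residue_generator K D
  set Q := resCard K D with hQ
  have hQ1 : 1 < Q := one_lt_resCard K D
  have ha0 : a ∈ fil K D 0 := mem_integers_iff_fil.mp haO
  have hstep : ∀ j : ℕ, a ^ Q ^ (j + 1) - a ^ Q ^ j ∈ fil K D (j + 1) := by
    intro j
    induction j with
    | zero => simpa using pow_resCard_sub_mem haO
    | succ j ih =>
      have := pow_sub_pow_mem_fil_succ (by simpa using pow_mem_fil ha0 _)
        (by simpa using pow_mem_fil ha0 _) (by omega)
        ((Commute.refl a).pow_pow (Q ^ (j + 1)) (Q ^ j)) ih (resCard_cast_mem K D)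
      rw [← pow_mul, ← pow_mul, ← hQ, ← pow_succ, ← pow_succ] at this
      exact_mod_cast this
  have hstep' : ∀ i k : ℕ, a ^ Q ^ (i + k) - a ^ Q ^ i ∈ fil K D (i + 1) := by
    intro i k
    induction k with
    | zero => simp
    | succ k ih =>
      have := add_mem (fil_mono (show (i : ℤ) + 1 ≤ (i + k : ℕ) + 1 by push_cast; omega)
        (hstep (i + k))) ih
      rwa [sub_add_sub_cancel] at this
  set e := ram D ϖ with he
  have he1 : 0 < e := ram_pos hϖ
  -- Taking every `e`-th term makes consecutive terms agree modulo `ϖ ^ i`.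
  obtain ⟨t, htO, ht⟩ := exists_limit_integers hϖ (fun i => a ^ Q ^ (e * i))
    (fun i => pow_mem haO _) (fun i => by
      refine fil_mono ?_ (hstep' (e * i) e)
      push_cast
      exact le_add_of_nonneg_right zero_le_one)
  have ht0 : t ∈ fil K D 0 := mem_integers_iff_fil.mp htO
  have hta : t - a ∈ fil K D 1 := by
    have h1 := ht 1
    have h2 := hstep' 0 (e * 1)
    have := add_mem (fil_mono (show (1 : ℤ) ≤ e * (1 : ℕ) by push_cast; omega) h1) h2
    simpa using this
  have htQ : t ^ Q = t := by
    rw [← sub_eq_zero]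
    refine eq_zero_of_forall_mem_fil (K := K) fun k => ?_
    have h1 : t - a ^ Q ^ (e * k) ∈ fil K D k := by
      refine fil_mono ?_ (ht k)
      nlinarith
    have h2 := pow_sub_pow_mem_fil ht0 (by simpa using pow_mem_fil ha0 (Q ^ (e * k))) h1 Q
    have h3 : a ^ Q ^ (e * k + 1) - a ^ Q ^ (e * k) ∈ fil K D k := by
      refine fil_mono ?_ (hstep (e * k))
      push_cast
      nlinarith
    rw [← pow_mul, ← pow_succ] at h2
    have := sub_mem (add_mem h2 h3) h1
    convert this using 1
    abel
  have ht1 : t ∉ fil K D 1 := by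
    intro h
    have haf : a ∈ fil K D 1 := by
      have := sub_mem h hta
      rwa [sub_sub_cancel] at this
    exact ha3 haf
  have htne : t ≠ 0 := by rintro rfl; exact ht1 (zero_mem _)
  have hpow : ∀ j, t ^ j - a ^ j ∈ fil K D 1 := pow_sub_pow_mem_fil ht0 ha0 hta
  refine ⟨t, ⟨?_, fun x hx => ?_, fun j hj => ?_⟩⟩
  · rw [← hQ]
    refine mul_left_cancel₀ htne ?_
    rw [← pow_succ', Nat.sub_add_cancel hQ1.le, htQ, mul_one]
  · refine (ha1 x hx).imp_right ?_
    rintro ⟨j, hj⟩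
    refine ⟨j, ?_⟩
    have := sub_mem hj (hpow j)
    rwa [sub_sub_sub_cancel_right] at this
  · refine ha2 j ?_
    have := sub_mem hj (hpow j)
    convert this using 1
    abel

end Teichmuller

/-! ### Frobenius powers on finite fields. -/

section FiniteFields

/-- An endomorphism of a finite field whose fixed field is `k` is a power of the Frobenius
over `k`, with exponent prime to the degree. -/
lemma exists_frobenius_pow_of_fixed {k κ : Type*} [Field k] [Finite k] [Field κ] [Finite κ]
    (i : k →+* κ) (σ : κ →+* κ) (hσ : ∀ a, σ (i a) = i a)
    (hfix : ∀ x, σ x = x → ∃ a, i a = x) {f : ℕ} (hf : Nat.card κ = Nat.card k ^ f) :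
    ∃ s : ℕ, s.Coprime f ∧ ∀ x, σ x = x ^ Nat.card k ^ s := by
  classical
  let := i.toAlgebra
  let := Fintype.ofFinite k
  let := Fintype.ofFinite κ
  have hfr : f = Module.finrank k κ := by
    rw [Module.natCard_eq_pow_finrank (K := k)] at hf
    exact (Nat.pow_right_injective Finite.one_lt_card hf).symm
  let τ : κ ≃ₐ[k] κ := AlgEquiv.ofBijective ({ σ with commutes' := hσ } : κ →ₐ[k] κ)
    (Finite.injective_iff_bijective.mp σ.injective)
  have hτ : ∀ x, τ x = σ x := fun _ => rfl
  -- By Galois theory an automorphism with fixed field `k` generates the whole group.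
  have htop : Subgroup.zpowers τ = ⊤ := by
    have : IntermediateField.fixedField (Subgroup.zpowers τ) = ⊥ := by
      rw [eq_bot_iff]
      intro x hx
      rw [IntermediateField.mem_fixedField_iff] at hx
      obtain ⟨a, ha⟩ := hfix x (hx τ (Subgroup.mem_zpowers τ))
      exact IntermediateField.mem_bot.mpr ⟨a, ha⟩
    rw [← IntermediateField.fixingSubgroup_fixedField (Subgroup.zpowers τ), this,
      IntermediateField.fixingSubgroup_bot]
  obtain ⟨⟨s, hlt⟩, hs⟩ := (FiniteField.bijective_frobeniusAlgEquivOfAlgebraic_pow k κ).2 τ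
  change FiniteField.frobeniusAlgEquivOfAlgebraic k κ ^ s = τ at hs
  clear hlt
  refine ⟨s, ?_, fun x => ?_⟩
  -- The `s`-th power of Frobenius has order `f / gcd f s`, which equals `f` only if `s` is prime to
  -- `f`.
  · have h1 : orderOf τ = f := by
      rw [← Nat.card_zpowers, htop, hfr, Subgroup.card_top, IsGalois.card_aut_eq_finrank]
    have hf0 : 0 < f := hfr ▸ Module.finrank_pos
    rw [← hs, orderOf_pow, FiniteField.orderOf_frobeniusAlgEquivOfAlgebraic] at h1
    have h2 : Nat.gcd f s = 1 := by
      have h3 := Nat.div_mul_cancel (Nat.gcd_dvd_left f s)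
      rw [hfr, h1, ← hfr] at h3
      exact Nat.eq_of_mul_eq_mul_left hf0 (by rw [h3, mul_one])
    rw [Nat.coprime_comm]
    exact h2
  · rw [← hτ, ← hs, Nat.card_eq_fintype_card]
    rw [← congrFun (FiniteField.coe_frobeniusAlgEquivOfAlgebraic_iterate k κ s) x]
    exact congrFun (AlgEquiv.coe_pow _ _) x

lemma exists_card_eq_card_pow {k κ : Type*} [Field k] [Ring κ] [Finite κ] (i : k →+* κ) :
    ∃ f : ℕ, Nat.card κ = Nat.card k ^ f := by
  let := Module.compHom κ i
  have : Module.Finite k κ := Module.Finite.of_finite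
  exact ⟨_, Module.natCard_eq_pow_finrank (K := k)⟩

/-- Converts divisibility between orders of Teichmüller generators into divisibility between residue
degrees. -/
lemma pow_sub_one_dvd_iff {q a b : ℕ} (hq : 1 < q) : q ^ a - 1 ∣ q ^ b - 1 ↔ a ∣ b := by
  constructor
  · intro h
    have h1 := Nat.gcd_eq_left h
    rw [Nat.pow_sub_one_gcd_pow_sub_one] at h1
    have h2 : q ^ Nat.gcd a b = q ^ a := by
      have := Nat.one_le_pow (Nat.gcd a b) q (by omega)
      have := Nat.one_le_pow a q (by omega)
      omega
    rw [← Nat.pow_right_injective hq h2]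
    exact Nat.gcd_dvd_right a b
  · exact Nat.pow_sub_one_dvd_pow_sub_one q

end FiniteFields

/-! ### The residue degree and the fundamental identity. -/

section ResidueDegree

variable {K : Type*} [Field K] [ValuativeRel K] [TopologicalSpace K] [IsNonarchimedeanLocalField K]
  {D : Type*} [DivisionRing D] [Algebra K D] [FiniteDimensional K D]

variable (K D) in
/-- The inclusion of the residue field of `K` into that of a division algebra over `K`. -/
noncomputable def residueMap : 𝓀[K] →+* (integers K D ⧸ nonunits K D) :=
  Ideal.Quotient.lift 𝓂[K]
    ((Ideal.Quotient.mk (nonunits K D)).comp (algebraMap 𝒪[K] (integers K D))) (by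
      intro a ha
      obtain ⟨ϖ, hϖ⟩ := IsDiscreteValuationRing.exists_irreducible 𝒪[K]
      rw [hϖ.maximalIdeal_eq, Ideal.mem_span_singleton] at ha
      obtain ⟨b, rfl⟩ := ha
      rw [RingHom.comp_apply, Ideal.Quotient.eq_zero_iff_mem, mem_nonunits]
      change algebraMap 𝒪[K] D (ϖ * b) ∈ fil K D 1
      rw [map_mul]
      refine mul_mem_fil_right (Or.inr ?_)
        (mem_integers_iff_fil.mp (Subalgebra.algebraMap_mem _ b))
      have := ord_algebraMap_pos (D := D) hϖ
      omega)

lemma residueMap_residue (a : 𝒪[K]) : residueMap K D (IsLocalRing.residue 𝒪[K] a) =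
    Ideal.Quotient.mk (nonunits K D) (algebraMap 𝒪[K] (integers K D) a) := rfl

variable (K) in
/-- The residue degree of a division algebra over a local field. -/
noncomputable def resDeg (D : Type*) [DivisionRing D] [Algebra K D] [FiniteDimensional K D] : ℕ :=
  Nat.log (Nat.card 𝓀[K]) (resCard K D)

variable (K D) in
lemma resCard_eq : resCard K D = Nat.card 𝓀[K] ^ resDeg K D := by
  obtain ⟨f, hf⟩ := exists_card_eq_card_pow (residueMap K D)
  change resCard K D = _ at hf
  rw [resDeg, hf, Nat.log_pow Finite.one_lt_card]

lemma ram_mul_resDeg {ϖ : 𝒪[K]} (hϖ : Irreducible ϖ) :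
    ram D ϖ * resDeg K D = Module.finrank K D := by
  have h := resCard_pow_ram (D := D) hϖ
  rw [resCard_eq, ← pow_mul] at h
  rw [mul_comm]
  exact Nat.pow_right_injective Finite.one_lt_card h

end ResidueDegree

/-! ### Arithmetic of Teichmüller generators. -/

section TeichmullerBasics

variable {K : Type*} [Field K] [ValuativeRel K] [TopologicalSpace K] [IsNonarchimedeanLocalField K]
  {D : Type*} [DivisionRing D] [Algebra K D] [FiniteDimensional K D]

namespace IsTeichmuller

variable {ζ : D} (hζ : IsTeichmuller K ζ)

include hζ

lemma ne_zero : ζ ≠ 0 := by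
  rintro rfl
  have := hζ.pow_eq_one
  have h1 := one_lt_resCard K D
  by_cases h2 : resCard K D - 1 = 0
  · omega
  · rw [zero_pow h2] at this
    exact zero_ne_one this

lemma ord_eq_zero : ord K ζ = 0 := by
  have h := ord_pow (K := K) hζ.ne_zero (resCard K D - 1)
  rw [hζ.pow_eq_one, ord_one] at h
  have h1 := one_lt_resCard K D
  have : ((resCard K D - 1 : ℕ) : ℤ) ≠ 0 := by omega
  exact (mul_eq_zero.mp h.symm).resolve_left this

lemma mem_fil : ζ ∈ fil K D 0 := Or.inr hζ.ord_eq_zero.ge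

lemma pow_mem_fil (j : ℕ) : ζ ^ j ∈ fil K D 0 := by
  simpa using LocalOrders.pow_mem_fil hζ.mem_fil j

lemma ord_pow_eq_zero (j : ℕ) : ord K (ζ ^ j) = 0 := by
  rw [ord_pow hζ.ne_zero, hζ.ord_eq_zero, mul_zero]

lemma dvd_of_pow_eq_one {j : ℕ} (h : ζ ^ j = 1) : (resCard K D - 1) ∣ j :=
  hζ.dvd_of_pow_sub_one_mem j (by simp [h])

lemma pow_eq_one_iff {j : ℕ} : ζ ^ j = 1 ↔ (resCard K D - 1) ∣ j := by
  refine ⟨hζ.dvd_of_pow_eq_one, ?_⟩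
  rintro ⟨c, rfl⟩
  rw [pow_mul, hζ.pow_eq_one, one_pow]

lemma pow_eq_pow_of_sub_mem {i j : ℕ} (h : ζ ^ i - ζ ^ j ∈ fil K D 1) : ζ ^ i = ζ ^ j := by
  wlog hij : j ≤ i generalizing i j
  · exact (this (by rw [← neg_mem_iff, neg_sub]; exact h) (by omega)).symm
  obtain ⟨k, rfl⟩ := Nat.exists_eq_add_of_le hij
  have h1 : ζ ^ (j + k) - ζ ^ j = ζ ^ j * (ζ ^ k - 1) := by rw [pow_add, mul_sub, mul_one]
  rw [h1, mul_mem_fil_iff_left (pow_ne_zero _ hζ.ne_zero), hζ.ord_pow_eq_zero, sub_zero] at h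
  rw [pow_add, hζ.pow_eq_one_iff.mpr (hζ.dvd_of_pow_sub_one_mem k h), mul_one]

end IsTeichmuller

end TeichmullerBasics

/-! ### Generators of a division algebra. -/

section Central

variable {K : Type*} [Field K] [ValuativeRel K] [TopologicalSpace K] [IsNonarchimedeanLocalField K]
  {B : Type*} [DivisionRing B] [Algebra K B] [FiniteDimensional K B]

/-- A Teichmüller generator is normalized by a suitable uniformizer. -/
lemma exists_uniformizer_normalizing {ζ : B} (hζ : IsTeichmuller K ζ) :
    ∃ (π : B) (r : ℕ), π ≠ 0 ∧ ord K π = 1 ∧ ζ * π = π * ζ ^ r := by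
  obtain ⟨p, hp, hp1⟩ := exists_ord_eq_one K B
  set N := resCard K B - 1 with hN
  have hQ := one_lt_resCard K B
  have hζ0 := hζ.ne_zero
  have hu0 : p⁻¹ * ζ * p ≠ 0 := mul_ne_zero (mul_ne_zero (inv_ne_zero hp) hζ0) hp
  have hu : ord K (p⁻¹ * ζ * p) = 0 := by
    rw [ord_mul (mul_ne_zero (inv_ne_zero hp) hζ0) hp, ord_mul (inv_ne_zero hp) hζ0, ord_inv hp,
      hζ.ord_eq_zero, hp1]
    ring
  obtain ⟨r, hr⟩ := (hζ.exists_sub_mem (p⁻¹ * ζ * p)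
    (mem_integers_iff.mpr (Or.inr hu.ge))).resolve_left (not_mem_fil_of_lt hu0 (by omega))
  -- Averaging over the group generated by `ζ`. Each term is congruent to `p` modulo `𝔪²`, so the
  -- sum is congruent to `(Q - 1) p`, that is to `-p`, and is still a uniformizer; the cyclic shift
  -- `j ↦ j + 1` gives the exact relation.
  let F : ℕ → B := fun j => ζ ^ j * p * (ζ ^ (r * j))⁻¹
  have hF : ∀ j, F j - p ∈ fil K B 2 := by
    intro j
    have h1 : F j - p = p * ((p⁻¹ * ζ * p) ^ j - (ζ ^ r) ^ j) * (ζ ^ (r * j))⁻¹ := by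
      have h2 : (p⁻¹ * ζ * p) ^ j = p⁻¹ * ζ ^ j * p := by
        induction j with
        | zero => simp [hp]
        | succ j ih =>
          rw [pow_succ, ih, pow_succ]
          simp only [mul_assoc, mul_inv_cancel_left₀ hp]
      rw [h2, mul_sub, sub_mul, ← pow_mul, mul_inv_cancel_right₀ (pow_ne_zero _ hζ0)]
      simp only [F, mul_assoc, mul_inv_cancel_left₀ hp]
    rw [h1]
    refine mul_mem_fil_right ?_ ?_
    · have := mul_mem_fil (hp1 ▸ mem_fil_ord (K := K) p)
        (pow_sub_pow_mem_fil (Or.inr hu.ge) (hζ.pow_mem_fil r) hr j)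
      exact this
    · right
      rw [ord_inv (pow_ne_zero _ hζ0), hζ.ord_pow_eq_zero]
      simp
  let π : B := ∑ j ∈ Finset.range N, F j
  have hπ : -p - π ∈ fil K B 2 := by
    have h1 : -p - π = -(∑ j ∈ Finset.range N, (F j - p)) - (resCard K B : B) * p := by
      have h3 : (resCard K B : B) = (N : B) + 1 := by
        have : resCard K B = N + 1 := by omega
        rw [this, Nat.cast_succ]
      rw [Finset.sum_sub_distrib, h3]
      simp only [Finset.sum_const, Finset.card_range, nsmul_eq_mul, π]
      noncomm_ring
    rw [h1]
    refine sub_mem (neg_mem (sum_mem fun j _ => hF j)) ?_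
    exact mul_mem_fil (resCard_cast_mem K B) (hp1 ▸ mem_fil_ord (K := K) p)
  have hnp : ord K (-p) = 1 := by
    refine ord_eq_of_mem_fil (neg_mem (hp1 ▸ mem_fil_ord (K := K) p)) ?_
    rw [neg_mem_iff]
    exact not_mem_fil_of_lt hp (by omega)
  have hπ1 : ord K π = 1 := by
    rw [ord_eq_of_sub_mem (neg_ne_zero.mpr hp) (by omega) hπ, hnp]
  have hπ0 : π ≠ 0 := by
    intro h
    rw [h, sub_zero] at hπ
    exact not_mem_fil_of_lt (neg_ne_zero.mpr hp) (by omega) hπ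
  refine ⟨π, r, hπ0, hπ1, ?_⟩
  have hshift : ∀ j, ζ * F j = F (j + 1) * ζ ^ r := by
    intro j
    simp only [F]
    rw [mul_add, mul_one, pow_add ζ (r * j), mul_inv_rev, pow_succ' ζ j]
    have : (ζ ^ r)⁻¹ * (ζ ^ (r * j))⁻¹ * ζ ^ r = (ζ ^ (r * j))⁻¹ := by
      rw [← mul_inv_rev, ← pow_add, add_comm, pow_add, mul_inv_rev, mul_assoc,
        inv_mul_cancel₀ (pow_ne_zero _ hζ0), mul_one]
    rw [mul_assoc _ _ (ζ ^ r), this]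
    simp only [mul_assoc]
  have hsum : ∑ j ∈ Finset.range N, F (j + 1) = π := by
    have h1 := Finset.sum_range_succ F N
    rw [Finset.sum_range_succ' F N] at h1
    have h2 : F N = F 0 := by
      simp only [F]
      rw [mul_comm r N, pow_mul, hζ.pow_eq_one]
      simp
    rw [h2] at h1
    exact add_right_cancel h1
  calc ζ * π = ∑ j ∈ Finset.range N, F (j + 1) * ζ ^ r := by
        rw [Finset.mul_sum]; exact Finset.sum_congr rfl fun j _ => hshift j
    _ = π * ζ ^ r := by rw [← Finset.sum_mul, hsum]

lemma maximalIdeal_le_jacobson : 𝓂[K] ≤ Ideal.jacobson (⊥ : Ideal 𝒪[K]) :=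
  IsLocalRing.maximalIdeal_le_jacobson ⊥

/-- A division algebra is generated by a Teichmüller generator and a uniformizer. -/
lemma commute_of_commute_generators {ζ π x : B} (hζ : IsTeichmuller K ζ) (hπ : π ≠ 0)
    (hπ1 : ord K π = 1) (h1 : Commute x ζ) (h2 : Commute x π) (y : B) : Commute x y := by
  obtain ⟨ϖ, hϖ⟩ := IsDiscreteValuationRing.exists_irreducible 𝒪[K]
  let C : Subalgebra 𝒪[K] B := Subalgebra.centralizer 𝒪[K] {x}
  have hC : ∀ z, z ∈ C ↔ Commute x z := by
    intro z
    rw [Subalgebra.mem_centralizer_iff]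
    simp [Commute, SemiconjBy]
  -- Digit expansion: every integer is approximated by sums of terms `π ^ m ζ ^ j`, which all
  -- commute with `x`.
  have happ : ∀ (m : ℕ), ∀ z ∈ integers K B, ∃ c ∈ C, z - c ∈ fil K B m := by
    intro m z hz
    induction m with
    | zero => exact ⟨0, zero_mem _, by simpa using mem_integers_iff_fil.mp hz⟩
    | succ m ih =>
      obtain ⟨c, hc, hzc⟩ := ih
      have hw : (π ^ m)⁻¹ * (z - c) ∈ integers K B := by
        rw [mem_integers_iff_fil, mul_mem_fil_iff_left (inv_ne_zero (pow_ne_zero _ hπ)),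
          ord_inv (pow_ne_zero _ hπ), ord_pow hπ, hπ1]
        simpa using hzc
      have hback : ∀ d : B, (π ^ m)⁻¹ * (z - c) - d ∈ fil K B 1 →
          z - (c + π ^ m * d) ∈ fil K B (m + 1) := by
        intro d hd
        have := mul_mem_fil (pow_mem_fil (hπ1 ▸ mem_fil_ord (K := K) π) m) hd
        rw [mul_sub, mul_inv_cancel_left₀ (pow_ne_zero _ hπ), mul_one, sub_sub] at this
        exact this
      have hπC : π ^ m ∈ C := pow_mem ((hC _).mpr h2) m
      rcases hζ.exists_sub_mem _ hw with h | ⟨j, hj⟩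
      · refine ⟨c + π ^ m * 0, add_mem hc (mul_mem hπC (zero_mem _)), ?_⟩
        exact_mod_cast hback 0 (by simpa using h)
      · refine ⟨c + π ^ m * ζ ^ j, add_mem hc (mul_mem hπC (pow_mem ((hC _).mpr h1) j)), ?_⟩
        exact_mod_cast hback _ hj
  -- Approximation modulo `ϖ 𝒪_B` suffices, by Nakayama.
  have hle : Subalgebra.toSubmodule (integers K B) ≤ Subalgebra.toSubmodule C := by
    refine Submodule.le_of_le_smul_of_le_jacobson_bot fg_integers maximalIdeal_le_jacobson ?_
    intro z hz
    obtain ⟨c, hc, hzc⟩ := happ (ram B ϖ) z hz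
    obtain ⟨w, hw, hw'⟩ := exists_mul_pow_of_mem_fil hϖ (x := z - c) 1 (by simpa using hzc)
    rw [show z = c + (z - c) by abel, hw', pow_one]
    refine Submodule.add_mem_sup hc (Submodule.smul_mem_smul ?_ hw)
    rw [hϖ.maximalIdeal_eq]
    exact Ideal.mem_span_singleton_self _
  have hspan := Submodule.IsLattice.span_eq_top (A := K)
    (M := Subalgebra.toSubmodule (integers K B))
  have hy : y ∈ Submodule.span K
      ((Subalgebra.toSubmodule (integers K B) : Submodule 𝒪[K] B) : Set B) := by
    rw [hspan]; trivial
  have hmem : Submodule.span K ((Subalgebra.toSubmodule (integers K B) : Submodule 𝒪[K] B) : Set B)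
      ≤ Subalgebra.toSubmodule (Subalgebra.centralizer K {x}) := by
    rw [Submodule.span_le]
    intro z hz
    have := (hC z).mp (hle hz)
    change z ∈ Subalgebra.centralizer K {x}
    rw [Subalgebra.mem_centralizer_iff]
    simpa [Commute, SemiconjBy] using this
  have := hmem hy
  change y ∈ Subalgebra.centralizer K {x} at this
  rw [Subalgebra.mem_centralizer_iff] at this
  exact this x rfl

lemma mem_range_of_commute_generators [Algebra.IsCentral K B] {ζ π x : B}
    (hζ : IsTeichmuller K ζ) (hπ : π ≠ 0) (hπ1 : ord K π = 1) (h1 : Commute x ζ)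
    (h2 : Commute x π) : ∃ a : K, algebraMap K B a = x := by
  have : x ∈ Subalgebra.center K B := by
    rw [Subalgebra.mem_center_iff]
    exact fun y => (commute_of_commute_generators hζ hπ hπ1 h1 h2 y).symm
  rw [Algebra.IsCentral.center_eq_bot] at this
  exact Algebra.mem_bot.mp this

end Central

/-! ### The cyclic presentation of a central division algebra. -/

section Structure

variable {K : Type*} [Field K] [ValuativeRel K] [TopologicalSpace K] [IsNonarchimedeanLocalField K]
  {B : Type*} [DivisionRing B] [Algebra K B] [FiniteDimensional K B]

lemma ram_dvd_ord_algebraMap {ϖ : 𝒪[K]} (hϖ : Irreducible ϖ) {a : K} (ha : a ≠ 0) :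
    (ram B ϖ : ℤ) ∣ ord K (algebraMap K B a) := by
  wlog hO : a ∈ 𝒪[K] generalizing a
  · have h1 := this (inv_ne_zero ha) ((mem_integer_or_inv_mem a).resolve_left hO)
    rwa [map_inv₀, ord_inv (by simpa using ha), dvd_neg] at h1
  obtain ⟨k, u, hu⟩ := IsDiscreteValuationRing.eq_unit_mul_pow_irreducible
    (x := (⟨a, hO⟩ : 𝒪[K])) (by simpa [Subtype.ext_iff] using ha) hϖ
  have h0 := algebraMap_ne_zero_of_irreducible (D := B) hϖ
  have hinj : ∀ v : 𝒪[K]ˣ, algebraMap 𝒪[K] B v ≠ 0 := fun v => (v.isUnit.map _).ne_zero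
  have hunit : ord K (algebraMap 𝒪[K] B u) = 0 := by
    have h1 := (mem_integers_iff.mp (Subalgebra.algebraMap_mem (integers K B) (u : 𝒪[K]))).resolve_left
      (hinj u)
    have h2 := (mem_integers_iff.mp (Subalgebra.algebraMap_mem (integers K B)
      ((u⁻¹ : 𝒪[K]ˣ) : 𝒪[K]))).resolve_left (hinj _)
    have h3 := ord_mul (K := K) (hinj u) (hinj u⁻¹)
    rw [← map_mul, Units.mul_inv, map_one, ord_one] at h3
    omega
  have h1 : algebraMap K B a = algebraMap 𝒪[K] B u * algebraMap 𝒪[K] B ϖ ^ k := by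
    rw [← map_pow, ← map_mul, ← hu]
    rfl
  rw [h1, ord_mul (hinj u) (pow_ne_zero _ h0), hunit, ord_pow h0, ord_algebraMap_eq_ram hϖ,
    zero_add]
  exact dvd_mul_left _ _

lemma pow_mul_pow_of_normalizing {ζ π : B} {r : ℕ} (h : ζ * π = π * ζ ^ r) (j i : ℕ) :
    ζ ^ j * π ^ i = π ^ i * ζ ^ (j * r ^ i) := by
  have h1 : ∀ j, ζ ^ j * π = π * ζ ^ (j * r) := by
    intro j
    induction j with
    | zero => simp
    | succ j ih =>
      rw [pow_succ, mul_assoc, h, ← mul_assoc, ih, mul_assoc, ← pow_add]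
      congr 2
      ring
  induction i with
  | zero => simp
  | succ i ih =>
    rw [pow_succ, ← mul_assoc, ih, mul_assoc, h1, ← mul_assoc]
    congr 2
    ring

variable (K) in
/-- The action of a normalizing uniformizer on the Teichmüller representatives is a generating
power of the Frobenius. -/
lemma exists_frobenius_normalizing [Algebra.IsCentral K B] {ζ π : B} {r : ℕ}
    (hζ : IsTeichmuller K ζ) (hπ : π ≠ 0) (hπ1 : ord K π = 1) (hr : ζ * π = π * ζ ^ r) :
    ∃ s : ℕ, s.Coprime (resDeg K B) ∧ ζ ^ r = ζ ^ Nat.card 𝓀[K] ^ s := by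
  have hconj : ∀ {k : ℤ} {x : B}, x ∈ fil K B k → π⁻¹ * x * π ∈ fil K B k := by
    intro k x hx
    rw [mul_mem_fil_iff_right hπ, mul_mem_fil_iff_left (inv_ne_zero hπ), ord_inv hπ, hπ1]
    simpa using hx
  let c : integers K B →+* integers K B :=
    { toFun := fun x => ⟨π⁻¹ * x * π, mem_integers_iff_fil.mpr
        (hconj (mem_integers_iff_fil.mp x.2))⟩
      map_one' := Subtype.ext (by simp [hπ])
      map_zero' := Subtype.ext (by simp)
      map_mul' := fun x y => Subtype.ext (by
        simp only [mul_assoc, MulMemClass.coe_mul, mul_inv_cancel_left₀ hπ])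
      map_add' := fun x y => Subtype.ext (by
        simp only [AddMemClass.coe_add, mul_add, add_mul]) }
  let σ : (integers K B ⧸ nonunits K B) →+* (integers K B ⧸ nonunits K B) :=
    Ideal.Quotient.lift (nonunits K B) ((Ideal.Quotient.mk (nonunits K B)).comp c) (by
      intro a ha
      rw [RingHom.comp_apply, Ideal.Quotient.eq_zero_iff_mem, mem_nonunits]
      exact hconj (mem_nonunits.mp ha))
  have hσ : ∀ x, σ (Ideal.Quotient.mk (nonunits K B) x) = Ideal.Quotient.mk (nonunits K B) (c x) :=
    fun _ => rfl
  have hζO : ∀ j, ζ ^ j ∈ integers K B := fun j => mem_integers_iff_fil.mpr (hζ.pow_mem_fil j)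
  have hcζ : ∀ j, π⁻¹ * ζ ^ j * π = ζ ^ (j * r) := by
    intro j
    have := pow_mul_pow_of_normalizing hr j 1
    rw [pow_one, pow_one] at this
    rw [mul_assoc, this, inv_mul_cancel_left₀ hπ]
  let := (Finite.isDomain_to_isField (integers K B ⧸ nonunits K B)).toField
  obtain ⟨s, hs, hs'⟩ := exists_frobenius_pow_of_fixed (residueMap K B) σ (by
      intro a
      obtain ⟨a, rfl⟩ := IsLocalRing.residue_surjective a
      rw [residueMap_residue, hσ]
      congr 1
      refine Subtype.ext ?_
      change π⁻¹ * algebraMap 𝒪[K] B a * π = algebraMap 𝒪[K] B a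
      rw [mul_assoc, Algebra.commutes, inv_mul_cancel_left₀ hπ]) (by
      intro x hx
      obtain ⟨x, rfl⟩ := Ideal.Quotient.mk_surjective x
      rcases hζ.exists_sub_mem x x.2 with h | ⟨j, hj⟩
      · refine ⟨0, ?_⟩
        rw [map_zero, eq_comm, Ideal.Quotient.eq_zero_iff_mem]
        exact h
      · have hxj : Ideal.Quotient.mk (nonunits K B) x
            = Ideal.Quotient.mk (nonunits K B) ⟨ζ ^ j, hζO j⟩ := by
          rw [Ideal.Quotient.mk_eq_mk_iff_sub_mem]
          exact hj
        rw [hxj] at hx ⊢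
        rw [hσ, Ideal.Quotient.mk_eq_mk_iff_sub_mem, mem_nonunits] at hx
        change π⁻¹ * ζ ^ j * π - ζ ^ j ∈ fil K B 1 at hx
        -- Congruent Teichmüller representatives are equal. So a residue class fixed by conjugation
        -- lifts to a power of `ζ` that commutes with `π`, hence is central and lies in `𝒪[K]`.
        have hfix : π⁻¹ * ζ ^ j * π = ζ ^ j := by
          rw [hcζ] at hx ⊢
          exact hζ.pow_eq_pow_of_sub_mem hx
        have hcomm : Commute (ζ ^ j) π := by
          have := congrArg (π * ·) hfix
          simp only [mul_assoc, mul_inv_cancel_left₀ hπ] at this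
          exact this
        obtain ⟨a, ha⟩ := mem_range_of_commute_generators hζ hπ hπ1
          ((Commute.refl ζ).pow_left j) hcomm
        have haO : a ∈ 𝒪[K] := by
          rw [← algebraMap_isIntegral_iff (D := B), ha]
          exact hζO j
        refine ⟨IsLocalRing.residue 𝒪[K] ⟨a, haO⟩, ?_⟩
        rw [residueMap_residue]
        congr 1
        exact Subtype.ext ha) (resCard_eq K B)
  refine ⟨s, hs, hζ.pow_eq_pow_of_sub_mem ?_⟩
  have h1 := hs' (Ideal.Quotient.mk (nonunits K B) ⟨ζ ^ 1, hζO 1⟩)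
  rw [hσ, ← map_pow, Ideal.Quotient.mk_eq_mk_iff_sub_mem, mem_nonunits] at h1
  change π⁻¹ * ζ ^ 1 * π - (ζ ^ 1) ^ _ ∈ fil K B 1 at h1
  rwa [hcζ, one_mul, pow_one] at h1

variable (K) in
/-- A presentation of a central division algebra of degree `n` over a local field: a generator `ζ`
of the Teichmüller representatives, normalized by a uniformizer `π` with `π ^ n` central. -/
structure CentralData (n s : ℕ) (ζ π : B) : Prop where
  teich : IsTeichmuller K ζ
  ne_zero : π ≠ 0
  ord_eq : ord K π = 1
  coprime : s.Coprime n
  normalizes : ζ * π = π * ζ ^ Nat.card 𝓀[K] ^ s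
  resDeg_eq : resDeg K B = n
  ram_eq : ∀ ϖ : 𝒪[K], Irreducible ϖ → ram B ϖ = n
  exists_pow_eq : ∃ a : K, algebraMap K B a = π ^ n

/-- `π ^ f` commutes with `ζ` and `π`, so it lies in `K` and `e ∣ f`. Conversely `ϖ⁻¹ π ^ e` is a
unit, congruent to a power of `ζ`; it thus commutes with `ζ` modulo `𝔪`, so the `s e`-th power of
Frobenius is trivial and `f ∣ e`. Then `e f = n²` gives `e = f = n`. -/
theorem exists_centralData [Algebra.IsCentral K B] {n : ℕ} (hn : Module.finrank K B = n ^ 2) :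
    ∃ (s : ℕ) (ζ π : B), CentralData K n s ζ π := by
  obtain ⟨ζ, hζ⟩ := exists_isTeichmuller K B
  obtain ⟨π, r, hπ, hπ1, hr⟩ := exists_uniformizer_normalizing hζ
  obtain ⟨s, hs, hrs⟩ := exists_frobenius_normalizing K hζ hπ hπ1 hr
  rw [hrs] at hr
  set q := Nat.card 𝓀[K] with hq
  have hq1 : 1 < q := Finite.one_lt_card
  have hQ : resCard K B = q ^ resDeg K B := resCard_eq K B
  have hfix : ∀ m, ζ ^ q ^ m = ζ ↔ resDeg K B ∣ m := by
    intro m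
    rw [← pow_sub_one_dvd_iff hq1, ← hQ, ← hζ.pow_eq_one_iff]
    have : ζ ^ q ^ m = ζ * ζ ^ (q ^ m - 1) := by
      rw [← pow_succ', Nat.sub_add_cancel (Nat.one_le_pow _ _ (by omega))]
    rw [this]
    constructor
    · intro h
      exact mul_left_cancel₀ hζ.ne_zero (by rw [h, mul_one])
    · intro h
      rw [h, mul_one]
  have hpow : ∀ i, ζ * π ^ i = π ^ i * ζ ^ q ^ (s * i) := by
    intro i
    have := pow_mul_pow_of_normalizing hr 1 i
    rwa [pow_one, one_mul, ← pow_mul] at this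
  have hcentral : ∃ a : K, algebraMap K B a = π ^ resDeg K B := by
    refine mem_range_of_commute_generators hζ hπ hπ1 ?_ ((Commute.refl π).pow_left _)
    have := hpow (resDeg K B)
    rw [(hfix _).mpr (dvd_mul_left _ _)] at this
    exact this.symm
  have key : ∀ ϖ : 𝒪[K], Irreducible ϖ → ram B ϖ = resDeg K B := by
    intro ϖ hϖ
    refine Nat.dvd_antisymm ?_ ?_
    · obtain ⟨a, ha⟩ := hcentral
      have ha0 : a ≠ 0 := by
        rintro rfl
        rw [map_zero] at ha
        exact pow_ne_zero _ hπ ha.symm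
      have := ram_dvd_ord_algebraMap (B := B) hϖ ha0
      rw [ha, ord_pow hπ, hπ1, mul_one] at this
      exact_mod_cast this
    · have h0 := algebraMap_ne_zero_of_irreducible (D := B) hϖ
      set e := ram B ϖ
      set u := (algebraMap 𝒪[K] B ϖ)⁻¹ * π ^ e with hu
      have hu0 : u ≠ 0 := mul_ne_zero (inv_ne_zero h0) (pow_ne_zero _ hπ)
      have hou : ord K u = 0 := by
        rw [hu, ord_mul (inv_ne_zero h0) (pow_ne_zero _ hπ), ord_inv h0, ord_pow hπ, hπ1,
          ord_algebraMap_eq_ram hϖ]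
        ring
      have hcomm : ζ * u = u * ζ ^ q ^ (s * e) := by
        have h1 : Commute ζ (algebraMap 𝒪[K] B ϖ)⁻¹ :=
          Commute.inv_right₀ (Algebra.commutes ϖ ζ).symm
        rw [hu, ← mul_assoc, h1.eq, mul_assoc, hpow, mul_assoc]
      obtain ⟨j, hj⟩ := (hζ.exists_sub_mem u (mem_integers_iff.mpr (Or.inr hou.ge))).resolve_left
        (not_mem_fil_of_lt hu0 (by omega))
      have h2 : ζ ^ (j + 1) - ζ ^ (j + q ^ (s * e)) ∈ fil K B 1 := by
        have h3 := mul_mem_fil_left hζ.mem_fil hj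
        have h4 := mul_mem_fil_right hj (hζ.pow_mem_fil (q ^ (s * e)))
        have := sub_mem h4 h3
        rw [mul_sub, sub_mul, hcomm, ← pow_add, ← pow_succ', sub_sub_sub_cancel_left] at this
        exact this
      have h3 := hζ.pow_eq_pow_of_sub_mem h2
      rw [pow_succ, pow_add] at h3
      have h4 := mul_left_cancel₀ (pow_ne_zero _ hζ.ne_zero) h3
      exact (Nat.Coprime.dvd_mul_left hs.symm).mp ((hfix _).mp h4.symm)
  have hdeg : resDeg K B = n := by
    obtain ⟨ϖ, hϖ⟩ := IsDiscreteValuationRing.exists_irreducible 𝒪[K]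
    have := ram_mul_resDeg (D := B) hϖ
    rw [key ϖ hϖ, hn, ← sq] at this
    exact Nat.pow_left_injective two_ne_zero this
  exact ⟨s, ζ, π, hζ, hπ, hπ1, hdeg ▸ hs, hr, hdeg, fun ϖ hϖ => hdeg ▸ key ϖ hϖ, hdeg ▸ hcentral⟩

end Structure

/-! ### Lattices over the integers of `B`. -/

section Lattices

variable {K : Type*} [Field K] [ValuativeRel K] [TopologicalSpace K] [IsNonarchimedeanLocalField K]
  {B : Type*} [DivisionRing B] [Algebra K B] [FiniteDimensional K B]

lemma mulVec_op_smul (M : Matrix (Fin 2) (Fin 2) B) (v : Fin 2 → B) (b : B) :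
    M.mulVec (v <• b) = (M.mulVec v) <• b :=
  Matrix.mulVec_smul M (MulOpposite.op b) v

lemma op_smul_op_smul (v : Fin 2 → B) (b c : B) : (v <• b) <• c = v <• (b * c) := by
  rw [smul_smul, ← MulOpposite.op_mul]

/-- `x` and `y` form a basis of the right `B`-vector space `B²`. -/
structure IsRightBasis (x y : Fin 2 → B) : Prop where
  eq_zero : ∀ α β : B, x <• α + y <• β = 0 → α = 0 ∧ β = 0
  exists_eq : ∀ v : Fin 2 → B, ∃ α β : B, v = x <• α + y <• β

variable (K) in
/-- The `𝒪_B`-lattice `x 𝔪ᵃ + y 𝔪ᵇ`, with `𝔪` the maximal ideal of `𝒪_B`. -/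
def std (x y : Fin 2 → B) (a b : ℤ) : Submodule 𝒪[K] (Fin 2 → B) where
  carrier := {v | ∃ α ∈ fil K B a, ∃ β ∈ fil K B b, v = x <• α + y <• β}
  zero_mem' := ⟨0, zero_mem _, 0, zero_mem _, by simp⟩
  add_mem' := by
    rintro _ _ ⟨α, hα, β, hβ, rfl⟩ ⟨α', hα', β', hβ', rfl⟩
    refine ⟨α + α', add_mem hα hα', β + β', add_mem hβ hβ', ?_⟩
    simp only [MulOpposite.op_add, add_smul]
    abel
  smul_mem' := by
    rintro c _ ⟨α, hα, β, hβ, rfl⟩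
    refine ⟨c • α, Submodule.smul_mem _ _ hα, c • β, Submodule.smul_mem _ _ hβ, ?_⟩
    simp only [MulOpposite.op_smul, smul_assoc, smul_add]

lemma mem_std {x y v : Fin 2 → B} {a b : ℤ} :
    v ∈ std K x y a b ↔ ∃ α ∈ fil K B a, ∃ β ∈ fil K B b, v = x <• α + y <• β := Iff.rfl

lemma IsRightBasis.mem_std_iff {x y : Fin 2 → B} (h : IsRightBasis x y) {a b : ℤ} {α β : B} :
    x <• α + y <• β ∈ std K x y a b ↔ α ∈ fil K B a ∧ β ∈ fil K B b := by
  constructor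
  · rintro ⟨α', hα, β', hβ, he⟩
    obtain ⟨h1, h2⟩ := h.eq_zero (α - α') (β - β') (by
      simp only [MulOpposite.op_sub, sub_smul]
      rw [sub_add_sub_comm, he, sub_self])
    rw [sub_eq_zero.mp h1, sub_eq_zero.mp h2]
    exact ⟨hα, hβ⟩
  · rintro ⟨hα, hβ⟩
    exact ⟨α, hα, β, hβ, rfl⟩

lemma op_smul_left_mem_std {x y : Fin 2 → B} {a b : ℤ} {α : B} (hα : α ∈ fil K B a) :
    x <• α ∈ std K x y a b := ⟨α, hα, 0, zero_mem _, by simp⟩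

lemma op_smul_right_mem_std {x y : Fin 2 → B} {a b : ℤ} {β : B} (hβ : β ∈ fil K B b) :
    y <• β ∈ std K x y a b := ⟨0, zero_mem _, β, hβ, by simp⟩

lemma op_smul_mem_std {x y v : Fin 2 → B} {a b k : ℤ} {c : B} (hv : v ∈ std K x y a b)
    (hc : c ∈ fil K B k) : v <• c ∈ std K x y (a + k) (b + k) := by
  obtain ⟨α, hα, β, hβ, rfl⟩ := hv
  refine ⟨α * c, mul_mem_fil hα hc, β * c, mul_mem_fil hβ hc, ?_⟩
  rw [smul_add, op_smul_op_smul, op_smul_op_smul]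

lemma op_smul_mem_std_iff {x y v : Fin 2 → B} {a b : ℤ} {c : B} (hc : c ≠ 0) :
    v <• c ∈ std K x y a b ↔ v ∈ std K x y (a - ord K c) (b - ord K c) := by
  constructor
  · intro h
    have := op_smul_mem_std h (mem_fil_ord (K := K) c⁻¹)
    rw [op_smul_op_smul, mul_inv_cancel₀ hc, ord_inv hc] at this
    simpa [sub_eq_add_neg] using this
  · intro h
    have := op_smul_mem_std h (mem_fil_ord (K := K) c)
    simpa using this

lemma fg_fil (k : ℤ) : (fil K B k).FG := by
  obtain ⟨p, hp, hp1⟩ := exists_ord_eq_one K B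
  have : fil K B k = (Subalgebra.toSubmodule (integers K B)).map
      (LinearMap.mulLeft 𝒪[K] (p ^ k)) := by
    ext z
    rw [Submodule.mem_map]
    constructor
    · intro hz
      refine ⟨p ^ (-k) * z, ?_, ?_⟩
      · change p ^ (-k) * z ∈ integers K B
        rw [mem_integers_iff_fil, mul_mem_fil_iff_left (zpow_ne_zero _ hp), ord_zpow hp, hp1]
        simpa using hz
      · rw [LinearMap.mulLeft_apply, zpow_neg, mul_inv_cancel_left₀ (zpow_ne_zero _ hp)]
    · rintro ⟨w, hw, rfl⟩
      rw [LinearMap.mulLeft_apply, mul_mem_fil_iff_left (zpow_ne_zero _ hp), ord_zpow hp, hp1]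
      simpa using mem_integers_iff_fil.mp hw
  rw [this]
  exact fg_integers.map _

variable (K) in
/-- The map `b ↦ v b` from `B` to `B²`. -/
def rightMap (v : Fin 2 → B) : B →ₗ[𝒪[K]] (Fin 2 → B) where
  toFun b := v <• b
  map_add' b c := by rw [MulOpposite.op_add, add_smul]
  map_smul' c b := by
    rw [MulOpposite.op_smul, smul_assoc]
    rfl

lemma rightMap_apply (v : Fin 2 → B) (b : B) : rightMap K v b = v <• b := rfl

lemma std_eq_sup (x y : Fin 2 → B) (a b : ℤ) :
    std K x y a b = (fil K B a).map (rightMap K x) ⊔ (fil K B b).map (rightMap K y) := by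
  ext v
  rw [Submodule.mem_sup, mem_std]
  constructor
  · rintro ⟨α, hα, β, hβ, rfl⟩
    exact ⟨_, ⟨α, hα, rfl⟩, _, ⟨β, hβ, rfl⟩, rfl⟩
  · rintro ⟨_, ⟨α, hα, rfl⟩, _, ⟨β, hβ, rfl⟩, rfl⟩
    exact ⟨α, hα, β, hβ, rfl⟩

lemma exists_smul_mem_of_span_eq_top {V : Type*} [AddCommGroup V] [Module K V] [Module 𝒪[K] V]
    [IsScalarTower 𝒪[K] K V] {Λ : Submodule 𝒪[K] V}
    (h : Submodule.span K (Λ : Set V) = ⊤) (v : V) : ∃ t : 𝒪[K], t ≠ 0 ∧ t • v ∈ Λ := by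
  have hv : v ∈ Submodule.span K (Λ : Set V) := by rw [h]; trivial
  induction hv using Submodule.span_induction with
  | mem x hx => exact ⟨1, one_ne_zero, by rwa [one_smul]⟩
  | zero => exact ⟨1, one_ne_zero, by rw [smul_zero]; exact zero_mem _⟩
  | add x y _ _ hx hy =>
    obtain ⟨s, hs, hsx⟩ := hx
    obtain ⟨t, ht, hty⟩ := hy
    refine ⟨s * t, mul_ne_zero hs ht, ?_⟩
    rw [smul_add]
    refine add_mem ?_ ?_
    · rw [mul_comm, mul_smul]; exact Submodule.smul_mem _ _ hsx
    · rw [mul_smul]; exact Submodule.smul_mem _ _ hty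
  | smul a x _ hx =>
    obtain ⟨s, hs, hsx⟩ := hx
    obtain ⟨c, d, hd, hcd⟩ := IsFractionRing.div_surjective (A := 𝒪[K]) a
    have hd0 : d ≠ 0 := nonZeroDivisors.ne_zero hd
    refine ⟨d * s, mul_ne_zero hd0 hs, ?_⟩
    have : (d * s) • a • x = c • s • x := by
      rw [← algebraMap_smul K (d * s), ← algebraMap_smul K c, ← algebraMap_smul K s, smul_smul,
        smul_smul]
      congr 1
      rw [← hcd, map_mul]
      have : algebraMap 𝒪[K] K d ≠ 0 := by simpa using hd0
      field_simp
    rw [this]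
    exact Submodule.smul_mem _ _ hsx

lemma span_eq_top_of_smul_mem {V : Type*} [AddCommGroup V] [Module K V] [Module 𝒪[K] V]
    [IsScalarTower 𝒪[K] K V] {Λ : Submodule 𝒪[K] V}
    (h : ∀ v : V, ∃ t : 𝒪[K], t ≠ 0 ∧ t • v ∈ Λ) : Submodule.span K (Λ : Set V) = ⊤ := by
  rw [eq_top_iff]
  intro v _
  obtain ⟨t, ht, htv⟩ := h v
  have ht' : algebraMap 𝒪[K] K t ≠ 0 := by simpa using ht
  have : v = (algebraMap 𝒪[K] K t)⁻¹ • t • v := by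
    rw [← algebraMap_smul K t v, smul_smul, inv_mul_cancel₀ ht', one_smul]
  rw [this]
  exact Submodule.smul_mem _ _ (Submodule.subset_span htv)

lemma exists_smul_mem_fil (k : ℤ) (b : B) : ∃ t : 𝒪[K], t ≠ 0 ∧ t • b ∈ fil K B k := by
  obtain ⟨ϖ, hϖ⟩ := IsDiscreteValuationRing.exists_irreducible 𝒪[K]
  have h0 := algebraMap_ne_zero_of_irreducible (D := B) hϖ
  have hpos := ord_algebraMap_pos (D := B) hϖ
  refine ⟨ϖ ^ (k - ord K b).toNat, pow_ne_zero _ hϖ.ne_zero, ?_⟩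
  by_cases hb : b = 0
  · simp [hb]
  rw [Algebra.smul_def, map_pow, mem_fil_of_ne (mul_ne_zero (pow_ne_zero _ h0) hb),
    ord_mul (pow_ne_zero _ h0) hb, ord_pow h0]
  have : ((k - ord K b).toNat : ℤ) ≤ (k - ord K b).toNat * ord K (algebraMap 𝒪[K] B ϖ) := by
    nlinarith
  omega

lemma IsRightBasis.isLattice_std {x y : Fin 2 → B} (h : IsRightBasis x y) (a b : ℤ) :
    IsLattice K (std K x y a b) := by
  refine ⟨?_, ?_, ?_⟩
  · rw [std_eq_sup]
    exact ((fg_fil a).map _).sup ((fg_fil b).map _)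
  · refine span_eq_top_of_smul_mem fun v => ?_
    obtain ⟨α, β, rfl⟩ := h.exists_eq v
    obtain ⟨s, hs, hsα⟩ := exists_smul_mem_fil (K := K) a α
    obtain ⟨t, ht, htβ⟩ := exists_smul_mem_fil (K := K) b β
    refine ⟨s * t, mul_ne_zero hs ht, (s * t) • α, ?_, (s * t) • β, ?_, ?_⟩
    · rw [mul_comm, mul_smul]; exact Submodule.smul_mem _ _ hsα
    · rw [mul_smul]; exact Submodule.smul_mem _ _ htβ
    · simp only [MulOpposite.op_smul, smul_assoc, smul_add]
  · intro v hv c hc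
    have := op_smul_mem_std hv (mem_integers_iff_fil.mp (show c ∈ integers K B from hc))
    rwa [add_zero, add_zero] at this

lemma IsRightBasis.std_le_std {x y : Fin 2 → B} (h : IsRightBasis x y) {a b a' b' : ℤ} :
    std K x y a b ≤ std K x y a' b' ↔ a' ≤ a ∧ b' ≤ b := by
  obtain ⟨p, hp, hp1⟩ := exists_ord_eq_one K B
  constructor
  · intro hle
    have h1 := hle (op_smul_left_mem_std (x := x) (y := y) (zpow_mem_fil hp hp1 a))
    have h2 := hle (op_smul_right_mem_std (x := x) (y := y) (zpow_mem_fil hp hp1 b))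
    constructor
    · have := (h.mem_std_iff (α := p ^ a) (β := 0)).mp (by simpa using h1)
      simpa [mem_fil_of_ne (zpow_ne_zero a hp), ord_zpow hp, hp1] using this.1
    · have := (h.mem_std_iff (α := 0) (β := p ^ b)).mp (by simpa using h2)
      simpa [mem_fil_of_ne (zpow_ne_zero b hp), ord_zpow hp, hp1] using this.2
  · rintro ⟨h1, h2⟩ _ ⟨α, hα, β, hβ, rfl⟩
    exact ⟨α, fil_mono h1 hα, β, fil_mono h2 hβ, rfl⟩

lemma IsRightBasis.std_inj {x y : Fin 2 → B} (h : IsRightBasis x y) {a b a' b' : ℤ} :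
    std K x y a b = std K x y a' b' ↔ a = a' ∧ b = b' := by
  rw [le_antisymm_iff, h.std_le_std, h.std_le_std]
  omega

lemma exists_fil_le_of_fg {J : Submodule 𝒪[K] B} (hJ : J.FG) : ∃ k, J ≤ fil K B k := by
  obtain ⟨S, rfl⟩ := hJ
  obtain ⟨k, hk⟩ := (S.image (ord K)).bddBelow
  refine ⟨k, Submodule.span_le.mpr fun z hz => Or.inr (hk ?_)⟩
  exact Finset.mem_coe.mpr (Finset.mem_image_of_mem _ hz)

/-- A nonzero finitely generated fractional right ideal of `𝒪_B` is a power of the maximal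
ideal. -/
lemma exists_eq_fil {J : Submodule 𝒪[K] B} (hJ : J.FG) (h0 : J ≠ ⊥)
    (hr : ∀ α ∈ J, ∀ c ∈ integers K B, α * c ∈ J) : ∃ k, J = fil K B k := by
  obtain ⟨m, hm⟩ := exists_fil_le_of_fg hJ
  obtain ⟨z, hz, hz0⟩ := Submodule.exists_mem_ne_zero_of_ne_bot h0
  obtain ⟨k, ⟨α, hα, hα0, hk⟩, hmin⟩ := Int.exists_least_of_bdd
    (P := fun k => ∃ α ∈ J, α ≠ 0 ∧ ord K α = k)
    ⟨m, by
      rintro k ⟨α, hα, hα0, rfl⟩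
      exact (mem_fil_of_ne hα0).mp (hm hα)⟩ ⟨_, z, hz, hz0, rfl⟩
  refine ⟨k, le_antisymm (fun β hβ => ?_) fun β hβ => ?_⟩
  · by_cases hβ0 : β = 0
    · rw [hβ0]; exact zero_mem _
    · exact Or.inr (hmin _ ⟨β, hβ, hβ0, rfl⟩)
  · have := hr α hα (α⁻¹ * β) (by
      rw [mem_integers_iff_fil, mul_mem_fil_iff_left (inv_ne_zero hα0), ord_inv hα0, hk]
      simpa using hβ)
    rwa [mul_inv_cancel_left₀ hα0] at this

lemma op_smul_ne_zero {v : Fin 2 → B} {b : B} (hv : v ≠ 0) (hb : b ≠ 0) : v <• b ≠ 0 := by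
  intro h
  apply hv
  have := congrArg (· <• b⁻¹) h
  simpa [op_smul_op_smul, mul_inv_cancel₀ hb, hb] using this

lemma IsLattice.op_smul_mem {Λ : Submodule 𝒪[K] (Fin 2 → B)} (hΛ : IsLattice K Λ)
    {v : Fin 2 → B} (hv : v ∈ Λ) {c : B} (hc : c ∈ fil K B 0) : v <• c ∈ Λ :=
  hΛ.2.2 v hv c (mem_integers_iff_fil.mpr hc)

/-- The scalars `α` with `v α` in the lattice form a nonzero finitely generated fractional right
ideal. -/
lemma IsLattice.exists_fil {Λ : Submodule 𝒪[K] (Fin 2 → B)} (hΛ : IsLattice K Λ)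
    {v : Fin 2 → B} (hv : v ≠ 0) : ∃ k : ℤ, ∀ α : B, v <• α ∈ Λ ↔ α ∈ fil K B k := by
  have hinj : Function.Injective (rightMap K v) := by
    rw [injective_iff_map_eq_zero]
    intro b hb
    by_contra hb0
    exact op_smul_ne_zero hv hb0 hb
  obtain ⟨k, hk⟩ := exists_eq_fil (J := Λ.comap (rightMap K v)) (by
      refine Submodule.fg_of_fg_map_injective _ hinj (hΛ.1.of_le ?_)
      exact Submodule.map_comap_le _ _) (by
      obtain ⟨t, ht, htv⟩ := exists_smul_mem_of_span_eq_top hΛ.2.1 v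
      intro h
      have h1 : algebraMap 𝒪[K] B t ∈ Λ.comap (rightMap K v) := by
        rw [Submodule.mem_comap, rightMap_apply]
        convert htv using 1
        ext i
        simp [Algebra.smul_def, Algebra.commutes]
      rw [h, Submodule.mem_bot, IsScalarTower.algebraMap_apply 𝒪[K] K B] at h1
      simp [ht] at h1) (by
      intro α hα c hc
      rw [Submodule.mem_comap, rightMap_apply] at hα ⊢
      rw [← op_smul_op_smul]
      exact hΛ.2.2 _ hα c hc)
  exact ⟨k, fun α => by rw [← hk]; rfl⟩

/-- Every `𝒪_B`-lattice in `B²` is free. -/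
lemma IsLattice.exists_basis {Λ : Submodule 𝒪[K] (Fin 2 → B)} (hΛ : IsLattice K Λ) :
    ∃ x y : Fin 2 → B, IsRightBasis x y ∧ Λ = std K x y 0 0 := by
  obtain ⟨p, hp, hp1⟩ := exists_ord_eq_one K B
  have he1 : (![0, 1] : Fin 2 → B) ≠ 0 := fun h => one_ne_zero (congrFun h 1)
  obtain ⟨b, hb⟩ := hΛ.exists_fil he1
  -- The first projection of the lattice is `𝔪ᵃ` and its kernel is `(0, 1) 𝔪ᵇ`; a lift of a
  -- generator of the image and a generator of the kernel form the basis.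
  obtain ⟨a, ha⟩ := exists_eq_fil (J := Λ.map (LinearMap.proj (R := 𝒪[K]) (φ := fun _ => B) 0))
    (hΛ.1.map _) (by
      intro h
      obtain ⟨t, ht, htv⟩ := exists_smul_mem_of_span_eq_top hΛ.2.1 (![1, 0] : Fin 2 → B)
      have h1 : (LinearMap.proj (R := 𝒪[K]) (φ := fun _ => B) 0) (t • (![1, 0] : Fin 2 → B))
          ∈ Λ.map (LinearMap.proj (R := 𝒪[K]) (φ := fun _ => B) 0) :=
        Submodule.mem_map_of_mem htv
      rw [h, Submodule.mem_bot] at h1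
      have h2 : algebraMap 𝒪[K] B t = 0 := by simpa [Algebra.smul_def] using h1
      rw [IsScalarTower.algebraMap_apply 𝒪[K] K B] at h2
      simp [ht] at h2) (by
      rintro _ ⟨v, hv, rfl⟩ c hc
      exact ⟨_, hΛ.2.2 v hv c hc, rfl⟩)
  obtain ⟨x, hx, hx0⟩ : p ^ a ∈ Λ.map (LinearMap.proj (R := 𝒪[K]) (φ := fun _ => B) 0) := by
    rw [ha]; exact zpow_mem_fil hp hp1 a
  have hx0 : x 0 = p ^ a := hx0
  have hx0' : x 0 ≠ 0 := by rw [hx0]; exact zpow_ne_zero _ hp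
  have hdec : ∀ v : Fin 2 → B, v = x <• ((x 0)⁻¹ * v 0)
      + (![0, 1] <• p ^ b) <• (p ^ (-b) * (v 1 - x 1 * ((x 0)⁻¹ * v 0))) := by
    intro v
    rw [op_smul_op_smul, zpow_neg, mul_inv_cancel_left₀ (zpow_ne_zero _ hp)]
    ext i
    fin_cases i
    · simp [mul_inv_cancel_left₀ hx0']
    · simp
  refine ⟨x, ![0, 1] <• p ^ b, ⟨?_, fun v => ⟨_, _, hdec v⟩⟩, le_antisymm (fun v hv => ?_) ?_⟩
  · intro α β h
    have h0 := congrFun h 0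
    have h1 := congrFun h 1
    simp [hx0'] at h0
    subst h0
    simp [zpow_ne_zero _ hp] at h1
    exact ⟨rfl, h1⟩
  · have hα : (x 0)⁻¹ * v 0 ∈ fil K B 0 := by
      rw [mul_mem_fil_iff_left (inv_ne_zero hx0'), ord_inv hx0', hx0, ord_zpow hp, hp1]
      have : v 0 ∈ fil K B a := by rw [← ha]; exact ⟨v, hv, rfl⟩
      simpa using this
    refine ⟨_, hα, _, ?_, hdec v⟩
    rw [mul_mem_fil_iff_left (zpow_ne_zero _ hp), ord_zpow hp, hp1]
    have h1 : (![0, 1] : Fin 2 → B) <• (v 1 - x 1 * ((x 0)⁻¹ * v 0)) ∈ Λ := by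
      have h2 := sub_mem hv (hΛ.op_smul_mem hx hα)
      convert h2 using 1
      ext i
      fin_cases i
      · simp [mul_inv_cancel_left₀ hx0']
      · simp
    simpa using (hb _).mp h1
  · rintro _ ⟨α, hα, β, hβ, rfl⟩
    exact add_mem (hΛ.op_smul_mem hx hα) (hΛ.op_smul_mem ((hb _).mpr (zpow_mem_fil hp hp1 b)) hβ)

end Lattices

/-! ### Maximal orders as endomorphism rings of lattices. -/

section Orders

variable {K : Type*} [Field K] [ValuativeRel K] [TopologicalSpace K] [IsNonarchimedeanLocalField K]
  {B : Type*} [DivisionRing B] [Algebra K B] [FiniteDimensional K B]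

/-- The endomorphism ring of a lattice, as an algebra over the ring of integers. -/
def endAlg (Λ : Submodule 𝒪[K] (Fin 2 → B)) : Subalgebra 𝒪[K] (Matrix (Fin 2) (Fin 2) B) where
  carrier := endSet Λ
  mul_mem' {M N} hM hN v hv := by
    rw [← Matrix.mulVec_mulVec]
    exact hM _ (hN v hv)
  add_mem' {M N} hM hN v hv := by
    rw [Matrix.add_mulVec]
    exact add_mem (hM v hv) (hN v hv)
  algebraMap_mem' c v hv := by
    rw [Algebra.algebraMap_eq_smul_one, Matrix.smul_mulVec, Matrix.one_mulVec]
    exact Submodule.smul_mem _ _ hv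

lemma mem_endAlg {Λ : Submodule 𝒪[K] (Fin 2 → B)} {M : Matrix (Fin 2) (Fin 2) B} :
    M ∈ endAlg Λ ↔ ∀ v ∈ Λ, M.mulVec v ∈ Λ := Iff.rfl

lemma coe_endAlg (Λ : Submodule 𝒪[K] (Fin 2 → B)) :
    (endAlg Λ : Set (Matrix (Fin 2) (Fin 2) B)) = endSet Λ := rfl

/-- A matrix with prescribed values on a basis. -/
lemma IsRightBasis.exists_matrix {x y : Fin 2 → B} (h : IsRightBasis x y) (x' y' : Fin 2 → B) :
    ∃ M : Matrix (Fin 2) (Fin 2) B, M.mulVec x = x' ∧ M.mulVec y = y' := by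
  obtain ⟨α₀, β₀, h₀⟩ := h.exists_eq ![1, 0]
  obtain ⟨α₁, β₁, h₁⟩ := h.exists_eq ![0, 1]
  have hexp : ∀ v : Fin 2 → B,
      v = x <• (α₀ * v 0 + α₁ * v 1) + y <• (β₀ * v 0 + β₁ * v 1) := by
    intro v
    have : v = (![1, 0] : Fin 2 → B) <• v 0 + (![0, 1] : Fin 2 → B) <• v 1 := by
      ext i; fin_cases i <;> simp
    conv_lhs => rw [this, h₀, h₁]
    simp only [smul_add, op_smul_op_smul, MulOpposite.op_add, add_smul]
    abel
  let M : Matrix (Fin 2) (Fin 2) B :=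
    fun i j => x' i * ![α₀, α₁] j + y' i * ![β₀, β₁] j
  have hM : ∀ v, M.mulVec v = x' <• (α₀ * v 0 + α₁ * v 1) + y' <• (β₀ * v 0 + β₁ * v 1) := by
    intro v
    ext i
    simp only [M, Matrix.mulVec, dotProduct, Fin.sum_univ_two, Pi.add_apply, Pi.smul_apply,
      MulOpposite.smul_eq_mul_unop, MulOpposite.unop_op, Matrix.cons_val_zero, Matrix.cons_val_one]
    noncomm_ring
  refine ⟨M, ?_, ?_⟩
  · obtain ⟨h1, h2⟩ := h.eq_zero (α₀ * x 0 + α₁ * x 1 - 1) (β₀ * x 0 + β₁ * x 1) (by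
      have := hexp x
      simp only [MulOpposite.op_sub, sub_smul, MulOpposite.op_one, one_smul]
      rw [sub_add_eq_add_sub, ← this, sub_self])
    rw [hM, h2, sub_eq_zero.mp h1]
    simp
  · obtain ⟨h1, h2⟩ := h.eq_zero (α₀ * y 0 + α₁ * y 1) (β₀ * y 0 + β₁ * y 1 - 1) (by
      have := hexp y
      simp only [MulOpposite.op_sub, sub_smul, MulOpposite.op_one, one_smul]
      rw [← add_sub_assoc, ← this, sub_self])
    rw [hM, h1, sub_eq_zero.mp h2]
    simp

lemma IsRightBasis.left_ne_zero {x y : Fin 2 → B} (h : IsRightBasis x y) : x ≠ 0 := by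
  rintro rfl
  exact one_ne_zero (h.eq_zero 1 0 (by simp)).1

lemma IsRightBasis.right_ne_zero {x y : Fin 2 → B} (h : IsRightBasis x y) : y ≠ 0 := by
  rintro rfl
  exact one_ne_zero (h.eq_zero 0 1 (by simp)).2

/-- A lattice stable under the endomorphisms of another lattice is homothetic to it. -/
lemma exists_homothety {Λ Λ' : Submodule 𝒪[K] (Fin 2 → B)} (hΛ : IsLattice K Λ)
    (hΛ' : IsLattice K Λ') (h : endAlg Λ ≤ endAlg Λ') :
    ∃ c : B, c ≠ 0 ∧ ∀ v, v ∈ Λ' ↔ v <• c ∈ Λ := by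
  obtain ⟨p, hp, hp1⟩ := exists_ord_eq_one K B
  obtain ⟨x, y, hxy, rfl⟩ := hΛ.exists_basis
  have hend : ∀ M : Matrix (Fin 2) (Fin 2) B, M.mulVec x ∈ std K x y 0 0 →
      M.mulVec y ∈ std K x y 0 0 → M ∈ endAlg Λ' := by
    intro M hMx hMy
    refine h (mem_endAlg.mpr ?_)
    rintro _ ⟨α, hα, β, hβ, rfl⟩
    rw [Matrix.mulVec_add, mulVec_op_smul, mulVec_op_smul]
    exact add_mem (hΛ.op_smul_mem hMx hα) (hΛ.op_smul_mem hMy hβ)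
  have hx : x ∈ std K x y 0 0 := by
    simpa using op_smul_left_mem_std (x := x) (y := y) (a := 0) (b := 0) (one_mem_fil (K := K))
  have hy : y ∈ std K x y 0 0 := by
    simpa using op_smul_right_mem_std (x := x) (y := y) (a := 0) (b := 0) (one_mem_fil (K := K))
  obtain ⟨a, ha⟩ := hΛ'.exists_fil hxy.left_ne_zero
  obtain ⟨b, hb⟩ := hΛ'.exists_fil hxy.right_ne_zero
  -- Swapping `x` and `y` and projecting onto `x` are endomorphisms of the first lattice; stability
  -- under both forces the second one to be `x 𝔪ᵃ + y 𝔪ᵃ`.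
  have hswap : ∀ α : B, x <• α ∈ Λ' ↔ y <• α ∈ Λ' := by
    obtain ⟨M, hMx, hMy⟩ := hxy.exists_matrix y x
    have hM := hend M (by rwa [hMx]) (by rwa [hMy])
    intro α
    constructor
    · intro h1
      have := hM _ h1
      rwa [mulVec_op_smul, hMx] at this
    · intro h1
      have := hM _ h1
      rwa [mulVec_op_smul, hMy] at this
  have hproj : ∀ α β : B, x <• α + y <• β ∈ Λ' → x <• α ∈ Λ' := by
    obtain ⟨M, hMx, hMy⟩ := hxy.exists_matrix x 0
    have hM := hend M (by rwa [hMx]) (by rw [hMy]; exact zero_mem _)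
    intro α β h1
    have := hM _ h1
    rwa [Matrix.mulVec_add, mulVec_op_smul, mulVec_op_smul, hMx, hMy, smul_zero,
      add_zero] at this
  have hΛ'eq : Λ' = std K x y a a := by
    refine le_antisymm (fun v hv => ?_) ?_
    · obtain ⟨α, β, rfl⟩ := hxy.exists_eq v
      have h1 := hproj α β hv
      have h2 : y <• β ∈ Λ' := by
        have := sub_mem hv h1
        rwa [add_sub_cancel_left] at this
      exact ⟨α, (ha _).mp h1, β, (ha _).mp ((hswap β).mpr h2), rfl⟩
    · rintro _ ⟨α, hα, β, hβ, rfl⟩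
      exact add_mem ((ha _).mpr hα) ((hswap _).mp ((ha _).mpr hβ))
  refine ⟨p ^ (-a), zpow_ne_zero _ hp, fun v => ?_⟩
  rw [op_smul_mem_std_iff (zpow_ne_zero _ hp), hΛ'eq, ord_zpow hp, hp1]
  simp

lemma endAlg_eq_of_homothety {Λ Λ' : Submodule 𝒪[K] (Fin 2 → B)} {c : B} (hc : c ≠ 0)
    (h : ∀ v, v ∈ Λ' ↔ v <• c ∈ Λ) : endAlg Λ' = endAlg Λ := by
  ext M
  rw [mem_endAlg, mem_endAlg]
  constructor
  · intro hM v hv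
    have h1 : v <• c⁻¹ ∈ Λ' := by
      rw [h, op_smul_op_smul, inv_mul_cancel₀ hc]
      simpa using hv
    have h2 := (h _).mp (hM _ h1)
    rw [mulVec_op_smul, op_smul_op_smul, inv_mul_cancel₀ hc] at h2
    simpa using h2
  · intro hM v hv
    rw [h, ← mulVec_op_smul]
    exact hM _ ((h v).mp hv)

/-- Evaluation at a basis of the lattice embeds its endomorphism ring into `Λ × Λ`, which gives
finiteness; clearing denominators at the two basis vectors gives the span. -/
lemma isFullOrder_endAlg {Λ : Submodule 𝒪[K] (Fin 2 → B)} (hΛ : IsLattice K Λ) :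
    IsFullOrder K (endAlg Λ) := by
  obtain ⟨x, y, hxy, rfl⟩ := hΛ.exists_basis
  have hx : x ∈ std K x y 0 0 := by
    simpa using op_smul_left_mem_std (x := x) (y := y) (a := 0) (b := 0) (one_mem_fil (K := K))
  have hy : y ∈ std K x y 0 0 := by
    simpa using op_smul_right_mem_std (x := x) (y := y) (a := 0) (b := 0) (one_mem_fil (K := K))
  set Λ := std K x y 0 0
  constructor
  · have : Module.Finite 𝒪[K] Λ := Module.Finite.of_fg hΛ.1
    let f : endAlg Λ →ₗ[𝒪[K]] Λ × Λ :=
      { toFun := fun M => (⟨_, M.2 x hx⟩, ⟨_, M.2 y hy⟩)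
        map_add' := fun M N => by
          exact Prod.ext (Subtype.ext (Matrix.add_mulVec M.1 N.1 x))
            (Subtype.ext (Matrix.add_mulVec M.1 N.1 y))
        map_smul' := fun c M => by
          exact Prod.ext (Subtype.ext (Matrix.smul_mulVec c M.1 x))
            (Subtype.ext (Matrix.smul_mulVec c M.1 y)) }
    refine Module.Finite.of_injective f fun M N hMN => Subtype.ext ?_
    have h1 : M.1.mulVec x = N.1.mulVec x := congrArg Subtype.val (congrArg Prod.fst hMN)
    have h2 : M.1.mulVec y = N.1.mulVec y := congrArg Subtype.val (congrArg Prod.snd hMN)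
    have h3 : ∀ v, M.1.mulVec v = N.1.mulVec v := by
      intro v
      obtain ⟨α, β, rfl⟩ := hxy.exists_eq v
      rw [Matrix.mulVec_add, mulVec_op_smul, mulVec_op_smul, h1, h2, Matrix.mulVec_add,
        mulVec_op_smul, mulVec_op_smul]
    ext i j
    have := congrFun (h3 (Pi.single j 1)) i
    simpa using this
  · refine span_eq_top_of_smul_mem (Λ := Subalgebra.toSubmodule (endAlg Λ)) fun M => ?_
    obtain ⟨s, hs, hsx⟩ := exists_smul_mem_of_span_eq_top hΛ.2.1 (M.mulVec x)
    obtain ⟨t, ht, hty⟩ := exists_smul_mem_of_span_eq_top hΛ.2.1 (M.mulVec y)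
    refine ⟨s * t, mul_ne_zero hs ht, ?_⟩
    change ∀ v ∈ Λ, _
    rintro _ ⟨α, hα, β, hβ, rfl⟩
    rw [Matrix.mulVec_add, mulVec_op_smul, mulVec_op_smul, Matrix.smul_mulVec,
      Matrix.smul_mulVec]
    refine add_mem (hΛ.op_smul_mem ?_ hα) (hΛ.op_smul_mem ?_ hβ)
    · rw [mul_comm, mul_smul]; exact Submodule.smul_mem _ _ hsx
    · rw [mul_smul]; exact Submodule.smul_mem _ _ hty

variable (K B) in
/-- Multiplication of matrices and vectors as a bilinear map. -/
noncomputable def mulVecBilinear :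
    Matrix (Fin 2) (Fin 2) B →ₗ[𝒪[K]] (Fin 2 → B) →ₗ[𝒪[K]] (Fin 2 → B) :=
  LinearMap.mk₂ 𝒪[K] Matrix.mulVec Matrix.add_mulVec Matrix.smul_mulVec Matrix.mulVec_add
    (fun c M v => Matrix.mulVec_smul M c v)

/-- The lattice generated by the translates of a lattice under an order. -/
lemma isLattice_map₂ {H : Subalgebra 𝒪[K] (Matrix (Fin 2) (Fin 2) B)}
    (hH : (Subalgebra.toSubmodule H).FG) {Λ : Submodule 𝒪[K] (Fin 2 → B)} (hΛ : IsLattice K Λ) :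
    IsLattice K (Submodule.map₂ (mulVecBilinear K B) (Subalgebra.toSubmodule H) Λ) ∧
    H ≤ endAlg (Submodule.map₂ (mulVecBilinear K B) (Subalgebra.toSubmodule H) Λ) ∧
    Λ ≤ Submodule.map₂ (mulVecBilinear K B) (Subalgebra.toSubmodule H) Λ := by
  have hle : Λ ≤ Submodule.map₂ (mulVecBilinear K B) (Subalgebra.toSubmodule H) Λ := by
    intro v hv
    have := Submodule.apply_mem_map₂ (mulVecBilinear K B)
      (show (1 : Matrix (Fin 2) (Fin 2) B) ∈ Subalgebra.toSubmodule H from one_mem H) hv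
    simpa [mulVecBilinear] using this
  have hspan : Submodule.map₂ (mulVecBilinear K B) (Subalgebra.toSubmodule H) Λ
      = Submodule.span 𝒪[K] (Set.image2 (fun M v => mulVecBilinear K B M v)
        (Subalgebra.toSubmodule H : Set (Matrix (Fin 2) (Fin 2) B)) (Λ : Set (Fin 2 → B))) :=
    Submodule.map₂_eq_span_image2 _ _ _
  refine ⟨⟨hH.map₂ _ hΛ.1, ?_, ?_⟩, ?_, hle⟩
  · rw [eq_top_iff, ← hΛ.2.1]
    exact Submodule.span_mono hle
  · intro v hv b hb
    change v <• b ∈ _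
    rw [hspan] at hv ⊢
    induction hv using Submodule.span_induction with
    | mem v hv =>
      obtain ⟨M, hM, w, hw, rfl⟩ := hv
      refine Submodule.subset_span ⟨M, hM, w <• b, hΛ.2.2 w hw b hb, ?_⟩
      exact mulVec_op_smul M w b
    | zero => rw [smul_zero]; exact zero_mem _
    | add v w _ _ hv hw => rw [smul_add]; exact add_mem hv hw
    | smul c v _ hv => rw [smul_comm]; exact Submodule.smul_mem _ _ hv
  · intro N hN v hv
    rw [hspan] at hv ⊢
    induction hv using Submodule.span_induction with
    | mem v hv =>
      obtain ⟨M, hM, w, hw, rfl⟩ := hv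
      refine Submodule.subset_span ⟨N * M, H.mul_mem hN hM, w, hw, ?_⟩
      exact (Matrix.mulVec_mulVec w N M).symm
    | zero => rw [Matrix.mulVec_zero]; exact zero_mem _
    | add v w _ _ hv hw => rw [Matrix.mulVec_add]; exact add_mem hv hw
    | smul c v _ hv => rw [Matrix.mulVec_smul]; exact Submodule.smul_mem _ _ hv

variable (B) in
lemma isRightBasis_standard : IsRightBasis (![1, 0] : Fin 2 → B) ![0, 1] where
  eq_zero α β h := by
    have h0 := congrFun h 0
    have h1 := congrFun h 1
    simp at h0 h1
    exact ⟨h0, h1⟩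
  exists_eq v := ⟨v 0, v 1, by ext i; fin_cases i <;> simp⟩

/-- Every algebra that is finitely generated as a module stabilizes a lattice. -/
lemma exists_isLattice_le_endAlg {H : Subalgebra 𝒪[K] (Matrix (Fin 2) (Fin 2) B)}
    (hH : (Subalgebra.toSubmodule H).FG) :
    ∃ Λ : Submodule 𝒪[K] (Fin 2 → B), IsLattice K Λ ∧ H ≤ endAlg Λ :=
  ⟨_, (isLattice_map₂ hH ((isRightBasis_standard B).isLattice_std 0 0)).1,
    (isLattice_map₂ hH ((isRightBasis_standard B).isLattice_std 0 0)).2.1⟩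

/-- A larger order stabilizes some lattice, which is then homothetic to `Λ` and so has the same
endomorphism ring. -/
theorem isMaximalOrder_endAlg {Λ : Submodule 𝒪[K] (Fin 2 → B)} (hΛ : IsLattice K Λ) :
    IsMaximalOrder K (endAlg Λ) := by
  refine ⟨isFullOrder_endAlg hΛ, fun D hD hle => ?_⟩
  obtain ⟨Λ', hΛ', hD'⟩ := exists_isLattice_le_endAlg (Module.Finite.iff_fg.mp hD.1)
  obtain ⟨c, hc, h⟩ := exists_homothety hΛ hΛ' (hle.trans hD')
  rwa [endAlg_eq_of_homothety hc h] at hD'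

theorem isMaximalOrder_iff {D : Subalgebra 𝒪[K] (Matrix (Fin 2) (Fin 2) B)} :
    IsMaximalOrder K D ↔ ∃ Λ : Submodule 𝒪[K] (Fin 2 → B), IsLattice K Λ ∧ D = endAlg Λ := by
  constructor
  · intro hD
    obtain ⟨Λ, hΛ, hle⟩ := exists_isLattice_le_endAlg (Module.Finite.iff_fg.mp hD.1.1)
    exact ⟨Λ, hΛ, le_antisymm hle (hD.2 (isFullOrder_endAlg hΛ) hle)⟩
  · rintro ⟨Λ, hΛ, rfl⟩
    exact isMaximalOrder_endAlg hΛ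

end Orders

/-! ### Apartments and the shape of a branch. -/

section Apartment

variable {K : Type*} [Field K] [ValuativeRel K] [TopologicalSpace K] [IsNonarchimedeanLocalField K]
  {B : Type*} [DivisionRing B] [Algebra K B] [FiniteDimensional K B]

lemma eq_std_of_homothety {x y : Fin 2 → B} {Λ : Submodule 𝒪[K] (Fin 2 → B)} {a b : ℤ} {c : B}
    (hc : c ≠ 0) (h : ∀ v, v ∈ Λ ↔ v <• c ∈ std K x y a b) :
    Λ = std K x y (a - ord K c) (b - ord K c) := by
  ext v
  rw [h, op_smul_mem_std_iff hc]

lemma IsRightBasis.exists_eq_std_of_endAlg_eq {x y : Fin 2 → B} (hxy : IsRightBasis x y)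
    {Λ : Submodule 𝒪[K] (Fin 2 → B)} (hΛ : IsLattice K Λ) {a b : ℤ}
    (h : endAlg (std K x y a b) = endAlg Λ) : ∃ k, Λ = std K x y (a + k) (b + k) := by
  obtain ⟨c, hc, hcv⟩ := exists_homothety (hxy.isLattice_std a b) hΛ h.le
  exact ⟨-ord K c, by rw [eq_std_of_homothety hc hcv]; rfl⟩

lemma image_op_smul_std {x y : Fin 2 → B} {a b : ℤ} {p : B} (hp : p ≠ 0) (hp1 : ord K p = 1) :
    (fun (v : Fin 2 → B) (i : Fin 2) => v i * p) '' (std K x y a b : Set (Fin 2 → B))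
      = std K x y (a + 1) (b + 1) := by
  ext v
  constructor
  · rintro ⟨w, hw, rfl⟩
    have := op_smul_mem_std hw (mem_fil_ord (K := K) p)
    rwa [hp1] at this
  · intro hv
    refine ⟨v <• p⁻¹, ?_, ?_⟩
    · have := op_smul_mem_std hv (mem_fil_ord (K := K) p⁻¹)
      rw [ord_inv hp, hp1] at this
      simpa using this
    · change (v <• p⁻¹) <• p = v
      rw [op_smul_op_smul, inv_mul_cancel₀ hp]
      simp

lemma isNeighbor_std_succ {x y : Fin 2 → B} (hxy : IsRightBasis x y)
    {D D' : MaximalOrder K (Matrix (Fin 2) (Fin 2) B)} {i : ℤ}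
    (hD : D.1 = endAlg (std K x y 0 i)) (hD' : D'.1 = endAlg (std K x y 0 (i + 1))) :
    IsNeighbor K D D' := by
  obtain ⟨p, hp, hp1⟩ := exists_ord_eq_one K B
  refine ⟨_, _, p, hxy.isLattice_std 0 i, hxy.isLattice_std 0 (i + 1),
    isUniformizer_iff.mpr ⟨hp, hp1⟩, by rw [hD]; rfl, by rw [hD']; rfl, ?_, ?_⟩
  · rw [image_op_smul_std hp hp1, SetLike.coe_ssubset_coe, lt_iff_le_not_ge, hxy.std_le_std,
      hxy.std_le_std]
    omega
  · rw [SetLike.coe_ssubset_coe, lt_iff_le_not_ge, hxy.std_le_std, hxy.std_le_std]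
    omega

/-- The lattices realizing the adjacency are homothetic to the diagonal ones. The strict inclusions
say that exactly one of the two exponents grows by one. -/
lemma eq_succ_of_isNeighbor {x y : Fin 2 → B} (hxy : IsRightBasis x y)
    {D D' : MaximalOrder K (Matrix (Fin 2) (Fin 2) B)} {i j : ℤ}
    (hD : D.1 = endAlg (std K x y 0 i)) (hD' : D'.1 = endAlg (std K x y 0 j))
    (h : IsNeighbor K D D') : i + 1 = j ∨ j + 1 = i := by
  obtain ⟨Λ, Λ', p, hΛ, hΛ', hp, hDΛ, hDΛ', h1, h2⟩ := h
  rw [isUniformizer_iff] at hp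
  obtain ⟨k, rfl⟩ := hxy.exists_eq_std_of_endAlg_eq hΛ (a := 0) (b := i)
    (SetLike.coe_injective (by rw [← hD, hDΛ, coe_endAlg]))
  obtain ⟨k', rfl⟩ := hxy.exists_eq_std_of_endAlg_eq hΛ' (a := 0) (b := j)
    (SetLike.coe_injective (by rw [← hD', hDΛ', coe_endAlg]))
  rw [image_op_smul_std hp.1 hp.2, SetLike.coe_ssubset_coe, lt_iff_le_not_ge, hxy.std_le_std,
    hxy.std_le_std] at h1
  rw [SetLike.coe_ssubset_coe, lt_iff_le_not_ge, hxy.std_le_std, hxy.std_le_std] at h2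
  omega

/-- If the stable lattices of `H` all lie in one apartment, the branch of `H` is the full
subgraph of the integer line on the corresponding set of integers. -/
theorem exists_equiv_branch {x y : Fin 2 → B} (hxy : IsRightBasis x y) (I : Set ℤ)
    {H : Subalgebra 𝒪[K] (Matrix (Fin 2) (Fin 2) B)}
    (hI : ∀ i ∈ I, H ≤ endAlg (std K x y 0 i))
    (hH : ∀ Λ : Submodule 𝒪[K] (Fin 2 → B), IsLattice K Λ → H ≤ endAlg Λ →
      ∃ a b : ℤ, b - a ∈ I ∧ Λ = std K x y a b) :
    ∃ φ : I ≃ branchVertices H, ∀ i j : I,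
      (branch H).Adj (φ i) (φ j) ↔ (i : ℤ) + 1 = j ∨ (j : ℤ) + 1 = i := by
  let f : I → branchVertices H := fun i =>
    ⟨⟨endAlg (std K x y 0 i), isMaximalOrder_endAlg (hxy.isLattice_std 0 i)⟩, hI i i.2⟩
  have hf : ∀ i, (f i).1.1 = endAlg (std K x y 0 i) := fun _ => rfl
  have hinj : Function.Injective f := by
    intro i j hij
    have h1 : endAlg (std K x y 0 i) = endAlg (std K x y 0 j) :=
      congrArg (fun z : branchVertices H => z.1.1) hij
    obtain ⟨k, hk⟩ := hxy.exists_eq_std_of_endAlg_eq (hxy.isLattice_std 0 j) h1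
    rw [hxy.std_inj] at hk
    exact Subtype.ext (by omega)
  have hsurj : Function.Surjective f := by
    rintro ⟨⟨D, hD⟩, hHD⟩
    obtain ⟨Λ, hΛ, rfl⟩ := isMaximalOrder_iff.mp hD
    obtain ⟨a, b, hab, rfl⟩ := hH Λ hΛ hHD
    -- A homothety brings the first exponent to zero, so only the difference matters.
    refine ⟨⟨b - a, hab⟩, Subtype.ext (Subtype.ext ?_)⟩
    obtain ⟨p, hp, hp1⟩ := exists_ord_eq_one K B
    refine endAlg_eq_of_homothety (zpow_ne_zero a hp) fun v => ?_
    rw [op_smul_mem_std_iff (zpow_ne_zero _ hp), ord_zpow hp, hp1]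
    simp
  refine ⟨Equiv.ofBijective f ⟨hinj, hsurj⟩, fun i j => ?_⟩
  change (bruhatTitsTree K B).Adj (f i).1 (f j).1 ↔ _
  rw [bruhatTitsTree, SimpleGraph.fromRel_adj]
  constructor
  · rintro ⟨-, h | h⟩
    · exact eq_succ_of_isNeighbor hxy (hf i) (hf j) h
    · exact (eq_succ_of_isNeighbor hxy (hf j) (hf i) h).symm
  · intro h
    refine ⟨fun he => ?_, ?_⟩
    · have := congrArg Subtype.val (hinj (Subtype.ext he))
      omega
    · rcases h with h | h
      · exact Or.inl (isNeighbor_std_succ hxy (hf i) (by rw [h]))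
      · exact Or.inr (isNeighbor_std_succ hxy (hf j) (by rw [h]))

theorem isMaximalPath_branch {x y : Fin 2 → B} (hxy : IsRightBasis x y)
    {H : Subalgebra 𝒪[K] (Matrix (Fin 2) (Fin 2) B)}
    (hI : ∀ i : ℤ, H ≤ endAlg (std K x y 0 i))
    (hH : ∀ Λ : Submodule 𝒪[K] (Fin 2 → B), IsLattice K Λ → H ≤ endAlg Λ →
      ∃ a b : ℤ, Λ = std K x y a b) : IsMaximalPath (branch H) := by
  obtain ⟨φ, hφ⟩ := exists_equiv_branch hxy Set.univ (fun i _ => hI i) (fun Λ hΛ h => by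
    obtain ⟨a, b, hab⟩ := hH Λ hΛ h
    exact ⟨a, b, Set.mem_univ _, hab⟩)
  refine ⟨⟨(Equiv.Set.univ ℤ).symm.trans φ, fun {i j} => ?_⟩⟩
  rw [Equiv.trans_apply, Equiv.trans_apply, hφ, SimpleGraph.hasse_adj, Order.covBy_iff_add_one_eq,
    Order.covBy_iff_add_one_eq]
  rfl

theorem isPathOfLength_branch {x y : Fin 2 → B} (hxy : IsRightBasis x y) (l : ℕ)
    {H : Subalgebra 𝒪[K] (Matrix (Fin 2) (Fin 2) B)}
    (hI : ∀ i : ℤ, 0 ≤ i → i ≤ l → H ≤ endAlg (std K x y 0 i))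
    (hH : ∀ Λ : Submodule 𝒪[K] (Fin 2 → B), IsLattice K Λ → H ≤ endAlg Λ →
      ∃ a b : ℤ, 0 ≤ b - a ∧ b - a ≤ l ∧ Λ = std K x y a b) : IsPathOfLength (branch H) l := by
  obtain ⟨φ, hφ⟩ := exists_equiv_branch hxy (Set.Icc 0 (l : ℤ)) (fun i hi => hI i hi.1 hi.2)
    (fun Λ hΛ h => by
      obtain ⟨a, b, h1, h2, hab⟩ := hH Λ hΛ h
      exact ⟨a, b, ⟨h1, h2⟩, hab⟩)
  let g : Fin (l + 1) ≃ Set.Icc (0 : ℤ) l :=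
    { toFun := fun i => ⟨i, by omega, by have := i.2; omega⟩
      invFun := fun i => ⟨i.1.toNat, by have := i.2.2; omega⟩
      left_inv := fun i => by ext; simp
      right_inv := fun i => by
        ext
        have := i.2.1
        simp [this] }
  refine ⟨⟨g.trans φ, fun {i j} => ?_⟩⟩
  rw [Equiv.trans_apply, Equiv.trans_apply, hφ, SimpleGraph.pathGraph_adj]
  change ((i : ℕ) : ℤ) + 1 = ((j : ℕ) : ℤ) ∨ ((j : ℕ) : ℤ) + 1 = ((i : ℕ) : ℤ) ↔ _
  omega

end Apartment

/-! ### Commutative algebras that are not fields. -/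

section NotField

variable {K : Type*} [Field K] {B : Type*} [DivisionRing B] [Algebra K B] [FiniteDimensional K B]

/-- The map `(α, β) ↦ x α + y β`. -/
noncomputable def pairMap (x y : Fin 2 → B) : (B × B) →ₗ[K] (Fin 2 → B) where
  toFun z := x <• z.1 + y <• z.2
  map_add' z w := by
    simp only [Prod.fst_add, Prod.snd_add, MulOpposite.op_add, add_smul]
    abel
  map_smul' c z := by
    simp only [Prod.smul_fst, Prod.smul_snd, MulOpposite.op_smul, smul_assoc, smul_add,
      RingHom.id_apply]

include K in
variable (K) in
-- Dimension count over `K` for the map `(α, β) ↦ x α + y β`.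
lemma isRightBasis_of_eq_zero {x y : Fin 2 → B}
    (h : ∀ α β : B, x <• α + y <• β = 0 → α = 0 ∧ β = 0) : IsRightBasis x y := by
  refine ⟨h, fun v => ?_⟩
  have hinj : Function.Injective (pairMap (K := K) x y) := by
    rw [injective_iff_map_eq_zero]
    intro z hz
    exact Prod.ext (h _ _ hz).1 (h _ _ hz).2
  have hsurj := (LinearMap.injective_iff_surjective_of_finrank_eq_finrank (by
    rw [Module.finrank_prod, Module.finrank_pi_fintype]
    simp [two_mul])).mp hinj
  obtain ⟨z, hz⟩ := hsurj v
  exact ⟨z.1, z.2, hz.symm⟩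

include K in
variable (K) in
lemma isRightBasis_of_exists_eq {x y : Fin 2 → B}
    (h : ∀ v : Fin 2 → B, ∃ α β : B, v = x <• α + y <• β) : IsRightBasis x y := by
  refine ⟨fun α β hαβ => ?_, h⟩
  have hsurj : Function.Surjective (pairMap (K := K) x y) := by
    intro v
    obtain ⟨α, β, rfl⟩ := h v
    exact ⟨(α, β), rfl⟩
  have hinj := (LinearMap.injective_iff_surjective_of_finrank_eq_finrank (by
    rw [Module.finrank_prod, Module.finrank_pi_fintype]
    simp [two_mul])).mpr hsurj
  have : ((α, β) : B × B) = 0 := hinj (by rw [map_zero]; exact hαβ)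
  exact ⟨congrArg Prod.fst this, congrArg Prod.snd this⟩

variable [ValuativeRel K]

lemma mem_ringOfIntegers {A : Type*} [Ring A] [Algebra K A] (L : Subalgebra K A)
    [IsMulCommutative L] {a : A} : a ∈ ringOfIntegers K L ↔ a ∈ L ∧ IsIntegral 𝒪[K] a := by
  unfold ringOfIntegers
  rw [Subalgebra.mem_map]
  constructor
  · rintro ⟨s, hs, rfl⟩
    exact ⟨s.2, (hs : IsIntegral 𝒪[K] s).map (L.val.restrictScalars 𝒪[K])⟩
  · rintro ⟨ha, hintegral⟩
    refine ⟨⟨a, ha⟩, ?_, rfl⟩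
    exact (isIntegral_algHom_iff (L.val.restrictScalars 𝒪[K]) Subtype.val_injective).mp hintegral

/-- The ideal of a nonzero non-unit has a complement by semisimplicity; the component of `1` in it
is the idempotent. -/
lemma exists_idempotent_of_not_isField {R : Type*} [CommRing R] [Nontrivial R] [IsSemisimpleRing R]
    (h : ¬ IsField R) : ∃ e : R, e * e = e ∧ e ≠ 0 ∧ e ≠ 1 := by
  obtain ⟨a, ha, hau⟩ := Ring.exists_not_isUnit_of_not_isField h
  obtain ⟨J, hJ⟩ := exists_isCompl (Ideal.span {a})
  obtain ⟨e, he, e', he', hee⟩ := Submodule.mem_sup.mp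
    (show (1 : R) ∈ Ideal.span {a} ⊔ J from hJ.sup_eq_top ▸ Submodule.mem_top)
  have h0 : e * e' = 0 := by
    have : e * e' ∈ Ideal.span {a} ⊓ J := ⟨Ideal.mul_mem_right _ _ he, Ideal.mul_mem_left _ _ he'⟩
    rwa [hJ.inf_eq_bot, Ideal.mem_bot] at this
  refine ⟨e, ?_, ?_, ?_⟩
  · calc e * e = e * (e + e') - e * e' := by ring
      _ = e := by rw [hee, h0, mul_one, sub_zero]
  · rintro rfl
    rw [zero_add] at hee
    subst hee
    have : a ∈ Ideal.span {a} ⊓ J :=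
      ⟨Ideal.mem_span_singleton_self a, by simpa using Ideal.mul_mem_left J a he'⟩
    rw [hJ.inf_eq_bot, Ideal.mem_bot] at this
    exact ha this
  · rintro rfl
    exact hau (Ideal.span_singleton_eq_top.mp ((Ideal.eq_top_iff_one _).mpr he))

lemma exists_mulVec_ne_zero {M : Matrix (Fin 2) (Fin 2) B} (hM : M ≠ 0) :
    ∃ v, M.mulVec v ≠ 0 := by
  by_contra h
  push Not at h
  apply hM
  ext i j
  simpa using congrFun (h (Pi.single j 1)) i

variable [TopologicalSpace K] [IsNonarchimedeanLocalField K]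

/-- Applying a monic equation of `M` to its eigenvector gives the same equation for `α`. -/
lemma isIntegral_of_mulVec_eq {M : Matrix (Fin 2) (Fin 2) B} (hM : IsIntegral 𝒪[K] M)
    {x : Fin 2 → B} (hx : x ≠ 0) {α : B} (h : M.mulVec x = x <• α) : IsIntegral 𝒪[K] α := by
  obtain ⟨P, hP, hPM⟩ := hM
  refine ⟨P, hP, ?_⟩
  have hpow : ∀ k : ℕ, (M ^ k).mulVec x = x <• (α ^ k) := by
    intro k
    induction k with
    | zero => simp
    | succ k ih =>
      rw [pow_succ', ← Matrix.mulVec_mulVec, ih, mulVec_op_smul, h, op_smul_op_smul, pow_succ']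
  have hev : ∀ Q : Polynomial 𝒪[K],
      (Polynomial.aeval M Q).mulVec x = x <• (Polynomial.aeval α Q) := by
    intro Q
    induction Q using Polynomial.induction_on' with
    | add p q hp hq =>
      rw [map_add, map_add, Matrix.add_mulVec, hp, hq, MulOpposite.op_add, add_smul]
    | monomial k c =>
      rw [Polynomial.aeval_monomial, Polynomial.aeval_monomial, ← Algebra.smul_def,
        ← Algebra.smul_def, Matrix.smul_mulVec, hpow, MulOpposite.op_smul, smul_assoc]
  have h1 := hev P
  rw [Polynomial.aeval_def, hPM, Matrix.zero_mulVec] at h1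
  by_contra hne
  exact op_smul_ne_zero hx hne h1.symm

/-- The branch of the integers of a commutative algebra that is not a field. -/
theorem isMaximalPath_branch_of_idempotent (L : Subalgebra K (Matrix (Fin 2) (Fin 2) B))
    [IsMulCommutative L] {ε : Matrix (Fin 2) (Fin 2) B} (hε : ε ∈ L) (hidem : ε * ε = ε)
    (h0 : ε ≠ 0) (h1 : ε ≠ 1) : IsMaximalPath (branch (ringOfIntegers K L)) := by
  obtain ⟨v, hv⟩ := exists_mulVec_ne_zero h0
  obtain ⟨w, hw⟩ := exists_mulVec_ne_zero (sub_ne_zero.mpr h1.symm)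
  -- The image and the kernel of `ε` are both nonzero, hence lines; `x` and `y` span them.
  set x := ε.mulVec v with hx
  set y := (1 - ε).mulVec w with hy
  have hεx : ε.mulVec x = x := by rw [hx, Matrix.mulVec_mulVec, hidem]
  have hεy : ε.mulVec y = 0 := by
    rw [hy, Matrix.mulVec_mulVec, mul_sub, hidem, mul_one, sub_self, Matrix.zero_mulVec]
  have hxy : IsRightBasis x y := by
    refine isRightBasis_of_eq_zero K fun α β h => ?_
    have h2 := congrArg ε.mulVec h
    rw [Matrix.mulVec_add, mulVec_op_smul, mulVec_op_smul, hεx, hεy, smul_zero, add_zero,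
      Matrix.mulVec_zero] at h2
    have hα : α = 0 := by
      by_contra hα
      exact op_smul_ne_zero hv hα h2
    subst hα
    refine ⟨rfl, ?_⟩
    by_contra hβ
    refine op_smul_ne_zero hw hβ ?_
    simpa using h
  have hεint : IsIntegral 𝒪[K] ε := by
    refine ⟨Polynomial.X ^ 2 - Polynomial.X, ?_, ?_⟩
    · exact Polynomial.monic_X_pow_sub (by simp)
    · simp [sq, hidem]
  have hεH : ε ∈ ringOfIntegers K L := (mem_ringOfIntegers L).mpr ⟨hε, hεint⟩
  -- Integers of `L` commute with `ε`, so they act on the two lines by integral scalars and preserve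
  -- all diagonal lattices. Conversely `ε` is itself integral, so it splits each stable lattice
  -- along the two lines.
  refine isMaximalPath_branch hxy (fun i => ?_) fun Λ hΛ hle => ?_
  · intro M hM
    rw [mem_ringOfIntegers] at hM
    have hcomm : ε * M = M * ε :=
      congrArg Subtype.val (mul_comm' (⟨ε, hε⟩ : L) (⟨M, hM.1⟩ : L))
    have hMx : ∃ α : B, M.mulVec x = x <• α := by
      obtain ⟨α, β, hαβ⟩ := hxy.exists_eq (M.mulVec x)
      refine ⟨α, ?_⟩
      have h2 := congrArg ε.mulVec hαβ
      rwa [Matrix.mulVec_mulVec, hcomm, ← Matrix.mulVec_mulVec, hεx, Matrix.mulVec_add,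
        mulVec_op_smul, mulVec_op_smul, hεx, hεy, smul_zero, add_zero] at h2
    have hMy : ∃ β : B, M.mulVec y = y <• β := by
      obtain ⟨α, β, hαβ⟩ := hxy.exists_eq (M.mulVec y)
      have h2 := congrArg ε.mulVec hαβ
      rw [Matrix.mulVec_mulVec, hcomm, ← Matrix.mulVec_mulVec, hεy, Matrix.mulVec_add,
        mulVec_op_smul, mulVec_op_smul, hεx, hεy, smul_zero, add_zero, Matrix.mulVec_zero] at h2
      refine ⟨β, ?_⟩
      rwa [← h2, zero_add] at hαβ
    obtain ⟨α, hα⟩ := hMx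
    obtain ⟨β, hβ⟩ := hMy
    have hαi := mem_integers_iff_fil.mp
      (show α ∈ integers K B from isIntegral_of_mulVec_eq hM.2 hxy.left_ne_zero hα)
    have hβi := mem_integers_iff_fil.mp
      (show β ∈ integers K B from isIntegral_of_mulVec_eq hM.2 hxy.right_ne_zero hβ)
    rw [mem_endAlg]
    rintro _ ⟨γ, hγ, δ, hδ, rfl⟩
    rw [Matrix.mulVec_add, mulVec_op_smul, mulVec_op_smul, hα, hβ, op_smul_op_smul,
      op_smul_op_smul]
    exact ⟨_, mul_mem_fil_left hαi hγ, _, mul_mem_fil_left hβi hδ, rfl⟩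
  · obtain ⟨a, ha⟩ := hΛ.exists_fil hxy.left_ne_zero
    obtain ⟨b, hb⟩ := hΛ.exists_fil hxy.right_ne_zero
    refine ⟨a, b, le_antisymm (fun u hu => ?_) ?_⟩
    · obtain ⟨α, β, rfl⟩ := hxy.exists_eq u
      have h2 := hle hεH _ hu
      rw [Matrix.mulVec_add, mulVec_op_smul, mulVec_op_smul, hεx, hεy, smul_zero,
        add_zero] at h2
      have h3 := sub_mem hu h2
      rw [add_sub_cancel_left] at h3
      exact ⟨α, (ha _).mp h2, β, (hb _).mp h3, rfl⟩
    · rintro _ ⟨α, hα, β, hβ, rfl⟩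
      exact add_mem ((ha _).mpr hα) ((hb _).mpr hβ)

end NotField

/-! ### The ramification index in terms of valuations. -/

section RamificationIndex

variable {K : Type*} [Field K] [ValuativeRel K] [TopologicalSpace K] [IsNonarchimedeanLocalField K]
  {F L : Type*} [Field F] [Algebra K F] [FiniteDimensional K F] [Field L] [Algebra K L]
  [FiniteDimensional K L]

lemma mem_integralClosure_iff_fil {x : F} : x ∈ integralClosure 𝒪[K] F ↔ x ∈ fil K F 0 :=
  mem_integers_iff_fil

lemma mem_maxIdeal {x : integralClosure 𝒪[K] F} : x ∈ maxIdeal K F ↔ (x : F) ∈ fil K F 1 := by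
  unfold maxIdeal
  rw [Ideal.mem_jacobson_bot]
  constructor
  · intro h
    by_contra hx
    have hx0 : (x : F) ≠ 0 := by intro h0; rw [h0] at hx; exact hx (zero_mem _)
    have hord : ord K (x : F) = 0 := ord_eq_of_mem_fil (mem_integralClosure_iff_fil.mp x.2) hx
    have hinv : -(x : F)⁻¹ ∈ integralClosure 𝒪[K] F := by
      refine neg_mem (mem_integralClosure_iff_fil.mpr (Or.inr ?_))
      rw [ord_inv hx0, hord]
      simp
    have := h ⟨_, hinv⟩
    have h0 : x * ⟨-(x : F)⁻¹, hinv⟩ + 1 = 0 := Subtype.ext (by simp [hx0])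
    rw [h0] at this
    exact not_isUnit_zero this
  · intro hx y
    have h1 : (1 : F) - -((x : F) * y) ∈ fil K F 0 :=
      sub_mem one_mem_fil (neg_mem (fil_mono (by norm_num)
        (mul_mem_fil_right hx (mem_integralClosure_iff_fil.mp y.2))))
    have hord : ord K ((x : F) * y + 1) = 0 := by
      rw [ord_eq_of_sub_mem (K := K) (a := 1) (x := (1 : F)) one_ne_zero (by simp), ord_one]
      have := neg_mem (mul_mem_fil_right hx (mem_integralClosure_iff_fil.mp y.2))
      convert this using 1
      ring
    have hne : (x : F) * y + 1 ≠ 0 := by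
      intro h0
      have : (1 : F) ∈ fil K F 1 := by
        have h2 := neg_mem (mul_mem_fil_right hx (mem_integralClosure_iff_fil.mp y.2))
        rwa [← eq_neg_of_add_eq_zero_right h0] at h2
      exact not_mem_fil_of_lt one_ne_zero (by simp) this
    have hinv : ((x : F) * y + 1)⁻¹ ∈ integralClosure 𝒪[K] F := by
      refine mem_integralClosure_iff_fil.mpr (Or.inr ?_)
      rw [ord_inv hne, hord]
      simp
    exact IsUnit.of_mul_eq_one (⟨_, hinv⟩ : integralClosure 𝒪[K] F)
      (Subtype.ext (mul_inv_cancel₀ hne))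

lemma maxIdeal_pow_eq {p : F} (hp : p ≠ 0) (hp1 : ord K p = 1) (hpO : p ∈ integralClosure 𝒪[K] F)
    (e : ℕ) : maxIdeal K F ^ e = Ideal.span {(⟨p, hpO⟩ : integralClosure 𝒪[K] F) ^ e} := by
  have h1 : maxIdeal K F = Ideal.span {(⟨p, hpO⟩ : integralClosure 𝒪[K] F)} := by
    ext x
    rw [mem_maxIdeal, Ideal.mem_span_singleton]
    constructor
    · intro hx
      have hy : p⁻¹ * (x : F) ∈ integralClosure 𝒪[K] F := by
        rw [mem_integralClosure_iff_fil, mul_mem_fil_iff_left (inv_ne_zero hp), ord_inv hp, hp1]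
        simpa using hx
      exact ⟨⟨_, hy⟩, Subtype.ext (mul_inv_cancel_left₀ hp _).symm⟩
    · rintro ⟨y, rfl⟩
      exact mul_mem_fil_right (Or.inr hp1.ge) (mem_integralClosure_iff_fil.mp y.2)
  rw [h1, Ideal.span_singleton_pow]

lemma mem_maxIdeal_pow {x : integralClosure 𝒪[K] F} (e : ℕ) :
    x ∈ maxIdeal K F ^ e ↔ (x : F) ∈ fil K F e := by
  obtain ⟨p, hp, hp1⟩ := exists_ord_eq_one K F
  have hpO : p ∈ integralClosure 𝒪[K] F := mem_integralClosure_iff_fil.mpr (Or.inr (by omega))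
  rw [maxIdeal_pow_eq hp hp1 hpO, Ideal.mem_span_singleton]
  constructor
  · rintro ⟨y, rfl⟩
    refine mul_mem_fil_right ?_ (mem_integralClosure_iff_fil.mp y.2)
    simpa using pow_mem_fil (a := 1) (Or.inr hp1.ge) e
  · intro hx
    have hy : (p ^ e)⁻¹ * (x : F) ∈ integralClosure 𝒪[K] F := by
      rw [mem_integralClosure_iff_fil, mul_mem_fil_iff_left (inv_ne_zero (pow_ne_zero _ hp)),
        ord_inv (pow_ne_zero _ hp), ord_pow hp, hp1]
      simpa using hx
    exact ⟨⟨_, hy⟩, Subtype.ext (mul_inv_cancel_left₀ (pow_ne_zero _ hp) _).symm⟩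

lemma map_mem_fil_zero (f : F →ₐ[K] L) {x : F} (hx : x ∈ fil K F 0) : f x ∈ fil K L 0 := by
  rw [← mem_integers_iff_fil] at hx ⊢
  exact IsIntegral.map (f.restrictScalars 𝒪[K]) hx

lemma ord_map_eq_zero (f : F →ₐ[K] L) {x : F} (hx : x ≠ 0) (h : ord K x = 0) :
    ord K (f x) = 0 := by
  have hfx : f x ≠ 0 := by simpa using hx
  have h1 := (mem_fil_of_ne hfx).mp (map_mem_fil_zero f (x := x) (Or.inr h.ge))
  have h2 := map_mem_fil_zero f (x := x⁻¹) (Or.inr (by rw [ord_inv hx, h]; simp))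
  rw [map_inv₀, mem_fil_of_ne (inv_ne_zero hfx), ord_inv hfx] at h2
  omega

/-- Valuations in a tower of extensions. -/
lemma ord_map_eq_mul (f : F →ₐ[K] L) {p x : F} (hp : p ≠ 0) (hp1 : ord K p = 1) (hx : x ≠ 0) :
    ord K (f x) = ord K x * ord K (f p) := by
  have hfp : f p ≠ 0 := by simpa using hp
  have hu : p ^ (-ord K x) * x ≠ 0 := mul_ne_zero (zpow_ne_zero _ hp) hx
  have h1 : ord K (f (p ^ (-ord K x) * x)) = 0 := by
    refine ord_map_eq_zero f hu ?_
    rw [ord_mul (zpow_ne_zero _ hp) hx, ord_zpow hp, hp1]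
    ring
  rw [map_mul, map_zpow₀, ord_mul (zpow_ne_zero _ hfp) (by simpa using hx), ord_zpow hfp] at h1
  linarith

/-- The maximal ideal of `F` is generated by `p`, so the admissible exponents are exactly those up
to `ord K (f p)`; the set is bounded and `sSup` is its true maximum. -/
lemma ramificationIndex_eq (f : F →ₐ[K] L) {p : F} (hp : p ≠ 0) (hp1 : ord K p = 1) :
    (ramificationIndex f : ℤ) = ord K (f p) := by
  have hpO : p ∈ integralClosure 𝒪[K] F := mem_integralClosure_iff_fil.mpr (Or.inr (by omega))
  have hfp : f p ≠ 0 := by simpa using hp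
  have hnn : 0 ≤ ord K (f p) :=
    (mem_fil_of_ne hfp).mp (map_mem_fil_zero f (x := p) (Or.inr (by omega)))
  have hset : {e : ℕ | (maxIdeal K F).map (f.restrictScalars 𝒪[K]).mapIntegralClosure
      ≤ maxIdeal K L ^ e} = Set.Iic (ord K (f p)).toNat := by
    ext e
    have h1 : maxIdeal K F = Ideal.span {(⟨p, hpO⟩ : integralClosure 𝒪[K] F)} := by
      simpa using maxIdeal_pow_eq hp hp1 hpO 1
    change (maxIdeal K F).map (f.restrictScalars 𝒪[K]).mapIntegralClosure
      ≤ maxIdeal K L ^ e ↔ e ≤ _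
    rw [h1, Ideal.map_span, Set.image_singleton, Ideal.span_singleton_le_iff_mem,
      mem_maxIdeal_pow]
    change f p ∈ fil K L e ↔ _
    rw [mem_fil_of_ne hfp]
    omega
  unfold ramificationIndex
  rw [hset, csSup_Iic]
  omega

lemma ramificationIndex_ofId {ϖ : 𝒪[K]} (hϖ : Irreducible ϖ) :
    ramificationIndex (Algebra.ofId K L) = ram L ϖ := by
  have h1 : ord K (ϖ : K) = 1 := by
    have h2 := ram_mul_resDeg (D := K) hϖ
    rw [Module.finrank_self] at h2
    have h3 := ord_algebraMap_eq_ram (D := K) hϖ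
    rw [Nat.eq_one_of_mul_eq_one_right h2] at h3
    exact h3
  have h0 : (ϖ : K) ≠ 0 := by simpa using hϖ.ne_zero
  have h2 := ramificationIndex_eq (Algebra.ofId K L) h0 h1
  have h3 := ord_algebraMap_eq_ram (D := L) hϖ
  have h4 : (Algebra.ofId K L) (ϖ : K) = algebraMap 𝒪[K] L ϖ := rfl
  rw [h4] at h2
  omega

/-- Multiplicativity in towers; it makes `e(L/K)` even as soon as `e(L/F) = 2`. -/
lemma ramificationIndex_dvd_ram (f : F →ₐ[K] L) {ϖ : 𝒪[K]} (hϖ : Irreducible ϖ) :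
    ramificationIndex f ∣ ram L ϖ := by
  obtain ⟨p, hp, hp1⟩ := exists_ord_eq_one K F
  have h0 := algebraMap_ne_zero_of_irreducible (D := F) hϖ
  have h1 := ord_map_eq_mul f hp hp1 h0
  rw [← ramificationIndex_eq f hp hp1] at h1
  have h2 : f (algebraMap 𝒪[K] F ϖ) = algebraMap 𝒪[K] L ϖ := f.commutes (ϖ : K)
  rw [h2, ord_algebraMap_eq_ram hϖ] at h1
  exact Int.natCast_dvd_natCast.mp ⟨_, by rw [h1, mul_comm]⟩

end RamificationIndex

/-! ### Lattices stable under the integers of a field: the case `f ∤ n`. -/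

section StableLattices

variable {K : Type*} [Field K] [ValuativeRel K] [TopologicalSpace K] [IsNonarchimedeanLocalField K]
  {B : Type*} [DivisionRing B] [Algebra K B] [FiniteDimensional K B]

lemma rsmul_algebraMap (v : Fin 2 → B) (a : K) : v <• algebraMap K B a = a • v := by
  ext i
  simp [Algebra.smul_def, Algebra.commutes]

/-- Nakayama's lemma for `𝒪_B`-lattices. -/
lemma IsLattice.le_of_forall_exists {Λ N : Submodule 𝒪[K] (Fin 2 → B)} (hΛ : IsLattice K Λ)
    (hN : ∀ v ∈ N, ∀ c ∈ fil K B 0, v <• c ∈ N) {π : B} (hπ : π ≠ 0) (hπ1 : ord K π = 1)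
    (h : ∀ v ∈ Λ, ∃ u ∈ N, ∃ w ∈ Λ, v = u + w <• π) : Λ ≤ N := by
  obtain ⟨ϖ, hϖ⟩ := IsDiscreteValuationRing.exists_irreducible 𝒪[K]
  have hπ0 : π ∈ fil K B 0 := Or.inr (by omega)
  have hiter : ∀ m : ℕ, ∀ v ∈ Λ, ∃ u ∈ N, ∃ w ∈ Λ, v = u + w <• π ^ m := by
    intro m
    induction m with
    | zero => intro v hv; exact ⟨0, zero_mem _, v, hv, by simp⟩
    | succ m ih =>
      intro v hv
      obtain ⟨u, hu, w, hw, rfl⟩ := ih v hv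
      obtain ⟨u', hu', w', hw', rfl⟩ := h w hw
      refine ⟨u + u' <• π ^ m, add_mem hu (hN _ hu' _ (by simpa using pow_mem_fil hπ0 m)),
        w', hw', ?_⟩
      rw [smul_add, op_smul_op_smul, ← pow_succ', add_assoc]
  -- After `e` iterations the error lies in `Λ π ^ e = ϖ Λ`, where Nakayama over `𝒪[K]` applies.
  refine Submodule.le_of_le_smul_of_le_jacobson_bot hΛ.1 maximalIdeal_le_jacobson fun v hv => ?_
  obtain ⟨u, hu, w, hw, rfl⟩ := hiter (ram B ϖ) v hv
  refine Submodule.add_mem_sup hu ?_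
  have h0 := algebraMap_ne_zero_of_irreducible (D := B) hϖ
  have h1 : w <• π ^ ram B ϖ = ϖ • (w <• ((algebraMap 𝒪[K] B ϖ)⁻¹ * π ^ ram B ϖ)) := by
    have h2 : ϖ • (w <• ((algebraMap 𝒪[K] B ϖ)⁻¹ * π ^ ram B ϖ))
        = w <• (ϖ • ((algebraMap 𝒪[K] B ϖ)⁻¹ * π ^ ram B ϖ)) := by
      rw [MulOpposite.op_smul, smul_assoc]
    rw [h2, Algebra.smul_def, mul_inv_cancel_left₀ h0]
  rw [h1]
  refine Submodule.smul_mem_smul ?_ (hΛ.op_smul_mem hw ?_)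
  · rw [hϖ.maximalIdeal_eq]
    exact Ideal.mem_span_singleton_self _
  · rw [mul_mem_fil_iff_left (inv_ne_zero h0), ord_inv h0, ord_algebraMap_eq_ram hϖ,
      mem_fil_of_ne (pow_ne_zero _ hπ), ord_pow hπ, hπ1]
    simp

lemma std_comm (x y : Fin 2 → B) (a b : ℤ) : std K x y a b = std K y x b a := by
  rw [std_eq_sup, std_eq_sup, sup_comm]

lemma IsRightBasis.symm {x y : Fin 2 → B} (h : IsRightBasis x y) : IsRightBasis y x where
  eq_zero α β hαβ := (h.eq_zero β α (by rw [add_comm]; exact hαβ)).symm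
  exists_eq v := by
    obtain ⟨α, β, rfl⟩ := h.exists_eq v
    exact ⟨β, α, add_comm _ _⟩

/-- A lattice strictly between `Λ π` and `Λ` has one-dimensional quotient. -/
lemma IsRightBasis.exists_generator_of_between {x y : Fin 2 → B}
    {M : Submodule 𝒪[K] (Fin 2 → B)} (hM : ∀ v ∈ M, ∀ c ∈ fil K B 0, v <• c ∈ M)
    (h1 : std K x y 1 1 ≤ M) (h2 : ∃ w ∈ M, w ∈ std K x y 0 0 ∧ w ∉ std K x y 1 1)
    (h3 : ¬ std K x y 0 0 ≤ M) :
    ∃ z ∈ std K x y 0 0, z ∉ M ∧ (∀ c ∈ fil K B 1, z <• c ∈ M) ∧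
      ∀ v ∈ std K x y 0 0, ∃ c ∈ fil K B 0, v - z <• c ∈ M := by
  obtain ⟨w, hwM, ⟨α, hα, β, hβ, rfl⟩, hw1⟩ := h2
  -- Some coordinate of `w` is a unit, the first by symmetry. Then `x` is congruent to a multiple of
  -- `y` modulo `M`, so `y` generates the quotient.
  wlog hα1 : α ∉ fil K B 1 generalizing x y α β
  · have hβ1 : β ∉ fil K B 1 := fun h => hw1 ⟨α, not_not.mp hα1, β, h, rfl⟩
    obtain ⟨z, hz⟩ := this (x := y) (y := x) (by rwa [std_comm]) (by rwa [std_comm]) β hβ α hα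
      (by rwa [add_comm]) (by rwa [add_comm, std_comm]) hβ1
    rw [std_comm y x] at hz
    exact ⟨z, hz⟩
  have hα0 : α ≠ 0 := by rintro rfl; exact hα1 (zero_mem _)
  have hoα : ord K α = 0 := ord_eq_of_mem_fil hα hα1
  have hαinv : α⁻¹ ∈ fil K B 0 := Or.inr (by rw [ord_inv hα0, hoα]; simp)
  have hx : x + y <• (β * α⁻¹) ∈ M := by
    have := hM _ hwM _ hαinv
    rw [smul_add, op_smul_op_smul, op_smul_op_smul, mul_inv_cancel₀ hα0] at this
    simpa using this
  have hdec : ∀ v ∈ std K x y 0 0, ∃ c ∈ fil K B 0, v - y <• c ∈ M := by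
    rintro _ ⟨γ, hγ, δ, hδ, rfl⟩
    refine ⟨δ - β * α⁻¹ * γ, sub_mem hδ
      (mul_mem_fil_left (mul_mem_fil_left hβ hαinv) hγ), ?_⟩
    have := hM _ hx _ hγ
    rw [smul_add, op_smul_op_smul] at this
    convert this using 1
    rw [MulOpposite.op_sub, sub_smul]
    abel
  refine ⟨y, ?_, ?_, fun c hc => h1 (op_smul_right_mem_std hc), hdec⟩
  · simpa using op_smul_right_mem_std (x := x) (y := y) (a := 0) (b := 0) (one_mem_fil (K := K))
  · intro hy
    apply h3
    intro v hv
    obtain ⟨c, hc, hvc⟩ := hdec v hv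
    have := add_mem hvc (hM _ hy c hc)
    rwa [sub_add_cancel] at this

variable {E : Type*} [Field E] [Algebra K E] [FiniteDimensional K E]
  (φ : E →ₐ[K] Matrix (Fin 2) (Fin 2) B)

lemma map_mulVec_ne_zero {t : E} (ht : t ≠ 0) {v : Fin 2 → B} (hv : v ≠ 0) : φ t *ᵥ v ≠ 0 := by
  intro h
  apply hv
  have h1 : φ t⁻¹ *ᵥ (φ t *ᵥ v) = φ t⁻¹ *ᵥ 0 := by rw [h]
  rwa [Matrix.mulVec_mulVec, ← map_mul, inv_mul_cancel₀ ht, map_one, Matrix.one_mulVec,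
    Matrix.mulVec_zero] at h1

/-- A submodule of `B²` stable under the integers of `E` and of `B`. -/
structure IsStable (Λ : Submodule 𝒪[K] (Fin 2 → B)) : Prop where
  left : ∀ t ∈ fil K E 0, ∀ v ∈ Λ, φ t *ᵥ v ∈ Λ
  right : ∀ v ∈ Λ, ∀ c ∈ fil K B 0, v <• c ∈ Λ

variable {φ} in
/-- If the residue degree of `E` does not divide `n`, two stable lattices, neither of which can be
shrunk inside the other, coincide. -/
lemma eq_of_stable_of_not_dvd {n s : ℕ} {ζ π : B} (hB : CentralData K n s ζ π)
    (hf : ¬ resDeg K E ∣ n) {x y : Fin 2 → B} (hxy : IsRightBasis x y)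
    {Λ : Submodule 𝒪[K] (Fin 2 → B)} (hΛ : IsStable φ Λ) (hstd : IsStable φ (std K x y 0 0))
    (hle : Λ ≤ std K x y 0 0) (hnle : ¬ Λ ≤ std K x y 1 1) : Λ = std K x y 0 0 := by
  have hone : ∀ v, v ∈ std K x y 1 1 ↔ v <• π⁻¹ ∈ std K x y 0 0 := by
    intro v
    rw [op_smul_mem_std_iff (inv_ne_zero hB.ne_zero), ord_inv hB.ne_zero, hB.ord_eq]
    simp
  by_contra hne
  -- Write `X` for `std K x y 0 0`. If the claim fails, `M = Λ + X π` lies strictly between `X π`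
  -- and `X`: the upper inclusion is strict by Nakayama.
  set M := Λ ⊔ std K x y 1 1 with hMdef
  have hstd1 : IsStable φ (std K x y 1 1) := by
    refine ⟨fun t ht v hv => ?_, fun v hv c hc => ?_⟩
    · rw [hone] at hv ⊢
      rw [← mulVec_op_smul]
      exact hstd.left t ht _ hv
    · simpa using op_smul_mem_std hv hc
  have hM : IsStable φ M := by
    refine ⟨fun t ht v hv => ?_, fun v hv c hc => ?_⟩
    · obtain ⟨a, ha, b, hb, rfl⟩ := Submodule.mem_sup.mp hv
      rw [Matrix.mulVec_add]
      exact Submodule.add_mem_sup (hΛ.left t ht a ha) (hstd1.left t ht b hb)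
    · obtain ⟨a, ha, b, hb, rfl⟩ := Submodule.mem_sup.mp hv
      rw [smul_add]
      exact Submodule.add_mem_sup (hΛ.right a ha c hc) (hstd1.right b hb c hc)
  have h3 : ¬ std K x y 0 0 ≤ M := by
    intro h
    refine hne (le_antisymm hle ?_)
    refine (hxy.isLattice_std 0 0).le_of_forall_exists hΛ.right hB.ne_zero hB.ord_eq fun v hv => ?_
    obtain ⟨a, ha, b, hb, rfl⟩ := Submodule.mem_sup.mp (h hv)
    refine ⟨a, ha, _, (hone b).mp hb, ?_⟩
    rw [op_smul_op_smul, inv_mul_cancel₀ hB.ne_zero]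
    simp
  obtain ⟨w, hwΛ, hw1⟩ := SetLike.not_le_iff_exists.mp hnle
  obtain ⟨z, hz, hzM, hz1, hdec⟩ := IsRightBasis.exists_generator_of_between hM.right le_sup_right
    ⟨w, Submodule.mem_sup_left hwΛ, hle hwΛ, hw1⟩ h3
  obtain ⟨η, hη⟩ := exists_isTeichmuller K E
  have hη0 : η ∈ fil K E 0 := hη.mem_fil
  -- `X / M` is a line over the residue field of `B`, generated by `z`. So `η` acts on `z` by a
  -- right scalar, a unit because `η` is invertible, hence congruent to a power of `ζ`.
  obtain ⟨c, hc, hzc⟩ := hdec _ (hstd.left η hη0 z hz)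
  have hc1 : c ∉ fil K B 1 := by
    intro h
    have h4 : φ η *ᵥ z ∈ M := by
      have := add_mem hzc (hz1 c h)
      rwa [sub_add_cancel] at this
    have h5 := hM.left η⁻¹ (Or.inr (by rw [ord_inv hη.ne_zero, hη.ord_eq_zero]; simp)) _ h4
    rw [Matrix.mulVec_mulVec, ← map_mul, inv_mul_cancel₀ hη.ne_zero, map_one,
      Matrix.one_mulVec] at h5
    exact hzM h5
  obtain ⟨j, hj⟩ := (hB.teich.exists_sub_mem c (mem_integers_iff_fil.mpr hc)).resolve_left hc1
  have hzj : φ η *ᵥ z - z <• ζ ^ j ∈ M := by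
    have := add_mem hzc (hz1 _ hj)
    rw [MulOpposite.op_sub, sub_smul] at this
    convert this using 1
    abel
  have hpow : ∀ k : ℕ, φ (η ^ k) *ᵥ z - z <• (ζ ^ j) ^ k ∈ M := by
    intro k
    induction k with
    | zero => simp
    | succ k ih =>
      have h4 := hM.left _ hη0 _ ih
      have h5 := hM.right _ hzj _ (by simpa using pow_mem_fil (hB.teich.pow_mem_fil j) k)
      have := add_mem h4 h5
      rw [Matrix.mulVec_sub, mulVec_op_smul, Matrix.mulVec_mulVec, ← map_mul, ← pow_succ',
        smul_sub, op_smul_op_smul, ← pow_succ', sub_add_sub_cancel] at this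
      exact this
  -- `η ^ k` fixes `z` modulo `M`. If `η ^ k ≠ 1`, then `η ^ k - 1` is a unit of `𝒪_E` and `z` would
  -- lie in `M`; so the order of `η` divides that of `ζ`, which yields `f ∣ n`.
  set k := resCard K B - 1 with hk
  have h6 : φ (η ^ k - 1) *ᵥ z ∈ M := by
    have := hpow k
    rw [← pow_mul, mul_comm, pow_mul, hB.teich.pow_eq_one, one_pow] at this
    rw [map_sub, map_one, Matrix.sub_mulVec, Matrix.one_mulVec]
    simpa using this
  have h7 : η ^ k = 1 := by
    by_contra hne1
    have hne' : η ^ k - 1 ≠ 0 := sub_ne_zero.mpr hne1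
    have hord : ord K (η ^ k - 1) = 0 := by
      refine ord_eq_of_mem_fil (sub_mem (hη.pow_mem_fil k) one_mem_fil) fun h => hne1 ?_
      exact hη.pow_eq_one_iff.mpr (hη.dvd_of_pow_sub_one_mem k h)
    have h8 := hM.left (η ^ k - 1)⁻¹ (Or.inr (by rw [ord_inv hne', hord]; simp)) _ h6
    rw [Matrix.mulVec_mulVec, ← map_mul, inv_mul_cancel₀ hne', map_one, Matrix.one_mulVec] at h8
    exact hzM h8
  have h8 := hη.dvd_of_pow_eq_one h7
  rw [hk, resCard_eq, resCard_eq, pow_sub_one_dvd_iff Finite.one_lt_card, hB.resDeg_eq] at h8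
  exact hf h8

end StableLattices

/-! ### Uniqueness of the maximal order. -/

section UniqueMaximalOrder

variable {K : Type*} [Field K] [ValuativeRel K] [TopologicalSpace K] [IsNonarchimedeanLocalField K]
  {B : Type*} [DivisionRing B] [Algebra K B] [FiniteDimensional K B]

lemma std_anti (x y : Fin 2 → B) {a b a' b' : ℤ} (ha : a' ≤ a) (hb : b' ≤ b) :
    std K x y a b ≤ std K x y a' b' := by
  rintro _ ⟨α, hα, β, hβ, rfl⟩
  exact ⟨α, fil_mono ha hα, β, fil_mono hb hβ, rfl⟩

lemma IsRightBasis.exists_le_std {x y : Fin 2 → B} (h : IsRightBasis x y)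
    {Λ : Submodule 𝒪[K] (Fin 2 → B)} (hΛ : Λ.FG) : ∃ k : ℤ, Λ ≤ std K x y k k := by
  obtain ⟨S, rfl⟩ := hΛ
  have h1 : ∀ v : Fin 2 → B, ∃ m : ℤ, v ∈ std K x y m m := by
    intro v
    obtain ⟨α, β, rfl⟩ := h.exists_eq v
    exact ⟨min (ord K α) (ord K β), α, Or.inr (min_le_left _ _), β, Or.inr (min_le_right _ _), rfl⟩
  choose m hm using h1
  obtain ⟨k, hk⟩ := (S.image m).bddBelow
  refine ⟨k, Submodule.span_le.mpr fun z hz => ?_⟩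
  have hkz : k ≤ m z := hk (Finset.mem_coe.mpr (Finset.mem_image_of_mem _ hz))
  exact std_anti x y hkz hkz (hm z)

lemma IsLattice.exists_ne_zero {Λ : Submodule 𝒪[K] (Fin 2 → B)} (hΛ : IsLattice K Λ) :
    ∃ v ∈ Λ, v ≠ 0 := by
  obtain ⟨x, y, hxy, rfl⟩ := hΛ.exists_basis
  refine ⟨x, ?_, hxy.left_ne_zero⟩
  simpa using op_smul_left_mem_std (x := x) (y := y) (a := 0) (b := 0) (one_mem_fil (K := K))

/-- The smallest homothetic copy of a lattice containing another lattice. -/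
lemma IsRightBasis.exists_greatest_std {x y : Fin 2 → B} (h : IsRightBasis x y)
    {Λ : Submodule 𝒪[K] (Fin 2 → B)} (hΛ : IsLattice K Λ) :
    ∃ k : ℤ, Λ ≤ std K x y k k ∧ ¬ Λ ≤ std K x y (k + 1) (k + 1) := by
  obtain ⟨v, hv, hv0⟩ := hΛ.exists_ne_zero
  obtain ⟨α, β, rfl⟩ := h.exists_eq v
  obtain ⟨k, hk, hmax⟩ := Int.exists_greatest_of_bdd (P := fun k => Λ ≤ std K x y k k)
    ⟨max (ord K α) (ord K β), fun k hk => by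
      obtain ⟨h1, h2⟩ := h.mem_std_iff.mp (hk hv)
      by_cases hα : α = 0
      · have hβ : β ≠ 0 := by
          rintro rfl
          simp [hα] at hv0
        exact le_max_of_le_right ((mem_fil_of_ne hβ).mp h2)
      · exact le_max_of_le_left ((mem_fil_of_ne hα).mp h1)⟩ (h.exists_le_std hΛ.1)
  exact ⟨k, hk, fun hk' => by have := hmax _ hk'; omega⟩

lemma endAlg_std_shift (x y : Fin 2 → B) (k : ℤ) :
    endAlg (std K x y k k) = endAlg (std K x y 0 0) := by
  obtain ⟨p, hp, hp1⟩ := exists_ord_eq_one K B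
  refine endAlg_eq_of_homothety (c := p ^ (-k)) (zpow_ne_zero _ hp) fun v => ?_
  rw [op_smul_mem_std_iff (zpow_ne_zero _ hp), ord_zpow hp, hp1]
  simp

variable {E : Type*} [Field E] [Algebra K E] [FiniteDimensional K E]
  {φ : E →ₐ[K] Matrix (Fin 2) (Fin 2) B} {H : Subalgebra 𝒪[K] (Matrix (Fin 2) (Fin 2) B)}

lemma IsLattice.isStable_iff (hH : ∀ M, M ∈ H ↔ ∃ t ∈ fil K E 0, φ t = M)
    {Λ : Submodule 𝒪[K] (Fin 2 → B)} (hΛ : IsLattice K Λ) : H ≤ endAlg Λ ↔ IsStable φ Λ := by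
  constructor
  · intro h
    exact ⟨fun t ht v hv => mem_endAlg.mp (h ((hH _).mpr ⟨t, ht, rfl⟩)) v hv,
      fun v hv c hc => hΛ.op_smul_mem hv hc⟩
  · intro h M hM
    obtain ⟨t, ht, rfl⟩ := (hH M).mp hM
    exact mem_endAlg.mpr (h.left t ht)

lemma fg_of_mem_iff (hH : ∀ M, M ∈ H ↔ ∃ t ∈ fil K E 0, φ t = M) :
    (Subalgebra.toSubmodule H).FG := by
  have : Subalgebra.toSubmodule H = (Subalgebra.toSubmodule (integers K E)).map
      (φ.toLinearMap.restrictScalars 𝒪[K]) := by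
    ext M
    rw [Subalgebra.mem_toSubmodule, hH, ← fil_zero, Submodule.mem_map]
    rfl
  rw [this]
  exact fg_integers.map _

/-- If the residue degree of `E` does not divide the degree of `B`, the ring of integers of `E`
lies in exactly one maximal order. -/
theorem existsUnique_isMaximalOrder (hH : ∀ M, M ∈ H ↔ ∃ t ∈ fil K E 0, φ t = M)
    {n s : ℕ} {ζ π : B} (hB : CentralData K n s ζ π) (hf : ¬ resDeg K E ∣ n) :
    ∃! D : Subalgebra 𝒪[K] (Matrix (Fin 2) (Fin 2) B), IsMaximalOrder K D ∧ H ≤ D := by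
  obtain ⟨Λ, hΛ, hle⟩ := exists_isLattice_le_endAlg (fg_of_mem_iff hH)
  refine ⟨endAlg Λ, ⟨isMaximalOrder_endAlg hΛ, hle⟩, ?_⟩
  rintro D ⟨hD, hHD⟩
  obtain ⟨Λ', hΛ', rfl⟩ := isMaximalOrder_iff.mp hD
  obtain ⟨x, y, hxy, rfl⟩ := hΛ.exists_basis
  -- Replacing `Λ` by its smallest multiple containing `Λ'`, in a new basis, reaches the hypotheses
  -- of `eq_of_stable_of_not_dvd`.
  obtain ⟨k, hk, hk1⟩ := hxy.exists_greatest_std hΛ'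
  obtain ⟨x', y', hxy', he⟩ := (hxy.isLattice_std k k (K := K)).exists_basis
  have he1 : std K x y (k + 1) (k + 1) = std K x' y' 1 1 := by
    ext v
    have h1 := op_smul_mem_std_iff (K := K) (x := x) (y := y) (v := v) (a := k) (b := k)
      (inv_ne_zero hB.ne_zero)
    have h2 := op_smul_mem_std_iff (K := K) (x := x') (y := y') (v := v) (a := 0) (b := 0)
      (inv_ne_zero hB.ne_zero)
    rw [ord_inv hB.ne_zero, hB.ord_eq] at h1 h2
    rw [he] at h1
    simpa using h1.symm.trans h2
  have hst : H ≤ endAlg (std K x' y' 0 0) := by rw [← he, endAlg_std_shift]; exact hle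
  have := eq_of_stable_of_not_dvd hB hf hxy' ((hΛ'.isStable_iff hH).mp hHD)
    (((hxy'.isLattice_std 0 0).isStable_iff hH).mp hst) (by rwa [← he]) (by rwa [← he1])
  rw [this, ← he, endAlg_std_shift]

end UniqueMaximalOrder

/-! ### Eigenvectors of roots of unity. -/

section Eigenspaces

variable {K : Type*} [Field K] [ValuativeRel K] [TopologicalSpace K] [IsNonarchimedeanLocalField K]
  {B : Type*} [DivisionRing B] [Algebra K B] [FiniteDimensional K B]
  {E : Type*} [Field E] [Algebra K E] [FiniteDimensional K E]

variable (K E) in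
lemma resDeg_pos : 0 < resDeg K E := by
  have h := one_lt_resCard K E
  rw [resCard_eq] at h
  by_contra h0
  simp [Nat.eq_zero_of_not_pos h0] at h

variable (K E) in
-- The residue cardinality lies in the maximal ideal. Hence averaging over Teichmüller
-- representatives can be normalized inside lattices.
lemma isUnit_resCard_sub_one : IsUnit ((resCard K E - 1 : ℕ) : 𝒪[K]) := by
  have hq : (Nat.card 𝓀[K] : 𝒪[K]) ∈ 𝓂[K] := by
    rw [← IsLocalRing.residue_eq_zero_iff, map_natCast]
    have := Fintype.ofFinite 𝓀[K]
    rw [Nat.card_eq_fintype_card]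
    exact Nat.cast_card_eq_zero 𝓀[K]
  have hQ : (resCard K E : 𝒪[K]) ∈ 𝓂[K] := by
    rw [resCard_eq, Nat.cast_pow]
    exact Ideal.pow_mem_of_mem _ hq _ (resDeg_pos K E)
  rw [Nat.cast_sub (one_lt_resCard K E).le, Nat.cast_one, ← IsUnit.neg_iff, neg_sub]
  exact IsLocalRing.isUnit_one_sub_self_of_mem_nonunits _ hQ

lemma resCard_sub_one_ne_zero : ((resCard K E - 1 : ℕ) : K) ≠ 0 := by
  have := ((isUnit_resCard_sub_one K E).map (algebraMap 𝒪[K] K)).ne_zero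
  rwa [map_natCast] at this

variable (φ : E →ₐ[K] Matrix (Fin 2) (Fin 2) B)

lemma map_pow_mulVec {η : E} {θ : B} {v : Fin 2 → B} (h : φ η *ᵥ v = v <• θ) (k : ℕ) :
    φ (η ^ k) *ᵥ v = v <• θ ^ k := by
  induction k with
  | zero => simp
  | succ k ih =>
    rw [pow_succ', map_mul, ← Matrix.mulVec_mulVec, ih, mulVec_op_smul, h, op_smul_op_smul,
      ← pow_succ']

/-- The unnormalized projection onto the `θ`-eigenspace of an element `η` with `η ^ N = 1`. -/
noncomputable def eigenProj (η : E) (N : ℕ) (θ : B) : (Fin 2 → B) →ₗ[K] (Fin 2 → B) where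
  toFun v := ∑ k ∈ Finset.range N, (φ (η ^ k) *ᵥ v) <• (θ⁻¹) ^ k
  map_add' v w := by simp only [Matrix.mulVec_add, smul_add, Finset.sum_add_distrib]
  map_smul' c v := by
    simp only [Matrix.mulVec_smul, Finset.smul_sum, RingHom.id_apply, smul_comm c]

lemma eigenProj_apply (η : E) (N : ℕ) (θ : B) (v : Fin 2 → B) :
    eigenProj φ η N θ v = ∑ k ∈ Finset.range N, (φ (η ^ k) *ᵥ v) <• (θ⁻¹) ^ k := rfl

lemma map_mulVec_eigenProj {η : E} {N : ℕ} (hη : η ^ N = 1) {θ : B} (hθ0 : θ ≠ 0)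
    (hθ : θ ^ N = 1) (v : Fin 2 → B) :
    φ η *ᵥ eigenProj φ η N θ v = eigenProj φ η N θ v <• θ := by
  set F : ℕ → (Fin 2 → B) := fun k => (φ (η ^ k) *ᵥ v) <• (θ⁻¹) ^ k with hF
  have h1 : ∀ k, φ η *ᵥ F k = F (k + 1) <• θ := by
    intro k
    simp only [hF]
    rw [mulVec_op_smul, Matrix.mulVec_mulVec, ← map_mul, ← pow_succ', op_smul_op_smul,
      pow_succ θ⁻¹ k, mul_assoc, inv_mul_cancel₀ hθ0, mul_one]
  have h2 : ∑ k ∈ Finset.range N, F (k + 1) = ∑ k ∈ Finset.range N, F k := by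
    have h3 := Finset.sum_range_succ F N
    rw [Finset.sum_range_succ'] at h3
    have h4 : F N = F 0 := by simp only [hF, hη, inv_pow, hθ, pow_zero, inv_one]
    rw [h4] at h3
    exact add_right_cancel h3
  rw [eigenProj_apply]
  change φ η *ᵥ (∑ k ∈ Finset.range N, F k) = (∑ k ∈ Finset.range N, F k) <• θ
  rw [Matrix.mulVec_sum, Finset.sum_congr rfl fun k _ => h1 k, ← Finset.smul_sum, h2]

lemma eigenProj_of_eigen {η : E} (N : ℕ) {θ θ' : B} (hc : Commute θ' θ) {v : Fin 2 → B}
    (hv : φ η *ᵥ v = v <• θ') :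
    eigenProj φ η N θ v = v <• ∑ k ∈ Finset.range N, (θ' * θ⁻¹) ^ k := by
  rw [eigenProj_apply, Finset.op_sum, Finset.sum_smul]
  refine Finset.sum_congr rfl fun k _ => ?_
  rw [map_pow_mulVec φ hv, op_smul_op_smul, (hc.inv_right₀).mul_pow]

lemma eigenProj_self {η : E} (N : ℕ) {θ : B} (hθ : θ ≠ 0) {v : Fin 2 → B}
    (hv : φ η *ᵥ v = v <• θ) : eigenProj φ η N θ v = (N : K) • v := by
  rw [eigenProj_of_eigen φ N (Commute.refl _) hv, mul_inv_cancel₀ hθ, ← rsmul_algebraMap]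
  simp

/-- The resulting scalar is the geometric sum of `θ' θ⁻¹`, a nontrivial root of unity of order
dividing `N`. -/
lemma eigenProj_of_ne {η : E} {N : ℕ} {θ θ' : B} (hθ : θ ≠ 0) (hne : θ' ≠ θ)
    (h1 : θ ^ N = 1) (h2 : θ' ^ N = 1) (hc : Commute θ' θ) {v : Fin 2 → B}
    (hv : φ η *ᵥ v = v <• θ') : eigenProj φ η N θ v = 0 := by
  have h3 : θ' * θ⁻¹ ≠ 1 := fun h => hne (by rw [← mul_inv_eq_one₀ hθ]; exact h)
  rw [eigenProj_of_eigen φ N hc hv, geom_sum_eq h3, (hc.inv_right₀).mul_pow, h2, inv_pow, h1]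
  simp

/-- An element of finite order of `E` whose order divides the order of a root of unity in `B`
has an eigenvector. -/
lemma exists_eigenvector {η : E} {N : ℕ} (hN : (N : K) ≠ 0) (hη : η ^ N = 1) {Z : B}
    (hZ : ∀ r : ℕ, Z ^ r = 1 ↔ N ∣ r) :
    ∃ (j : ℕ) (v : Fin 2 → B), v ≠ 0 ∧ φ η *ᵥ v = v <• Z ^ j := by
  by_contra hcon
  push Not at hcon
  have hN0 : N ≠ 0 := by rintro rfl; simp at hN
  have hZN : Z ^ N = 1 := (hZ N).mpr dvd_rfl
  have hZ0 : Z ≠ 0 := by rintro rfl; rw [zero_pow hN0] at hZN; exact zero_ne_one hZN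
  have hzero : ∀ (j : ℕ) (v : Fin 2 → B), eigenProj φ η N (Z ^ j) v = 0 := by
    intro j v
    by_contra hne
    exact hcon j _ hne (map_mulVec_eigenProj φ hη (pow_ne_zero _ hZ0)
      (by rw [← pow_mul, mul_comm, pow_mul, hZN, one_pow]) v)
  -- Orthogonality of characters: summing over all eigenvalues kills every term except `k = 0`, so
  -- the projections cannot all vanish.
  have hsum : ∀ v : Fin 2 → B, ∑ j ∈ Finset.range N, eigenProj φ η N (Z ^ j) v = (N : K) • v := by
    intro v
    simp only [eigenProj_apply]
    rw [Finset.sum_comm, Finset.sum_eq_single_of_mem 0 (Finset.mem_range.mpr (by omega))]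
    · simp [Nat.cast_smul_eq_nsmul]
    · intro k hk hk0
      rw [← Finset.sum_smul, ← Finset.op_sum]
      have h1 : ∀ j : ℕ, ((Z ^ j)⁻¹) ^ k = ((Z ^ k)⁻¹) ^ j := by
        intro j
        rw [inv_pow, inv_pow, ← pow_mul, ← pow_mul, mul_comm]
      have h2 : (Z ^ k)⁻¹ ≠ 1 := by
        rw [ne_eq, inv_eq_one, hZ]
        intro h
        exact absurd (Nat.le_of_dvd (Nat.pos_of_ne_zero hk0) h)
          (not_le.mpr (Finset.mem_range.mp hk))
      rw [Finset.sum_congr rfl fun j _ => h1 j, geom_sum_eq h2, inv_pow, ← pow_mul, mul_comm k N,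
        pow_mul, hZN]
      simp
  obtain ⟨v, hv⟩ := exists_ne (0 : Fin 2 → B)
  have := hsum v
  simp only [hzero, Finset.sum_const_zero] at this
  exact smul_ne_zero hN hv this.symm

end Eigenspaces

/-! ### The eigenspace decomposition when `f ∣ n`. -/

section EigenData

variable {K : Type*} [Field K] [ValuativeRel K] [TopologicalSpace K] [IsNonarchimedeanLocalField K]
  {B : Type*} [DivisionRing B] [Algebra K B] [FiniteDimensional K B]
  {E : Type*} [Field E] [Algebra K E] [FiniteDimensional K E]
  (φ : E →ₐ[K] Matrix (Fin 2) (Fin 2) B)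

/-- The vectors on which `η` acts as right multiplication by `θ`. -/
def eigenSpace (η : E) (θ : B) : Submodule K (Fin 2 → B) where
  carrier := {v | φ η *ᵥ v = v <• θ}
  zero_mem' := by
    change φ η *ᵥ 0 = (0 : Fin 2 → B) <• θ
    rw [Matrix.mulVec_zero, smul_zero]
  add_mem' {v w} hv hw := by
    change φ η *ᵥ (v + w) = (v + w) <• θ
    change φ η *ᵥ v = v <• θ at hv
    change φ η *ᵥ w = w <• θ at hw
    rw [Matrix.mulVec_add, smul_add, hv, hw]
  smul_mem' c v hv := by
    change φ η *ᵥ (c • v) = (c • v) <• θ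
    change φ η *ᵥ v = v <• θ at hv
    rw [Matrix.mulVec_smul, hv, smul_comm]

variable {φ}

lemma mem_eigenSpace {η : E} {θ : B} {v : Fin 2 → B} :
    v ∈ eigenSpace φ η θ ↔ φ η *ᵥ v = v <• θ := Iff.rfl

variable (K) in
/-- The conjugate of a power `θ` of `ζ` by the `i`-th power of a normalizing uniformizer. -/
noncomputable def conjRoot (s : ℕ) (θ : B) (i : ℕ) : B := θ ^ (Nat.card 𝓀[K] ^ s) ^ i

lemma conjRoot_zero (s : ℕ) (θ : B) : conjRoot K s θ 0 = θ := by simp [conjRoot]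

variable (φ) in
/-- A Teichmüller generator `η` of `E` with a nontrivial eigenspace, for an eigenvalue `θ` that is
a power of `ζ`. -/
structure EigenData (n s : ℕ) (ζ π : B) (η : E) (θ : B) : Prop where
  central : CentralData K n s ζ π
  teich : IsTeichmuller K η
  dvd : resDeg K E ∣ n
  mem_powers : ∃ j : ℕ, θ = ζ ^ j
  exists_mem : ∃ v ∈ eigenSpace φ η θ, v ≠ 0

/-- As `f ∣ n`, the order of `η` divides that of `ζ`, so a power of `ζ` has exactly the order of `η`
and `exists_eigenvector` applies. -/
lemma exists_eigenData {n s : ℕ} {ζ π : B} (hB : CentralData K n s ζ π)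
    (hf : resDeg K E ∣ n) : ∃ η θ, EigenData φ n s ζ π η θ := by
  obtain ⟨η, hη⟩ := exists_isTeichmuller K E
  have hdvd : resCard K E - 1 ∣ resCard K B - 1 := by
    rw [resCard_eq, resCard_eq, pow_sub_one_dvd_iff Finite.one_lt_card, hB.resDeg_eq]
    exact hf
  obtain ⟨M, hM⟩ := hdvd
  have hM0 : 0 < M := by
    have := one_lt_resCard K B
    by_contra h0
    rw [Nat.eq_zero_of_not_pos h0] at hM
    omega
  obtain ⟨j, v, hv, hvj⟩ := exists_eigenvector φ (resCard_sub_one_ne_zero (K := K) (E := E))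
    hη.pow_eq_one (Z := ζ ^ M) (fun r => by
      rw [← pow_mul, hB.teich.pow_eq_one_iff, hM, mul_comm _ M, Nat.mul_dvd_mul_iff_left hM0])
  exact ⟨η, (ζ ^ M) ^ j, hB, hη, hf, ⟨M * j, by rw [pow_mul]⟩, v, hvj, hv⟩

namespace EigenData

variable {n s : ℕ} {ζ π : B} {η : E} {θ : B} (h : EigenData φ n s ζ π η θ)
include h

/-- `η ^ r` and `θ ^ r` act alike on an eigenvector, and nonzero elements of `E` or `B` kill no
nonzero vector; so `θ` has the order of `η`. -/
lemma pow_eq_one_iff (r : ℕ) : θ ^ r = 1 ↔ resCard K E - 1 ∣ r := by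
  obtain ⟨v, hv, hv0⟩ := h.exists_mem
  have h1 := map_pow_mulVec φ (mem_eigenSpace.mp hv) r
  rw [← h.teich.pow_eq_one_iff]
  constructor
  · intro hr
    by_contra hne
    refine map_mulVec_ne_zero φ (sub_ne_zero.mpr hne) hv0 ?_
    rw [map_sub, map_one, Matrix.sub_mulVec, Matrix.one_mulVec, h1, hr]
    simp
  · intro hr
    rw [hr, map_one, Matrix.one_mulVec] at h1
    by_contra hne
    refine op_smul_ne_zero hv0 (sub_ne_zero.mpr hne) ?_
    rw [MulOpposite.op_sub, sub_smul, ← h1]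
    simp

lemma ne_zero : θ ≠ 0 := by
  obtain ⟨j, rfl⟩ := h.mem_powers
  exact pow_ne_zero _ h.central.teich.ne_zero

lemma commute : Commute θ ζ := by
  obtain ⟨j, rfl⟩ := h.mem_powers
  exact Commute.pow_self ζ j

lemma conjRoot_ne_zero (i : ℕ) : conjRoot K s θ i ≠ 0 := pow_ne_zero _ h.ne_zero

lemma conjRoot_pow_eq_one (i : ℕ) : conjRoot K s θ i ^ (resCard K E - 1) = 1 := by
  rw [conjRoot, ← pow_mul, mul_comm, pow_mul, (h.pow_eq_one_iff _).mpr dvd_rfl, one_pow]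

lemma mul_pow_eq (i : ℕ) : θ * π ^ i = π ^ i * conjRoot K s θ i := by
  obtain ⟨j, rfl⟩ := h.mem_powers
  rw [pow_mul_pow_of_normalizing h.central.normalizes, conjRoot, pow_mul]

lemma commute_conjRoot (i k : ℕ) : Commute (conjRoot K s θ i) (conjRoot K s θ k) :=
  ((Commute.refl θ).pow_left _).pow_right _

/-- `θ` generates a copy of the residual units of `E`, so `f` must divide `s i`; and `s` is prime to
`n`, hence to `f`. -/
lemma conjRoot_eq_self_iff (i : ℕ) : conjRoot K s θ i = θ ↔ resDeg K E ∣ i := by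
  have h1 : conjRoot K s θ i = θ ↔ θ ^ (Nat.card 𝓀[K] ^ (s * i) - 1) = 1 := by
    have hpos : 0 < Nat.card 𝓀[K] ^ (s * i) := pow_pos Nat.card_pos _
    rw [conjRoot, ← pow_mul]
    conv_lhs => rw [← Nat.sub_add_cancel hpos, pow_succ]
    exact mul_eq_right₀ h.ne_zero
  rw [h1, h.pow_eq_one_iff, resCard_eq, pow_sub_one_dvd_iff Finite.one_lt_card]
  exact Nat.Coprime.dvd_mul_left (h.central.coprime.symm.coprime_dvd_left h.dvd)

lemma conjRoot_injOn {i k : ℕ} (hik : i ≤ k) (hk : k < resDeg K E)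
    (he : conjRoot K s θ i = conjRoot K s θ k) : i = k := by
  obtain ⟨d, rfl⟩ := Nat.exists_eq_add_of_le hik
  have hπ := h.central.ne_zero
  have h1 : conjRoot K s θ d = θ := by
    have h2 := h.mul_pow_eq (i + d)
    have h3 : θ * π ^ (i + d) = π ^ d * conjRoot K s θ d * π ^ i := by
      rw [add_comm, pow_add, ← mul_assoc, h.mul_pow_eq d]
    have h4 : π ^ (i + d) * conjRoot K s θ i = π ^ d * θ * π ^ i := by
      rw [add_comm, pow_add, mul_assoc, ← h.mul_pow_eq i, mul_assoc]
    rw [← he, h4, h3] at h2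
    exact mul_left_cancel₀ (pow_ne_zero d hπ) (mul_right_cancel₀ (pow_ne_zero i hπ) h2)
  have h5 := Nat.eq_zero_of_dvd_of_lt ((h.conjRoot_eq_self_iff d).mp h1) (by omega)
  omega

lemma op_smul_pow_mem {u : Fin 2 → B} (hu : u ∈ eigenSpace φ η θ) (i : ℕ) :
    u <• π ^ i ∈ eigenSpace φ η (conjRoot K s θ i) := by
  rw [mem_eigenSpace] at hu ⊢
  rw [mulVec_op_smul, hu, op_smul_op_smul, op_smul_op_smul, h.mul_pow_eq]

lemma op_smul_inv_pow_mem {i : ℕ} {w : Fin 2 → B}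
    (hw : w ∈ eigenSpace φ η (conjRoot K s θ i)) : w <• (π ^ i)⁻¹ ∈ eigenSpace φ η θ := by
  have h0 := pow_ne_zero i h.central.ne_zero
  rw [mem_eigenSpace] at hw ⊢
  rw [mulVec_op_smul, hw, op_smul_op_smul, op_smul_op_smul]
  congr 2
  rw [eq_inv_mul_iff_mul_eq₀ h0, ← mul_assoc, ← h.mul_pow_eq, mul_inv_cancel_right₀ h0]

lemma eigenProj_conjRoot_of_ne {i k : ℕ} (hi : i < resDeg K E) (hk : k < resDeg K E)
    (hne : i ≠ k) {v : Fin 2 → B} (hv : v ∈ eigenSpace φ η (conjRoot K s θ i)) :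
    eigenProj φ η (resCard K E - 1) (conjRoot K s θ k) v = 0 := by
  refine eigenProj_of_ne φ (h.conjRoot_ne_zero k) (fun he => hne ?_) (h.conjRoot_pow_eq_one k)
    (h.conjRoot_pow_eq_one i) (h.commute_conjRoot i k) (mem_eigenSpace.mp hv)
  rcases le_total i k with hik | hik
  · exact h.conjRoot_injOn hik hk he
  · exact (h.conjRoot_injOn hik hi he.symm).symm

/-- The sum of the conjugates of a power of the eigenvalue is central. -/
lemma exists_sum_conjRoot [Algebra.IsCentral K B] (k : ℕ) :
    ∃ a : K, algebraMap K B a = ∑ i ∈ Finset.range (resDeg K E), (conjRoot K s θ i)⁻¹ ^ k := by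
  refine mem_range_of_commute_generators h.central.teich h.central.ne_zero h.central.ord_eq ?_ ?_
  · exact Commute.sum_left _ _ _ fun i _ => ((h.commute.pow_left _).inv_left₀).pow_left _
  -- Conjugation by `π` permutes the conjugates cyclically, the `f`-th one being `θ` again; so the
  -- sum commutes with `π`.
  · have h1 : ∀ i, SemiconjBy π ((conjRoot K s θ (i + 1))⁻¹ ^ k) ((conjRoot K s θ i)⁻¹ ^ k) := by
      intro i
      refine (SemiconjBy.inv_right₀ ?_).pow_right k
      have h2 := h.mul_pow_eq (i + 1)
      rw [pow_succ, ← mul_assoc, h.mul_pow_eq i, mul_assoc, mul_assoc] at h2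
      exact (mul_left_cancel₀ (pow_ne_zero i h.central.ne_zero) h2).symm
    have h3 := Finset.sum_range_succ (fun i => (conjRoot K s θ i)⁻¹ ^ k) (resDeg K E)
    rw [Finset.sum_range_succ', (h.conjRoot_eq_self_iff _).mpr dvd_rfl, conjRoot_zero] at h3
    have h4 := add_right_cancel h3
    rw [commute_iff_eq]
    conv_rhs => rw [← h4]
    rw [Finset.sum_mul, Finset.mul_sum]
    exact Finset.sum_congr rfl fun i _ => (h1 i).symm

/-- The projections onto the conjugate eigenspaces add up to an integer multiple of the
identity. -/
lemma sum_eigenProj [Algebra.IsCentral K B] (v : Fin 2 → B) :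
    ∑ i ∈ Finset.range (resDeg K E), eigenProj φ η (resCard K E - 1) (conjRoot K s θ i) v
      = ((resCard K E - 1 : ℕ) : K) • v := by
  choose a ha using h.exists_sum_conjRoot (φ := φ)
  set N := resCard K E - 1
  -- Since the coefficients are central, the sum of the projections is the action of an element `g`
  -- of `E`. It acts as `N` on one eigenvector, and `E` is a field, so `g = N`.
  set g : E := ∑ k ∈ Finset.range N, a k • η ^ k with hg
  have hsum : ∀ v : Fin 2 → B,
      ∑ i ∈ Finset.range (resDeg K E), eigenProj φ η N (conjRoot K s θ i) v = φ g *ᵥ v := by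
    intro v
    simp only [eigenProj_apply]
    rw [Finset.sum_comm, hg, map_sum, Matrix.sum_mulVec]
    refine Finset.sum_congr rfl fun k _ => ?_
    rw [← Finset.sum_smul, ← Finset.op_sum, ← ha, rsmul_algebraMap, map_smul, Matrix.smul_mulVec]
  obtain ⟨v₀, hv₀, hne⟩ := h.exists_mem
  have h0 : φ g *ᵥ v₀ = (N : K) • v₀ := by
    rw [← hsum, Finset.sum_eq_single_of_mem 0 (Finset.mem_range.mpr (resDeg_pos K E))]
    · rw [conjRoot_zero]
      exact eigenProj_self φ N h.ne_zero (mem_eigenSpace.mp hv₀)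
    · intro i hi hi0
      exact h.eigenProj_conjRoot_of_ne (resDeg_pos K E) (Finset.mem_range.mp hi) hi0.symm
        (by rwa [conjRoot_zero])
  have h1 : g = algebraMap K E (N : K) := by
    by_contra hgN
    refine map_mulVec_ne_zero φ (sub_ne_zero.mpr hgN) hne ?_
    rw [map_sub, Matrix.sub_mulVec, h0, AlgHom.commutes, Algebra.algebraMap_eq_smul_one,
      Matrix.smul_mulVec, Matrix.one_mulVec, sub_self]
  rw [hsum, h1, AlgHom.commutes, Algebra.algebraMap_eq_smul_one, Matrix.smul_mulVec,
    Matrix.one_mulVec]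

/-- Each vector is a combination of translates of eigenvectors. -/
lemma exists_eigenvector_sum [Algebra.IsCentral K B] (v : Fin 2 → B) :
    ∃ u : ℕ → (Fin 2 → B), (∀ i, u i ∈ eigenSpace φ η θ) ∧
      (∀ i, u i <• π ^ i = eigenProj φ η (resCard K E - 1) (conjRoot K s θ i) v) ∧
      ((resCard K E - 1 : ℕ) : K) • v = ∑ i ∈ Finset.range (resDeg K E), u i <• π ^ i := by
  have h1 : ∀ i, (eigenProj φ η (resCard K E - 1) (conjRoot K s θ i) v <• (π ^ i)⁻¹) <• π ^ i
      = eigenProj φ η (resCard K E - 1) (conjRoot K s θ i) v := by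
    intro i
    rw [op_smul_op_smul, inv_mul_cancel₀ (pow_ne_zero i h.central.ne_zero)]
    simp
  refine ⟨fun i => eigenProj φ η (resCard K E - 1) (conjRoot K s θ i) v <• (π ^ i)⁻¹,
    fun i => h.op_smul_inv_pow_mem ?_, h1, ?_⟩
  · exact mem_eigenSpace.mpr (map_mulVec_eigenProj φ h.teich.pow_eq_one (h.conjRoot_ne_zero i)
      (h.conjRoot_pow_eq_one i) v)
  · rw [Finset.sum_congr rfl fun i _ => h1 i, h.sum_eigenProj]

/-- `B²` is the direct sum of the translates `U πⁱ`, `i < f`, of the eigenspace: the projections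
separate them and `exists_eigenvector_sum` shows that they span. -/
lemma finrank_eigenSpace [Algebra.IsCentral K B] :
    resDeg K E * Module.finrank K (eigenSpace φ η θ) = 2 * Module.finrank K B := by
  let T : (Fin (resDeg K E) → eigenSpace φ η θ) →ₗ[K] (Fin 2 → B) :=
    { toFun := fun u => ∑ i : Fin (resDeg K E), (u i : Fin 2 → B) <• π ^ (i : ℕ)
      map_add' := fun u w => by simp only [Pi.add_apply, Submodule.coe_add, smul_add,
        Finset.sum_add_distrib]
      map_smul' := fun c u => by
        simp only [Pi.smul_apply, Submodule.coe_smul, Finset.smul_sum, RingHom.id_apply,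
          smul_comm c] }
  have hT : ∀ u, T u = ∑ i : Fin (resDeg K E), (u i : Fin 2 → B) <• π ^ (i : ℕ) := fun u => rfl
  have hinj : Function.Injective T := by
    rw [injective_iff_map_eq_zero]
    intro u hu
    funext k
    have h1 := congrArg (eigenProj φ η (resCard K E - 1) (conjRoot K s θ k)) hu
    rw [hT, map_sum, map_zero, Finset.sum_eq_single_of_mem k (Finset.mem_univ _)
      (fun i _ hik => h.eigenProj_conjRoot_of_ne i.2 k.2 (fun he => hik (Fin.ext he))
        (h.op_smul_pow_mem (u i).2 i)),
      eigenProj_self φ _ (h.conjRoot_ne_zero _) (mem_eigenSpace.mp (h.op_smul_pow_mem (u k).2 k))]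
      at h1
    have h2 := (smul_eq_zero.mp h1).resolve_left resCard_sub_one_ne_zero
    by_contra hne
    exact op_smul_ne_zero (fun h3 => hne (Subtype.ext h3))
      (pow_ne_zero _ h.central.ne_zero) h2
  have hsurj : Function.Surjective T := by
    intro v
    have hN := resCard_sub_one_ne_zero (K := K) (E := E)
    obtain ⟨u, hu, -, hv⟩ := h.exists_eigenvector_sum v
    refine ⟨((resCard K E - 1 : ℕ) : K)⁻¹ • fun i => ⟨u i, hu i⟩, ?_⟩
    rw [map_smul, hT, inv_smul_eq_iff₀ hN, hv, Finset.sum_range]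
  have := (LinearEquiv.ofBijective T ⟨hinj, hsurj⟩).finrank_eq
  rw [Module.finrank_pi_fintype, Module.finrank_pi_fintype] at this
  simpa using this

end EigenData

end EigenData

/-! ### The filtration of a stable lattice by powers of `𝔪_E`. -/

section Layers

universe u

variable {K : Type*} [Field K] [ValuativeRel K] [TopologicalSpace K] [IsNonarchimedeanLocalField K]
  {B : Type u} [DivisionRing B] [Algebra K B] [FiniteDimensional K B]
  {E : Type*} [Field E] [Algebra K E] [FiniteDimensional K E]
  (φ : E →ₐ[K] Matrix (Fin 2) (Fin 2) B)

/-- The multiple `𝔪ᶜ X` of a stable lattice `X`, with `𝔪` the maximal ideal of `𝒪_E`. -/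
def layer (X : Submodule 𝒪[K] (Fin 2 → B)) (c : ℤ) : Submodule 𝒪[K] (Fin 2 → B) where
  carrier := {v | ∀ t ∈ fil K E (-c), φ t *ᵥ v ∈ X}
  zero_mem' t _ := by rw [Matrix.mulVec_zero]; exact zero_mem _
  add_mem' {v w} hv hw t ht := by rw [Matrix.mulVec_add]; exact add_mem (hv t ht) (hw t ht)
  smul_mem' a v hv t ht := by rw [Matrix.mulVec_smul]; exact X.smul_mem a (hv t ht)

variable {φ} {X : Submodule 𝒪[K] (Fin 2 → B)}

lemma mem_layer {c : ℤ} {v : Fin 2 → B} :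
    v ∈ layer φ X c ↔ ∀ t ∈ fil K E (-c), φ t *ᵥ v ∈ X := Iff.rfl

lemma layer_anti {c d : ℤ} (h : c ≤ d) : layer φ X d ≤ layer φ X c := fun _ hv t ht =>
  hv t (fil_mono (by omega) ht)

lemma map_mulVec_mem_layer {c d : ℤ} {t : E} (ht : t ∈ fil K E d) {v : Fin 2 → B}
    (hv : v ∈ layer φ X c) : φ t *ᵥ v ∈ layer φ X (c + d) := by
  intro r hr
  rw [Matrix.mulVec_mulVec, ← map_mul]
  exact hv _ (by have := mul_mem_fil hr ht; rwa [show -(c + d) + d = -c by ring] at this)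

lemma map_mulVec_mem_layer_iff {c d : ℤ} {t : E} (ht : t ≠ 0) (htd : ord K t = d)
    {v : Fin 2 → B} : φ t *ᵥ v ∈ layer φ X (c + d) ↔ v ∈ layer φ X c := by
  constructor
  · intro h
    have h1 := map_mulVec_mem_layer (mem_fil_ord (K := K) t⁻¹) h
    rw [Matrix.mulVec_mulVec, ← map_mul, inv_mul_cancel₀ ht, map_one, Matrix.one_mulVec,
      ord_inv ht, htd, add_neg_cancel_right] at h1
    exact h1
  · exact map_mulVec_mem_layer (htd ▸ mem_fil_ord t)

lemma IsStable.mem_layer_zero (hX : IsStable φ X) {v : Fin 2 → B} : v ∈ layer φ X 0 ↔ v ∈ X := by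
  rw [mem_layer, neg_zero]
  constructor
  · intro h
    simpa using h 1 one_mem_fil
  · exact fun h t ht => hX.left t ht v h

lemma IsStable.op_smul_mem_layer (hX : IsStable φ X) {c : ℤ} {v : Fin 2 → B}
    (hv : v ∈ layer φ X c) {b : B} (hb : b ∈ fil K B 0) : v <• b ∈ layer φ X c := by
  intro t ht
  rw [mulVec_op_smul]
  exact hX.right _ (hv t ht) b hb

variable (φ) in
/-- The map `t ↦ t v` from `E` to `B²`. -/
noncomputable def leftMap (v : Fin 2 → B) : E →ₗ[𝒪[K]] (Fin 2 → B) where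
  toFun t := φ t *ᵥ v
  map_add' t r := by rw [map_add, Matrix.add_mulVec]
  map_smul' c t := by
    rw [algebra_compatible_smul K c t, map_smul, Matrix.smul_mulVec, algebraMap_smul]
    rfl

lemma leftMap_apply (v : Fin 2 → B) (t : E) : leftMap φ v t = φ t *ᵥ v := rfl

/-- Every nonzero vector has a level with respect to a stable lattice. -/
lemma IsStable.exists_level (hX : IsStable φ X) (hlat : IsLattice K X) {v : Fin 2 → B}
    (hv : v ≠ 0) : ∃ m : ℤ, ∀ c, v ∈ layer φ X c ↔ c ≤ m := by
  have hinj : Function.Injective (leftMap φ v) := by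
    rw [injective_iff_map_eq_zero]
    intro t ht
    by_contra ht0
    exact map_mulVec_ne_zero φ ht0 hv ht
  obtain ⟨k, hk⟩ := exists_eq_fil (J := X.comap (leftMap φ v)) (by
      refine Submodule.fg_of_fg_map_injective _ hinj (hlat.1.of_le ?_)
      exact Submodule.map_comap_le _ _) (by
      obtain ⟨t, ht, htv⟩ := exists_smul_mem_of_span_eq_top hlat.2.1 v
      intro h
      have h1 : algebraMap 𝒪[K] E t ∈ X.comap (leftMap φ v) := by
        rw [Submodule.mem_comap, Algebra.algebraMap_eq_smul_one, map_smul, leftMap_apply, map_one,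
          Matrix.one_mulVec]
        exact htv
      rw [h, Submodule.mem_bot, IsScalarTower.algebraMap_apply 𝒪[K] K E] at h1
      simp [ht] at h1) (by
      intro t ht r hr
      rw [Submodule.mem_comap, leftMap_apply] at ht ⊢
      rw [mul_comm, map_mul, ← Matrix.mulVec_mulVec]
      exact hX.left r (mem_integers_iff_fil.mp hr) _ ht)
  obtain ⟨τ, hτ, hτ1⟩ := exists_ord_eq_one K E
  have hk' : ∀ t, φ t *ᵥ v ∈ X ↔ t ∈ fil K E k := fun t => by rw [← hk]; rfl
  refine ⟨-k, fun c => ?_⟩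
  rw [mem_layer]
  constructor
  · intro h
    have := (hk' _).mp (h (τ ^ (-c)) (zpow_mem_fil hτ hτ1 _))
    rw [mem_fil_of_ne (zpow_ne_zero _ hτ), ord_zpow hτ, hτ1] at this
    omega
  · exact fun h t ht => (hk' t).mpr (fil_mono (by omega) ht)

/-- The index of successive layers in a subspace stable under `E`. -/
lemma IsStable.exists_quotient (hX : IsStable φ X) (hlat : IsLattice K X)
    {U : Submodule K (Fin 2 → B)} (hU : ∀ (t : E), ∀ v ∈ U, φ t *ᵥ v ∈ U)
    {ϖ : 𝒪[K]} (hϖ : Irreducible ϖ) :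
    ∃ (Q : Type u) (κ : {v // v ∈ U ∧ v ∈ X} → Q),
      Function.Surjective κ ∧ (∀ v w, κ v = κ w ↔ (v - w : Fin 2 → B) ∈ layer φ X 1) ∧
      Nat.card Q ^ ram E ϖ = Nat.card 𝓀[K] ^ Module.finrank K U := by
  let ι : U →ₗ[𝒪[K]] (Fin 2 → B) := U.subtype.restrictScalars 𝒪[K]
  let Y : Submodule 𝒪[K] U := X.comap ι
  have hY : Submodule.IsLattice K Y :=
    { fg := Submodule.fg_of_fg_map_injective ι Subtype.val_injective
        (hlat.1.of_le (Submodule.map_comap_le _ _))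
      span_eq_top := span_eq_top_of_smul_mem fun u => by
        obtain ⟨t, ht, htu⟩ := exists_smul_mem_of_span_eq_top hlat.2.1 (u : Fin 2 → B)
        exact ⟨t, ht, htu⟩ }
  have hfr : Module.finrank 𝒪[K] Y = Module.finrank K U :=
    congrArg Cardinal.toNat (Submodule.IsLattice.rank' K Y)
  obtain ⟨τ, hτ, hτ1⟩ := exists_ord_eq_one K E
  have hτ0 : τ ∈ fil K E 0 := Or.inr (by omega)
  -- Multiplication by a uniformizer of `E` on `X ∩ U`: its image is the next layer, and its `e`-th
  -- power has the same image as `ϖ`.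
  let g : AddMonoid.End Y :=
    { toFun := fun y => ⟨⟨φ τ *ᵥ (y : U), hU τ _ (y : U).2⟩, hX.left τ hτ0 _ y.2⟩
      map_zero' := Subtype.ext (Subtype.ext (Matrix.mulVec_zero (φ τ)))
      map_add' := fun y z => Subtype.ext (Subtype.ext (Matrix.mulVec_add (φ τ) (y : U) (z : U))) }
  have hpow : ∀ (k : ℕ) (y : Y), ((((g ^ k) y : Y) : U) : Fin 2 → B) = φ (τ ^ k) *ᵥ (y : U) := by
    intro k
    induction k with
    | zero => intro y; simp
    | succ k ih =>
      intro y
      rw [pow_succ' τ, map_mul, ← Matrix.mulVec_mulVec, ← ih, pow_succ']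
      rfl
  have hcancel : ∀ {t : E}, t ≠ 0 → ∀ {v w : Fin 2 → B}, φ t *ᵥ v = φ t *ᵥ w → v = w := by
    intro t ht v w hvw
    by_contra hne
    refine map_mulVec_ne_zero φ ht (sub_ne_zero.mpr hne) ?_
    rw [Matrix.mulVec_sub, hvw, sub_self]
  have hg : Function.Injective g := by
    intro y z hyz
    have : φ τ *ᵥ ((y : U) : Fin 2 → B) = φ τ *ᵥ ((z : U) : Fin 2 → B) :=
      congrArg (fun w : Y => ((w : U) : Fin 2 → B)) hyz
    exact Subtype.ext (Subtype.ext (hcancel hτ this))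
  set e := ram E ϖ with he
  have hϖ0 := algebraMap_ne_zero_of_irreducible (D := E) hϖ
  have hϖsmul : ∀ v : Fin 2 → B, φ (algebraMap 𝒪[K] E ϖ) *ᵥ v = ϖ • v := by
    intro v
    rw [← leftMap_apply, Algebra.algebraMap_eq_smul_one, map_smul, leftMap_apply, map_one,
      Matrix.one_mulVec]
  have hunit : ∀ r : E, r ≠ 0 → ord K r = 0 → ∀ y : Y, ∃ z : Y,
      ((z : U) : Fin 2 → B) = φ r *ᵥ (y : U) := fun r hr hr0 y =>
    ⟨⟨⟨φ r *ᵥ (y : U), hU r _ (y : U).2⟩, hX.left r (Or.inr hr0.ge) _ y.2⟩, rfl⟩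
  have hcard := index_pow_eq_of_pow_eq hϖ g hg e (fun x => by
    have hτe := pow_ne_zero e hτ
    constructor
    · rintro ⟨y, rfl⟩
      obtain ⟨z, hz⟩ := hunit ((algebraMap 𝒪[K] E ϖ)⁻¹ * τ ^ e)
        (mul_ne_zero (inv_ne_zero hϖ0) hτe) (by
          rw [ord_mul (inv_ne_zero hϖ0) hτe, ord_inv hϖ0, ord_pow hτ, hτ1,
            ord_algebraMap_eq_ram hϖ]; omega) y
      refine ⟨z, Subtype.ext (Subtype.ext ?_)⟩
      rw [hpow]
      change ϖ • ((z : U) : Fin 2 → B) = _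
      rw [hz, ← hϖsmul, Matrix.mulVec_mulVec, ← map_mul, mul_inv_cancel_left₀ hϖ0]
    · rintro ⟨y, rfl⟩
      obtain ⟨z, hz⟩ := hunit ((τ ^ e)⁻¹ * algebraMap 𝒪[K] E ϖ)
        (mul_ne_zero (inv_ne_zero hτe) hϖ0) (by
          rw [ord_mul (inv_ne_zero hτe) hϖ0, ord_inv hτe, ord_pow hτ, hτ1,
            ord_algebraMap_eq_ram hϖ]; omega) y
      refine ⟨z, Subtype.ext (Subtype.ext ?_)⟩
      rw [hpow, hz, Matrix.mulVec_mulVec, ← map_mul, mul_inv_cancel_left₀ hτe]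
      exact hϖsmul _)
  rw [hfr] at hcard
  refine ⟨Y ⧸ AddMonoidHom.range g,
    fun v => QuotientAddGroup.mk ⟨⟨v.1, v.2.1⟩, v.2.2⟩, ?_, ?_, hcard⟩
  · intro q
    obtain ⟨y, rfl⟩ := QuotientAddGroup.mk_surjective q
    exact ⟨⟨y.1.1, y.1.2, y.2⟩, rfl⟩
  · intro v w
    rw [eq_comm, QuotientAddGroup.eq]
    have hl : ∀ z : Fin 2 → B, z ∈ layer φ X 1 ↔ φ τ⁻¹ *ᵥ z ∈ X := by
      intro z
      rw [← hX.mem_layer_zero, ← map_mulVec_mem_layer_iff (c := 1) (d := -1) (inv_ne_zero hτ)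
        (by rw [ord_inv hτ, hτ1])]
      rfl
    rw [hl]
    constructor
    · rintro ⟨y, hy⟩
      have h1 : φ τ *ᵥ ((y : U) : Fin 2 → B) = -(w : Fin 2 → B) + v :=
        congrArg (fun w : Y => ((w : U) : Fin 2 → B)) hy
      rw [← neg_add_eq_sub, ← h1, Matrix.mulVec_mulVec, ← map_mul, inv_mul_cancel₀ hτ, map_one,
        Matrix.one_mulVec]
      exact y.2
    · intro h1
      refine ⟨⟨⟨φ τ⁻¹ *ᵥ ((v : Fin 2 → B) - w), hU _ _ (sub_mem v.2.1 w.2.1)⟩, h1⟩, ?_⟩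
      refine Subtype.ext (Subtype.ext ?_)
      change φ τ *ᵥ (φ τ⁻¹ *ᵥ ((v : Fin 2 → B) - w)) = -(w : Fin 2 → B) + v
      rw [neg_add_eq_sub, Matrix.mulVec_mulVec, ← map_mul, mul_inv_cancel₀ hτ, map_one,
        Matrix.one_mulVec]

end Layers

/-! ### Layers of the eigenspace. -/

section EigenLayers

variable {K : Type*} [Field K] [ValuativeRel K] [TopologicalSpace K] [IsNonarchimedeanLocalField K]
  {B : Type*} [DivisionRing B] [Algebra K B] [FiniteDimensional K B]
  {E : Type*} [Field E] [Algebra K E] [FiniteDimensional K E]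
  {φ : E →ₐ[K] Matrix (Fin 2) (Fin 2) B} {X : Submodule 𝒪[K] (Fin 2 → B)}

lemma map_mulVec_mem_eigenSpace {η : E} {θ : B} (t : E) {v : Fin 2 → B}
    (hv : v ∈ eigenSpace φ η θ) : φ t *ᵥ v ∈ eigenSpace φ η θ := by
  rw [mem_eigenSpace] at hv ⊢
  rw [Matrix.mulVec_mulVec, ← map_mul, mul_comm, map_mul, ← Matrix.mulVec_mulVec, hv,
    mulVec_op_smul]

lemma op_smul_mem_eigenSpace {η : E} {θ b : B} (hb : Commute θ b) {v : Fin 2 → B}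
    (hv : v ∈ eigenSpace φ η θ) : v <• b ∈ eigenSpace φ η θ := by
  rw [mem_eigenSpace] at hv ⊢
  rw [mulVec_op_smul, hv, op_smul_op_smul, op_smul_op_smul, hb.eq]

lemma map_algebraMap_mulVec (a : K) (v : Fin 2 → B) : φ (algebraMap K E a) *ᵥ v = a • v := by
  rw [AlgHom.commutes, Algebra.algebraMap_eq_smul_one, Matrix.smul_mulVec, Matrix.one_mulVec]

lemma exists_smul_of_mem_layer {ϖ : 𝒪[K]} (hϖ : Irreducible ϖ) {U : Submodule K (Fin 2 → B)}
    {c : ℤ} {v : Fin 2 → B} (hvU : v ∈ U) (hv : v ∈ layer φ X (c + ram E ϖ)) :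
    ∃ w ∈ U, w ∈ layer φ X c ∧ v = ϖ • w := by
  have hϖ0 : algebraMap 𝒪[K] K ϖ ≠ 0 := algebraMap_ne_zero_of_irreducible (D := K) hϖ
  have he : v = ϖ • ((algebraMap 𝒪[K] K ϖ)⁻¹ • v) := by
    rw [algebra_compatible_smul K ϖ, smul_inv_smul₀ hϖ0]
  refine ⟨(algebraMap 𝒪[K] K ϖ)⁻¹ • v, U.smul_mem _ hvU, ?_, he⟩
  rw [← map_mulVec_mem_layer_iff (algebraMap_ne_zero_of_irreducible (D := E) hϖ)
    (ord_algebraMap_eq_ram hϖ), IsScalarTower.algebraMap_apply 𝒪[K] K E, map_algebraMap_mulVec,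
    smul_inv_smul₀ hϖ0]
  exact hv

lemma IsLattice.fg_layer_inf (hlat : IsLattice K X) (c : ℤ)
    (U : Submodule 𝒪[K] (Fin 2 → B)) : (layer φ X c ⊓ U).FG := by
  obtain ⟨τ, hτ, hτ1⟩ := exists_ord_eq_one K E
  have hτc : τ ^ (-c) ≠ 0 := zpow_ne_zero _ hτ
  refine Submodule.fg_of_fg_map_injective (mulVecBilinear K B (φ (τ ^ (-c)))) ?_
    (hlat.1.of_le ?_)
  · rw [injective_iff_map_eq_zero]
    intro v hv
    by_contra hv0
    exact map_mulVec_ne_zero φ hτc hv0 hv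
  · rintro _ ⟨v, hv, rfl⟩
    exact hv.1 _ (zpow_mem_fil hτ hτ1 _)

/-- Elements of `K` have proportional valuations in `B` and in `E`. -/
lemma ord_algebraMap_eq_of_ord_eq {ϖ : 𝒪[K]} (hϖ : Irreducible ϖ) {a : K} (ha : a ≠ 0)
    (h : ord K (algebraMap K B a) = ram B ϖ) : ord K (algebraMap K E a) = ram E ϖ := by
  have hϖ0 : algebraMap 𝒪[K] K ϖ ≠ 0 := algebraMap_ne_zero_of_irreducible (D := K) hϖ
  have hϖB := algebraMap_ne_zero_of_irreducible (D := B) hϖ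
  have haB : algebraMap K B a ≠ 0 := by simpa using ha
  have hϖE := algebraMap_ne_zero_of_irreducible (D := E) hϖ
  have haE : algebraMap K E a ≠ 0 := by simpa using ha
  have h1 : a / algebraMap 𝒪[K] K ϖ ∈ 𝒪[K] := by
    rw [← algebraMap_isIntegral_iff (D := B), mem_integers_iff, map_div₀,
      ← IsScalarTower.algebraMap_apply, div_eq_mul_inv, ord_mul haB (inv_ne_zero hϖB),
      ord_inv hϖB, h, ord_algebraMap_eq_ram hϖ]
    right; omega
  have h2 : algebraMap 𝒪[K] K ϖ / a ∈ 𝒪[K] := by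
    rw [← algebraMap_isIntegral_iff (D := B), mem_integers_iff, map_div₀,
      ← IsScalarTower.algebraMap_apply, div_eq_mul_inv, ord_mul hϖB (inv_ne_zero haB),
      ord_inv haB, h, ord_algebraMap_eq_ram hϖ]
    right; omega
  rw [← algebraMap_isIntegral_iff (D := E), mem_integers_iff, map_div₀,
    ← IsScalarTower.algebraMap_apply, div_eq_mul_inv, ord_mul haE (inv_ne_zero hϖE),
    ord_inv hϖE, ord_algebraMap_eq_ram hϖ] at h1
  rw [← algebraMap_isIntegral_iff (D := E), mem_integers_iff, map_div₀,
    ← IsScalarTower.algebraMap_apply, div_eq_mul_inv, ord_mul hϖE (inv_ne_zero haE),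
    ord_inv haE, ord_algebraMap_eq_ram hϖ] at h2
  have h1 := h1.resolve_left (mul_ne_zero haE (inv_ne_zero hϖE))
  have h2 := h2.resolve_left (mul_ne_zero hϖE (inv_ne_zero haE))
  omega

namespace EigenData

variable {n s : ℕ} {ζ π : B} {η : E} {θ : B} (h : EigenData φ n s ζ π η θ)
include h

lemma finrank_eigenSpace_eq [Algebra.IsCentral K B] (hn : Module.finrank K B = n ^ 2)
    (hE : Module.finrank K E = 2 * n) {ϖ : 𝒪[K]} (hϖ : Irreducible ϖ) :
    Module.finrank K (eigenSpace φ η θ) = n * ram E ϖ := by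
  have h1 := h.finrank_eigenSpace
  have h2 := ram_mul_resDeg (D := E) hϖ
  rw [hE] at h2
  refine Nat.eq_of_mul_eq_mul_left (resDeg_pos K E) ?_
  rw [h1, hn]
  calc 2 * n ^ 2 = n * (2 * n) := by ring
    _ = _ := by rw [← h2]; ring

variable [Algebra.IsCentral K B] (hn : Module.finrank K B = n ^ 2)
  (hE : Module.finrank K E = 2 * n) (hX : IsStable φ X) (hlat : IsLattice K X)
include hn hE hX hlat

/-- The quotient of the first two layers of `U` has `q ^ n` elements, since its `e`-th power is `q ^
dim U` with `dim U = n e`. That is the residue cardinality of `B`, and the classes of `0` and of the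
`x ζ ^ j` already give that many. -/
lemma exists_sub_mem_layer_one {x v : Fin 2 → B} (hx : x ∈ eigenSpace φ η θ) (hx0 : x ∈ X)
    (hx1 : x ∉ layer φ X 1) (hv : v ∈ eigenSpace φ η θ) (hv0 : v ∈ X) :
    v ∈ layer φ X 1 ∨ ∃ j : ℕ, v - x <• ζ ^ j ∈ layer φ X 1 := by
  obtain ⟨ϖ, hϖ⟩ := IsDiscreteValuationRing.exists_irreducible 𝒪[K]
  obtain ⟨Q, κ, hκ, hκeq, hcard⟩ := hX.exists_quotient hlat
    (U := eigenSpace φ η θ) (fun t v hv => map_mulVec_mem_eigenSpace t hv) hϖ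
  have hQ : Nat.card Q = resCard K B := by
    rw [h.finrank_eigenSpace_eq hn hE hϖ, pow_mul] at hcard
    rw [resCard_eq, h.central.resDeg_eq]
    exact Nat.pow_left_injective (ram_pos hϖ).ne' hcard
  have hBpos := one_lt_resCard K B
  have : Finite Q := Nat.finite_of_card_ne_zero (by omega)
  have hpowU : ∀ j : ℕ, x <• ζ ^ j ∈ eigenSpace φ η θ := fun j =>
    op_smul_mem_eigenSpace (h.commute.pow_right j) hx
  have hpowX : ∀ j : ℕ, x <• ζ ^ j ∈ X := fun j => hX.right _ hx0 _ (h.central.teich.pow_mem_fil j)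
  have hunit : ∀ b : B, b ≠ 0 → ord K b = 0 → x <• b ∉ layer φ X 1 := by
    intro b hb hb0 hmem
    have := hX.op_smul_mem_layer hmem (b := b⁻¹) (Or.inr (by rw [ord_inv hb, hb0]; simp))
    rw [op_smul_op_smul, mul_inv_cancel₀ hb] at this
    exact hx1 (by simpa using this)
  let F : Option (Fin (resCard K B - 1)) → Q := fun o => o.elim
    (κ ⟨0, zero_mem _, zero_mem _⟩) fun j => κ ⟨x <• ζ ^ (j : ℕ), hpowU j, hpowX j⟩
  have hinj : Function.Injective F := by
    have h0 : ∀ j : Fin (resCard K B - 1), F (some j) ≠ F none := by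
      intro j hj
      have h1 : x <• ζ ^ (j : ℕ) - 0 ∈ layer φ X 1 := (hκeq _ _).mp hj
      rw [sub_zero] at h1
      exact hunit _ (pow_ne_zero _ h.central.teich.ne_zero) (h.central.teich.ord_pow_eq_zero _) h1
    rintro (_ | i) (_ | j) hij
    · rfl
    · exact absurd hij.symm (h0 j)
    · exact absurd hij (h0 i)
    · have h1 : x <• ζ ^ (i : ℕ) - x <• ζ ^ (j : ℕ) ∈ layer φ X 1 := (hκeq _ _).mp hij
      rw [← sub_smul, ← MulOpposite.op_sub] at h1
      have h2 : ζ ^ (i : ℕ) = ζ ^ (j : ℕ) := by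
        by_contra hne
        refine hunit _ (sub_ne_zero.mpr hne) (ord_eq_of_mem_fil
          (sub_mem (h.central.teich.pow_mem_fil _) (h.central.teich.pow_mem_fil _))
          fun h3 => hne (h.central.teich.pow_eq_pow_of_sub_mem h3)) h1
      have hz0 := h.central.teich.ne_zero
      have key : ∀ a b : ℕ, a ≤ b → b < resCard K B - 1 → ζ ^ a = ζ ^ b → a = b := by
        intro a b hab hb he
        obtain ⟨d, rfl⟩ := Nat.exists_eq_add_of_le hab
        rw [pow_add, eq_comm, mul_eq_left₀ (pow_ne_zero _ hz0),
          h.central.teich.pow_eq_one_iff] at he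
        have := Nat.eq_zero_of_dvd_of_lt he (by omega)
        omega
      congr 1
      rcases le_total (i : ℕ) j with hle | hle
      · exact Fin.ext (key _ _ hle j.2 h2)
      · exact Fin.ext (key _ _ hle i.2 h2.symm).symm
  have hbij := Function.Injective.bijective_of_nat_card_le hinj (by
    rw [hQ, Finite.card_option, Nat.card_fin]
    omega)
  obtain ⟨o, ho⟩ := hbij.2 (κ ⟨v, hv, hv0⟩)
  rcases o with _ | j
  · have h1 : v - 0 ∈ layer φ X 1 := (hκeq _ _).mp ho.symm
    exact Or.inl (by simpa using h1)
  · exact Or.inr ⟨j, (hκeq _ _).mp ho.symm⟩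

/-- Successive layers of the eigenspace have one-dimensional quotients over the residue field
of `B`. -/
lemma exists_sub_mem_layer {c : ℤ} {x v : Fin 2 → B} (hx : x ∈ eigenSpace φ η θ)
    (hxc : x ∈ layer φ X c) (hxc1 : x ∉ layer φ X (c + 1)) (hv : v ∈ eigenSpace φ η θ)
    (hvc : v ∈ layer φ X c) :
    v ∈ layer φ X (c + 1) ∨ ∃ j : ℕ, v - x <• ζ ^ j ∈ layer φ X (c + 1) := by
  obtain ⟨τ, hτ, hτ1⟩ := exists_ord_eq_one K E
  have hτc : τ ^ (-c) ≠ 0 := zpow_ne_zero _ hτ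
  have hord : ord K (τ ^ (-c)) = -c := by rw [ord_zpow hτ, hτ1, mul_one]
  have h0 : ∀ w, w ∈ layer φ X c ↔ φ (τ ^ (-c)) *ᵥ w ∈ X := by
    intro w
    rw [← hX.mem_layer_zero, ← map_mulVec_mem_layer_iff hτc hord, add_neg_cancel]
  have h1 : ∀ w, w ∈ layer φ X (c + 1) ↔ φ (τ ^ (-c)) *ᵥ w ∈ layer φ X 1 := by
    intro w
    rw [← map_mulVec_mem_layer_iff hτc hord, show c + 1 + -c = 1 by ring]
  have := h.exists_sub_mem_layer_one hn hE hX hlat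
    (map_mulVec_mem_eigenSpace (τ ^ (-c)) hx) ((h0 x).mp hxc) (fun h2 => hxc1 ((h1 x).mpr h2))
    (map_mulVec_mem_eigenSpace (τ ^ (-c)) hv) ((h0 v).mp hvc)
  rw [← h1] at this
  refine this.imp_right ?_
  rintro ⟨j, hj⟩
  rw [← mulVec_op_smul, ← Matrix.mulVec_sub, ← h1] at hj
  exact ⟨j, hj⟩

/-- A submodule stable under `𝒪_E` and `ζ` contains the layer of each of its eigenvectors. -/
lemma mem_of_mem_layer {S : Submodule 𝒪[K] (Fin 2 → B)}
    (hS : ∀ t ∈ fil K E 0, ∀ v ∈ S, φ t *ᵥ v ∈ S) (hSζ : ∀ (j : ℕ), ∀ v ∈ S, v <• ζ ^ j ∈ S)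
    {c : ℤ} {x : Fin 2 → B} (hx : x ∈ eigenSpace φ η θ) (hxc : x ∈ layer φ X c)
    (hxc1 : x ∉ layer φ X (c + 1)) (hxS : x ∈ S) {v : Fin 2 → B} (hv : v ∈ eigenSpace φ η θ)
    (hvc : v ∈ layer φ X c) : v ∈ S := by
  obtain ⟨ϖ, hϖ⟩ := IsDiscreteValuationRing.exists_irreducible 𝒪[K]
  obtain ⟨τ, hτ, hτ1⟩ := exists_ord_eq_one K E
  -- The vector `τ ^ k x` has exact level `c + k` and lies in `S`, so `v` can be corrected layer by
  -- layer; `e` corrections suffice for Nakayama.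
  have hiter : ∀ k : ℕ, ∀ v ∈ eigenSpace φ η θ, v ∈ layer φ X c →
      ∃ r ∈ S, v - r ∈ eigenSpace φ η θ ∧ v - r ∈ layer φ X (c + k) := by
    intro k
    induction k with
    | zero => intro v hv hvc; exact ⟨0, zero_mem _, by simpa using hv, by simpa using hvc⟩
    | succ k ih =>
      intro v hv hvc
      obtain ⟨r, hr, hrU, hrk⟩ := ih v hv hvc
      have hord : ord K (τ ^ k) = k := by rw [ord_pow hτ, hτ1, mul_one]
      have hxk : φ (τ ^ k) *ᵥ x ∈ eigenSpace φ η θ := map_mulVec_mem_eigenSpace _ hx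
      have hxkS : φ (τ ^ k) *ᵥ x ∈ S := hS _ (Or.inr (by rw [hord]; positivity)) _ hxS
      have := h.exists_sub_mem_layer hn hE hX hlat (c := c + k) hxk
        ((map_mulVec_mem_layer_iff (pow_ne_zero k hτ) hord).mpr hxc)
        (fun h2 => hxc1 (by
          rw [show c + (k : ℤ) + 1 = c + 1 + k by ring,
            map_mulVec_mem_layer_iff (pow_ne_zero k hτ) hord] at h2
          exact h2)) hrU hrk
      rw [show c + ((k + 1 : ℕ) : ℤ) = c + k + 1 by push_cast; ring]
      rcases this with h1 | ⟨j, hj⟩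
      · exact ⟨r, hr, hrU, h1⟩
      · refine ⟨r + (φ (τ ^ k) *ᵥ x) <• ζ ^ j, add_mem hr (hSζ j _ hxkS), ?_, ?_⟩
        · rw [← sub_sub]
          exact sub_mem hrU (op_smul_mem_eigenSpace (h.commute.pow_right j) hxk)
        · rwa [← sub_sub]
  have hle : layer φ X c ⊓ (eigenSpace φ η θ).restrictScalars 𝒪[K] ≤ S := by
    refine Submodule.le_of_le_smul_of_le_jacobson_bot (hlat.fg_layer_inf c _)
      maximalIdeal_le_jacobson fun v hv => ?_
    obtain ⟨r, hr, hrU, hrk⟩ := hiter (ram E ϖ) v hv.2 hv.1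
    obtain ⟨w, hwU, hwc, hw⟩ := exists_smul_of_mem_layer hϖ hrU hrk
    rw [← add_sub_cancel r v, hw]
    refine Submodule.add_mem_sup hr (Submodule.smul_mem_smul ?_ ⟨hwc, hwU⟩)
    rw [hϖ.maximalIdeal_eq]
    exact Ideal.mem_span_singleton_self _
  exact hle ⟨hvc, hv⟩

end EigenData

end EigenLayers

/-! ### The effect of `π ^ f` on layers. -/

section AdaptedBasis

variable {K : Type*} [Field K] [ValuativeRel K] [TopologicalSpace K] [IsNonarchimedeanLocalField K]
  {B : Type*} [DivisionRing B] [Algebra K B] [FiniteDimensional K B]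
  {E : Type*} [Field E] [Algebra K E] [FiniteDimensional K E]
  {φ : E →ₐ[K] Matrix (Fin 2) (Fin 2) B} {X : Submodule 𝒪[K] (Fin 2 → B)}

/-- The vectors `v` such that `v b` lies in a given submodule. -/
noncomputable def rightComap (S : Submodule 𝒪[K] (Fin 2 → B)) (b : B) :
    Submodule 𝒪[K] (Fin 2 → B) :=
  S.comap (DistribSMul.toLinearMap 𝒪[K] (Fin 2 → B) (MulOpposite.op b))

lemma mem_rightComap {S : Submodule 𝒪[K] (Fin 2 → B)} {b : B} {v : Fin 2 → B} :
    v ∈ rightComap S b ↔ v <• b ∈ S := Iff.rfl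

namespace EigenData

variable {n s : ℕ} {ζ π : B} {η : E} {θ : B} (h : EigenData φ n s ζ π η θ)
include h

/-- `b⁻¹ ζ ^ j b` is again a unit of `𝒪_B`. -/
lemma op_smul_pow_mem_rightComap {S : Submodule 𝒪[K] (Fin 2 → B)}
    (hS : ∀ v ∈ S, ∀ c ∈ fil K B 0, v <• c ∈ S) {b : B} (hb : b ≠ 0) (j : ℕ) {v : Fin 2 → B}
    (hv : v ∈ rightComap S b) : v <• ζ ^ j ∈ rightComap S b := by
  have hζ := pow_ne_zero j h.central.teich.ne_zero
  rw [mem_rightComap] at hv ⊢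
  have := hS _ hv (b⁻¹ * (ζ ^ j * b)) (Or.inr (by
    rw [ord_mul (inv_ne_zero hb) (mul_ne_zero hζ hb), ord_mul hζ hb, ord_inv hb,
      h.central.teich.ord_pow_eq_zero]
    omega))
  rwa [op_smul_op_smul, mul_inv_cancel_left₀ hb, ← op_smul_op_smul] at this

lemma commute_pow_resDeg : Commute θ (π ^ resDeg K E) := by
  rw [commute_iff_eq, h.mul_pow_eq, (h.conjRoot_eq_self_iff _).mpr dvd_rfl]

lemma ram_eq_two_mul (hE : Module.finrank K E = 2 * n) {ϖ : 𝒪[K]} (hϖ : Irreducible ϖ) {m : ℕ}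
    (hm : n = resDeg K E * m) : ram E ϖ = 2 * m := by
  have h1 := ram_mul_resDeg (D := E) hϖ
  rw [hE, hm] at h1
  refine Nat.eq_of_mul_eq_mul_right (resDeg_pos K E) ?_
  rw [h1]
  ring

variable [Algebra.IsCentral K B] (hn : Module.finrank K B = n ^ 2)
  (hE : Module.finrank K E = 2 * n) (hX : IsStable φ X) (hlat : IsLattice K X)
include hn hE hX hlat

/-- The vectors `v` with `v b ∈ S` are stable under `𝒪_E` and `ζ`, so `mem_of_mem_layer` applies to
them. Thus one eigenvector of exact level `c` carries its whole layer with it. -/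
lemma op_smul_mem_of_mem_layer {S : Submodule 𝒪[K] (Fin 2 → B)} (hS : IsStable φ S) {b : B}
    (hb : b ≠ 0) {c : ℤ} {x : Fin 2 → B} (hx : x ∈ eigenSpace φ η θ) (hxc : x ∈ layer φ X c)
    (hxc1 : x ∉ layer φ X (c + 1)) (hxS : x <• b ∈ S) {v : Fin 2 → B}
    (hv : v ∈ eigenSpace φ η θ) (hvc : v ∈ layer φ X c) : v <• b ∈ S := by
  refine mem_rightComap.mp (h.mem_of_mem_layer hn hE hX hlat (S := rightComap S b)
    (fun t ht v hv => ?_)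
    (fun j v hv => h.op_smul_pow_mem_rightComap hS.right hb j hv) hx hxc hxc1 hxS hv hvc)
  rw [mem_rightComap] at hv ⊢
  rw [← mulVec_op_smul]
  exact hS.left t ht _ hv

/-- `π ^ f` commutes with `θ`, so it preserves `U`. Applying `op_smul_mem_of_mem_layer` to it and
its inverse matches one layer with another, and powers of `τ` propagate the shift. -/
lemma exists_op_smul_pow_mem_layer_iff : ∃ d : ℤ, ∀ (c : ℤ), ∀ u ∈ eigenSpace φ η θ,
    u <• π ^ resDeg K E ∈ layer φ X (c + d) ↔ u ∈ layer φ X c := by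
  obtain ⟨τ, hτ, hτ1⟩ := exists_ord_eq_one K E
  have hp : π ^ resDeg K E ≠ 0 := pow_ne_zero _ h.central.ne_zero
  set p := π ^ resDeg K E with hpdef
  obtain ⟨x, hx, hx0⟩ := h.exists_mem
  obtain ⟨m, hm⟩ := hX.exists_level hlat hx0
  obtain ⟨m', hm'⟩ := hX.exists_level hlat (op_smul_ne_zero hx0 hp)
  have hxm : x ∈ layer φ X m := (hm m).mpr le_rfl
  have hxm1 : x ∉ layer φ X (m + 1) := fun h1 => by have := (hm _).mp h1; omega
  have hxm' : x <• p ∈ layer φ X m' := (hm' m').mpr le_rfl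
  have hxm1' : x <• p ∉ layer φ X (m' + 1) := fun h1 => by have := (hm' _).mp h1; omega
  have hlay : ∀ c, IsStable φ (layer φ X c) := fun c =>
    ⟨fun t ht v hv => by simpa using map_mulVec_mem_layer ht hv,
      fun v hv b hb => hX.op_smul_mem_layer hv hb⟩
  have hfwd : ∀ u ∈ eigenSpace φ η θ, u ∈ layer φ X m → u <• p ∈ layer φ X m' :=
    fun u hu hum => h.op_smul_mem_of_mem_layer hn hE hX hlat (hlay m') hp hx hxm hxm1 hxm' hu hum
  have hbwd : ∀ u ∈ eigenSpace φ η θ, u <• p ∈ layer φ X m' → u ∈ layer φ X m := by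
    intro u hu hum
    have hback : ∀ v : Fin 2 → B, (v <• p) <• p⁻¹ = v := by
      intro v
      rw [op_smul_op_smul, mul_inv_cancel₀ hp]
      simp
    have := h.op_smul_mem_of_mem_layer hn hE hX hlat (hlay m) (inv_ne_zero hp)
      (op_smul_mem_eigenSpace h.commute_pow_resDeg hx) hxm' hxm1'
      (by rw [hback]; exact hxm) (op_smul_mem_eigenSpace h.commute_pow_resDeg hu) hum
    rwa [hback] at this
  refine ⟨m' - m, fun c u hu => ?_⟩
  have hord : ord K (τ ^ (m - c)) = m - c := by rw [ord_zpow hτ, hτ1, mul_one]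
  have hne : τ ^ (m - c) ≠ 0 := zpow_ne_zero _ hτ
  rw [← map_mulVec_mem_layer_iff hne hord, ← map_mulVec_mem_layer_iff (c := c) hne hord,
    mulVec_op_smul, show c + (m' - m) + (m - c) = m' by ring, show c + (m - c) = m by ring]
  exact ⟨hbwd _ (map_mulVec_mem_eigenSpace _ hu), hfwd _ (map_mulVec_mem_eigenSpace _ hu)⟩

/-- Multiplication by `π ^ f` shifts the layers of the eigenspace by two. -/
lemma op_smul_pow_mem_layer_iff (c : ℤ) {u : Fin 2 → B} (hu : u ∈ eigenSpace φ η θ) :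
    u <• π ^ resDeg K E ∈ layer φ X (c + 2) ↔ u ∈ layer φ X c := by
  obtain ⟨ϖ, hϖ⟩ := IsDiscreteValuationRing.exists_irreducible 𝒪[K]
  obtain ⟨d, hd⟩ := h.exists_op_smul_pow_mem_layer_iff hn hE hX hlat
  obtain ⟨m, hm⟩ := h.dvd
  have hiter : ∀ k : ℕ, ∀ (c : ℤ), ∀ u ∈ eigenSpace φ η θ,
      u <• π ^ (resDeg K E * k) ∈ layer φ X (c + d * k) ↔ u ∈ layer φ X c := by
    intro k
    induction k with
    | zero => intro c u hu; simp
    | succ k ih =>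
      intro c u hu
      rw [← ih c u hu, ← hd (c + d * k) (u <• π ^ (resDeg K E * k))
        (op_smul_mem_eigenSpace (by rw [pow_mul]; exact h.commute_pow_resDeg.pow_right k) hu),
        op_smul_op_smul, ← pow_add, mul_add, mul_one]
      push_cast
      rw [show c + d * ((k : ℤ) + 1) = c + d * k + d by ring]
  -- With `n = f m`, iterating the shift `d` by `m` steps gives the action of `π ^ n`, an element of
  -- `K` of valuation `e = 2m` in `E`. Hence `d m = 2m` and `d = 2`.
  obtain ⟨a, ha⟩ := h.central.exists_pow_eq
  have hπn : π ^ n ≠ 0 := pow_ne_zero _ h.central.ne_zero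
  have ha0 : a ≠ 0 := by
    rintro rfl
    rw [map_zero] at ha
    exact hπn ha.symm
  have hordE : ord K (algebraMap K E a) = ram E ϖ := by
    refine ord_algebraMap_eq_of_ord_eq (B := B) hϖ ha0 ?_
    rw [ha, ord_pow h.central.ne_zero, h.central.ord_eq, h.central.ram_eq ϖ hϖ, mul_one]
  obtain ⟨x, hx, hx0⟩ := h.exists_mem
  obtain ⟨l, hl⟩ := hX.exists_level hlat hx0
  have h1 : ∀ c, c ≤ l + d * m ↔ c ≤ l + ram E ϖ := by
    intro c
    have h2 := hiter m (c - d * m) x hx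
    have h3 := map_mulVec_mem_layer_iff (φ := φ) (X := X) (c := c - ram E ϖ) (v := x)
      (t := algebraMap K E a) (by simpa using ha0) hordE
    rw [map_algebraMap_mulVec, ← rsmul_algebraMap, ha, sub_add_cancel] at h3
    rw [← hm, sub_add_cancel, h3, hl, hl] at h2
    constructor <;> intro h4 <;> omega
  have h2 : d * m = ram E ϖ := by
    have h3 := (h1 (l + d * m)).mp le_rfl
    have h4 := (h1 (l + ram E ϖ)).mpr le_rfl
    omega
  have hn0 : 0 < n := by
    have : 0 < Module.finrank K B := Module.finrank_pos
    rw [hn] at this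
    exact Nat.pos_of_ne_zero fun h0 => by simp [h0] at this
  have hm0 : (m : ℤ) ≠ 0 := by
    intro h0
    rw [Nat.cast_eq_zero] at h0
    rw [h0, mul_zero] at hm
    omega
  have h7 : d = 2 := by
    rw [h.ram_eq_two_mul hE hϖ hm] at h2
    push_cast at h2
    exact mul_right_cancel₀ hm0 h2
  rw [← hd c u hu, h7]

lemma op_smul_zpow_mem_layer_iff (m c : ℤ) {u : Fin 2 → B} (hu : u ∈ eigenSpace φ η θ) :
    u <• (π ^ resDeg K E) ^ m ∈ layer φ X (c + 2 * m) ↔ u ∈ layer φ X c := by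
  have hp : π ^ resDeg K E ≠ 0 := pow_ne_zero _ h.central.ne_zero
  have hstep : ∀ m c : ℤ, u <• (π ^ resDeg K E) ^ (m + 1) ∈ layer φ X (c + 2 * (m + 1)) ↔
      u <• (π ^ resDeg K E) ^ m ∈ layer φ X (c + 2 * m) := by
    intro m c
    rw [← h.op_smul_pow_mem_layer_iff hn hE hX hlat (c + 2 * m)
      (op_smul_mem_eigenSpace (h.commute_pow_resDeg.zpow_right₀ m) hu), op_smul_op_smul,
      ← zpow_add_one₀ hp, show c + 2 * m + 2 = c + 2 * (m + 1) by ring]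
  induction m using Int.induction_on with
  | zero => simp
  | succ i ih => exact (hstep _ _).trans ih
  | pred i ih =>
    have := hstep (-i - 1) c
    rw [sub_add_cancel] at this
    exact this.symm.trans ih

end EigenData

end AdaptedBasis

/-! ### Classification of the stable lattices when `f ∣ n`. -/

section RamifiedBranch

variable {K : Type*} [Field K] [ValuativeRel K] [TopologicalSpace K] [IsNonarchimedeanLocalField K]
  {B : Type*} [DivisionRing B] [Algebra K B] [FiniteDimensional K B]
  {E : Type*} [Field E] [Algebra K E] [FiniteDimensional K E]
  {φ : E →ₐ[K] Matrix (Fin 2) (Fin 2) B} {X : Submodule 𝒪[K] (Fin 2 → B)}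

lemma IsStable.eigenProj_mem {Λ : Submodule 𝒪[K] (Fin 2 → B)} (hΛ : IsStable φ Λ) {η : E}
    (hη : η ∈ fil K E 0) (N : ℕ) {θ : B} (hθ : θ⁻¹ ∈ fil K B 0) {v : Fin 2 → B} (hv : v ∈ Λ) :
    eigenProj φ η N θ v ∈ Λ := by
  rw [eigenProj_apply]
  refine Submodule.sum_mem _ fun k _ => hΛ.right _ (hΛ.left _ ?_ _ hv) _ ?_
  · simpa using pow_mem_fil hη k
  · simpa using pow_mem_fil hθ k

namespace EigenData

variable {n s : ℕ} {ζ π : B} {η : E} {θ : B} (h : EigenData φ n s ζ π η θ)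
include h

lemma ord_conjRoot (i : ℕ) : ord K (conjRoot K s θ i) = 0 := by
  obtain ⟨j, rfl⟩ := h.mem_powers
  rw [conjRoot, ← pow_mul, h.central.teich.ord_pow_eq_zero]

variable [Algebra.IsCentral K B] (hn : Module.finrank K B = n ^ 2)
  (hE : Module.finrank K E = 2 * n)
include hn hE

variable (hX : IsStable φ X) (hlat : IsLattice K X)
  {x : Fin 2 → B} (hx : x ∈ eigenSpace φ η θ) (hx0 : x ∈ layer φ X 0) (hx1 : x ∉ layer φ X 1)
  {τ : E} (hτ : τ ≠ 0) (hτ1 : ord K τ = 1)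
include hX hlat hx hx0 hx1 hτ hτ1

/-- `τ x` has exact level 1, so a multiple of it approximates `v` modulo layer 2, and layer 2 of `U`
is layer 0 times `π ^ f`. -/
lemma exists_of_mem_layer_one {v : Fin 2 → B} (hv : v ∈ eigenSpace φ η θ)
    (hv1 : v ∈ layer φ X 1) : ∃ β ∈ fil K B 0, ∃ w ∈ eigenSpace φ η θ, w ∈ layer φ X 0 ∧
      v = (φ τ *ᵥ x) <• β + w <• π ^ resDeg K E := by
  have hp : π ^ resDeg K E ≠ 0 := pow_ne_zero _ h.central.ne_zero
  have hy : φ τ *ᵥ x ∈ eigenSpace φ η θ := map_mulVec_mem_eigenSpace τ hx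
  have hy1 : φ τ *ᵥ x ∈ layer φ X 1 := (map_mulVec_mem_layer_iff (c := 0) hτ hτ1).mpr hx0
  have hy2 : φ τ *ᵥ x ∉ layer φ X (1 + 1) := fun h1 =>
    hx1 ((map_mulVec_mem_layer_iff hτ hτ1).mp h1)
  have key : ∃ β ∈ fil K B 0, v - (φ τ *ᵥ x) <• β ∈ eigenSpace φ η θ ∧
      v - (φ τ *ᵥ x) <• β ∈ layer φ X 2 := by
    rcases h.exists_sub_mem_layer hn hE hX hlat hy hy1 hy2 hv hv1 with h1 | ⟨j, hj⟩
    · exact ⟨0, zero_mem _, by simpa using hv, by simpa using h1⟩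
    · exact ⟨ζ ^ j, h.central.teich.pow_mem_fil j,
        sub_mem hv (op_smul_mem_eigenSpace (h.commute.pow_right j) hy), hj⟩
  obtain ⟨β, hβ, hU, h2⟩ := key
  have hback : ((v - (φ τ *ᵥ x) <• β) <• (π ^ resDeg K E)⁻¹) <• π ^ resDeg K E
      = v - (φ τ *ᵥ x) <• β := by
    rw [op_smul_op_smul, inv_mul_cancel₀ hp]
    simp
  have hwU := op_smul_mem_eigenSpace (h.commute_pow_resDeg.inv_right₀) hU
  refine ⟨β, hβ, _, hwU, ?_, by rw [hback, add_sub_cancel]⟩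
  rw [← h.op_smul_pow_mem_layer_iff hn hE hX hlat 0 hwU, hback]
  exact h2

lemma exists_of_mem_layer_zero {v : Fin 2 → B} (hv : v ∈ eigenSpace φ η θ)
    (hv0 : v ∈ layer φ X 0) : ∃ r ∈ std K x (φ τ *ᵥ x) 0 0, ∃ w ∈ eigenSpace φ η θ,
      w ∈ layer φ X 0 ∧ v = r + w <• π ^ resDeg K E := by
  have key : ∃ α ∈ fil K B 0, v - x <• α ∈ eigenSpace φ η θ ∧ v - x <• α ∈ layer φ X 1 := by
    rcases h.exists_sub_mem_layer hn hE hX hlat (c := 0) hx hx0 hx1 hv hv0 with h1 | ⟨j, hj⟩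
    · exact ⟨0, zero_mem _, by simpa using hv, by simpa using h1⟩
    · exact ⟨ζ ^ j, h.central.teich.pow_mem_fil j,
        sub_mem hv (op_smul_mem_eigenSpace (h.commute.pow_right j) hx), hj⟩
  obtain ⟨α, hα, hU, h1⟩ := key
  obtain ⟨β, hβ, w, hwU, hw, hvw⟩ :=
    h.exists_of_mem_layer_one hn hE hX hlat hx hx0 hx1 hτ hτ1 hU h1
  refine ⟨x <• α + (φ τ *ᵥ x) <• β, ⟨α, hα, β, hβ, rfl⟩, w, hwU, hw, ?_⟩
  rw [add_assoc, ← hvw, add_sub_cancel]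

/-- After `m = n / f` approximations in terms of `x` and `τ x`, the error lies in layer `2m = e`,
that is in `ϖ` times layer 0 of `U`; Nakayama concludes. -/
lemma mem_std_of_mem_layer_zero {v : Fin 2 → B} (hv : v ∈ eigenSpace φ η θ)
    (hv0 : v ∈ layer φ X 0) : v ∈ std K x (φ τ *ᵥ x) 0 0 := by
  obtain ⟨ϖ, hϖ⟩ := IsDiscreteValuationRing.exists_irreducible 𝒪[K]
  obtain ⟨m, hm⟩ := h.dvd
  have hπ0 : π ∈ fil K B 0 := Or.inr (by have := h.central.ord_eq; omega)
  have hiter : ∀ k : ℕ, ∀ v ∈ eigenSpace φ η θ, v ∈ layer φ X 0 →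
      ∃ r ∈ std K x (φ τ *ᵥ x) 0 0, ∃ w ∈ eigenSpace φ η θ, w ∈ layer φ X 0 ∧
        v = r + w <• (π ^ resDeg K E) ^ k := by
    intro k
    induction k with
    | zero => intro v hv hv0; exact ⟨0, zero_mem _, v, hv, hv0, by simp⟩
    | succ k ih =>
      intro v hv hv0
      obtain ⟨r, hr, w, hwU, hw, rfl⟩ := ih v hv hv0
      obtain ⟨r', hr', w', hwU', hw', rfl⟩ :=
        h.exists_of_mem_layer_zero hn hE hX hlat hx hx0 hx1 hτ hτ1 hwU hw
      refine ⟨r + r' <• (π ^ resDeg K E) ^ k, add_mem hr ?_, w', hwU', hw', ?_⟩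
      · rw [← pow_mul]
        simpa using op_smul_mem_std hr' (pow_mem_fil hπ0 (resDeg K E * k))
      · rw [smul_add, op_smul_op_smul, ← pow_succ', add_assoc]
  have hle : layer φ X 0 ⊓ (eigenSpace φ η θ).restrictScalars 𝒪[K]
      ≤ std K x (φ τ *ᵥ x) 0 0 := by
    refine Submodule.le_of_le_smul_of_le_jacobson_bot (hlat.fg_layer_inf 0 _)
      maximalIdeal_le_jacobson fun v hv => ?_
    obtain ⟨r, hr, w, hwU, hw, rfl⟩ := hiter m v hv.2 hv.1
    have hwe : w <• (π ^ resDeg K E) ^ m ∈ layer φ X (0 + ram E ϖ) := by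
      have := (h.op_smul_zpow_mem_layer_iff hn hE hX hlat m 0 hwU).mpr hw
      rw [h.ram_eq_two_mul hE hϖ hm]
      simpa using this
    obtain ⟨u, huU, hu, hwu⟩ := exists_smul_of_mem_layer hϖ
      (op_smul_mem_eigenSpace (h.commute_pow_resDeg.pow_right m) hwU) hwe
    rw [hwu]
    refine Submodule.add_mem_sup hr (Submodule.smul_mem_smul ?_ ⟨hu, huU⟩)
    rw [hϖ.maximalIdeal_eq]
    exact Ideal.mem_span_singleton_self _
  exact hle ⟨hv0, hv⟩

/-- Apart from a multiple of `τ x`, the vector is a layer 0 vector times `π ^ f`. The exponent `f`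
at `x` is the source of the length of the path. -/
lemma mem_std_of_mem_layer_one {v : Fin 2 → B} (hv : v ∈ eigenSpace φ η θ)
    (hv1 : v ∈ layer φ X 1) : v ∈ std K x (φ τ *ᵥ x) (resDeg K E) 0 := by
  obtain ⟨β, hβ, w, hwU, hw, rfl⟩ :=
    h.exists_of_mem_layer_one hn hE hX hlat hx hx0 hx1 hτ hτ1 hv hv1
  refine add_mem (op_smul_right_mem_std hβ) ?_
  have h1 := op_smul_mem_std (h.mem_std_of_mem_layer_zero hn hE hX hlat hx hx0 hx1 hτ hτ1 hwU hw)
    (pow_mem_fil (a := 1) (Or.inr h.central.ord_eq.ge : π ∈ fil K B 1) (resDeg K E))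
  exact std_anti _ _ (by simp) (by simp) h1

/-- The stable lattices are diagonal in the basis `x, τ x`. -/
lemma exists_eq_std {Λ : Submodule 𝒪[K] (Fin 2 → B)} (hΛ : IsLattice K Λ) (hΛs : IsStable φ Λ) :
    ∃ a b : ℤ, b ≤ a ∧ a ≤ b + resDeg K E ∧ Λ = std K x (φ τ *ᵥ x) a b := by
  have hπ := h.central.ne_zero
  have hπ1 := h.central.ord_eq
  have hp : π ^ resDeg K E ≠ 0 := pow_ne_zero _ hπ
  have hpm : ∀ m : ℤ, (π ^ resDeg K E) ^ m ≠ 0 := fun m => zpow_ne_zero _ hp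
  have hordp : ∀ m : ℤ, ord K ((π ^ resDeg K E) ^ m) = resDeg K E * m := by
    intro m
    rw [ord_zpow hp, ord_pow hπ, hπ1]
    ring
  have hxne : x ≠ 0 := by rintro rfl; exact hx1 (zero_mem _)
  set y := φ τ *ᵥ x with hydef
  have hyne : y ≠ 0 := map_mulVec_ne_zero φ hτ hxne
  have hy : y ∈ eigenSpace φ η θ := map_mulVec_mem_eigenSpace τ hx
  have hy1 : y ∈ layer φ X 1 := (map_mulVec_mem_layer_iff (c := 0) hτ hτ1).mpr hx0
  have hy2 : y ∉ layer φ X (1 + 1) := fun h1 => hx1 ((map_mulVec_mem_layer_iff hτ hτ1).mp h1)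
  obtain ⟨a, ha⟩ := hΛ.exists_fil hxne
  obtain ⟨b, hb⟩ := hΛ.exists_fil hyne
  have hxm : ∀ (m c : ℤ), c ≤ 2 * m → x <• (π ^ resDeg K E) ^ m ∈ layer φ X c := by
    intro m c hc
    refine layer_anti hc ?_
    have := (h.op_smul_zpow_mem_layer_iff hn hE hX hlat m 0 hx).mpr hx0
    rwa [zero_add] at this
  have hym : ∀ (m c : ℤ), c ≤ 2 * m + 1 → y <• (π ^ resDeg K E) ^ m ∈ layer φ X c := by
    intro m c hc
    refine layer_anti hc ?_
    have := (h.op_smul_zpow_mem_layer_iff hn hE hX hlat m 1 hy).mpr hy1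
    rwa [add_comm] at this
  have hmulU : ∀ (m : ℤ) (u : Fin 2 → B), u ∈ eigenSpace φ η θ →
      u <• (π ^ resDeg K E) ^ m ∈ eigenSpace φ η θ := fun m u hu =>
    op_smul_mem_eigenSpace (h.commute_pow_resDeg.zpow_right₀ m) hu
  have hzp : ∀ k : ℤ, π ^ k ≠ 0 := fun k => zpow_ne_zero _ hπ
  have hordz : ∀ k : ℤ, ord K (π ^ k) = k := fun k => by rw [ord_zpow hπ, hπ1, mul_one]
  -- `τ x` is one level deeper than `x`, so it follows `x` into the lattice.
  have hba : b ≤ a := by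
    have h1 := h.op_smul_mem_of_mem_layer hn hE hX hlat hΛs (hzp a) hx hx0 hx1
      ((ha _).mpr (zpow_mem_fil hπ hπ1 a)) hy (layer_anti (by omega) hy1)
    rw [hb, mem_fil_of_ne (hzp a), hordz] at h1
    exact h1
  -- `x π ^ f` has level 2 and `τ x` has level 1, so `x π ^ f` follows `τ x`.
  have hab : a ≤ b + resDeg K E := by
    have h1 := h.op_smul_mem_of_mem_layer hn hE hX hlat hΛs (hzp b) hy hy1 hy2
      ((hb _).mpr (zpow_mem_fil hπ hπ1 b)) (hmulU 1 x hx) (hxm 1 1 (by omega))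
    rw [op_smul_op_smul, ha, mem_fil_of_ne (mul_ne_zero (hpm 1) (hzp b)),
      ord_mul (hpm 1) (hzp b), hordz, hordp] at h1
    omega
  have heig : ∀ (i : ℕ) (u : Fin 2 → B), u ∈ eigenSpace φ η θ → u <• π ^ i ∈ Λ →
      u <• π ^ i ∈ std K x y a b := by
    intro i u hu hui
    by_cases hu0 : u = 0
    · simp [hu0]
    have hπi := pow_ne_zero i hπ
    obtain ⟨c, hc⟩ := hX.exists_level hlat hu0
    have huc : u ∈ layer φ X c := (hc c).mpr le_rfl
    have huc1 : u ∉ layer φ X (c + 1) := fun h1 => by have := (hc _).mp h1; omega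
    have hgen : ∀ v ∈ eigenSpace φ η θ, v ∈ layer φ X c → v <• π ^ i ∈ Λ := fun v hv hvc =>
      h.op_smul_mem_of_mem_layer hn hE hX hlat hΛs hπi hu huc huc1 hui hv hvc
    have hordi : ∀ m : ℤ, ord K ((π ^ resDeg K E) ^ m * π ^ i) = resDeg K E * m + i := by
      intro m
      rw [ord_mul (hpm m) hπi, hordp, ord_pow hπ, hπ1, mul_one]
    have hxa : ∀ m : ℤ, c ≤ 2 * m → a ≤ resDeg K E * m + i := by
      intro m hcm
      have h1 := hgen _ (hmulU m x hx) (hxm m c hcm)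
      rwa [op_smul_op_smul, ha, mem_fil_of_ne (mul_ne_zero (hpm m) hπi), hordi] at h1
    have hyb : ∀ m : ℤ, c ≤ 2 * m + 1 → b ≤ resDeg K E * m + i := by
      intro m hcm
      have h1 := hgen _ (hmulU m y hy) (hym m c hcm)
      rwa [op_smul_op_smul, hb, mem_fil_of_ne (mul_ne_zero (hpm m) hπi), hordi] at h1
    have hrew : ∀ m : ℤ, (u <• (π ^ resDeg K E) ^ (-m)) <• ((π ^ resDeg K E) ^ m * π ^ i)
        = u <• π ^ i := by
      intro m
      rw [op_smul_op_smul, ← mul_assoc, ← zpow_add₀ hp, neg_add_cancel, zpow_zero, one_mul]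
    have hlev : ∀ m : ℤ, u <• (π ^ resDeg K E) ^ (-m) ∈ layer φ X (c - 2 * m) := by
      intro m
      have := (h.op_smul_zpow_mem_layer_iff hn hE hX hlat (-m) c hu).mpr huc
      rwa [show c + 2 * -m = c - 2 * m by ring] at this
    -- A power of `π ^ f` moves the level of `u` to 0 or 1 according to parity.
    rcases Int.even_or_odd' c with ⟨m, hm | hm⟩
    · have h1 := hlev m
      rw [show c - 2 * m = 0 by omega] at h1
      have h2 := op_smul_mem_std (h.mem_std_of_mem_layer_zero hn hE hX hlat hx hx0 hx1 hτ hτ1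
        (hmulU (-m) u hu) h1) (mem_fil_ord (K := K) ((π ^ resDeg K E) ^ m * π ^ i))
      rw [hrew, hordi] at h2
      refine std_anti _ _ ?_ ?_ h2
      · rw [zero_add]; exact hxa m (by omega)
      · rw [zero_add]; exact hyb m (by omega)
    · have h1 := hlev m
      rw [show c - 2 * m = 1 by omega] at h1
      have h2 := op_smul_mem_std (h.mem_std_of_mem_layer_one hn hE hX hlat hx hx0 hx1 hτ hτ1
        (hmulU (-m) u hu) h1) (mem_fil_ord (K := K) ((π ^ resDeg K E) ^ m * π ^ i))
      rw [hrew, hordi] at h2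
      refine std_anti _ _ ?_ ?_ h2
      · have := hxa (m + 1) (by omega)
        rw [mul_add] at this
        omega
      · rw [zero_add]; exact hyb m (by omega)
  refine ⟨a, b, hba, hab, le_antisymm (fun v hv => ?_) ?_⟩
  -- The projections preserve the stable lattice, so each component of `N v` lies in it; `N` is a
  -- unit of `𝒪[K]`.
  · obtain ⟨u, huU, hu, hsum⟩ := h.exists_eigenvector_sum v
    obtain ⟨N, hN⟩ := isUnit_resCard_sub_one K E
    have h1 : ((resCard K E - 1 : ℕ) : 𝒪[K]) • v ∈ std K x y a b := by
      rw [Nat.cast_smul_eq_nsmul, ← Nat.cast_smul_eq_nsmul K, hsum]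
      refine Submodule.sum_mem _ fun i _ => heig i (u i) (huU i) ?_
      rw [hu i]
      refine hΛs.eigenProj_mem h.teich.mem_fil _ (Or.inr ?_) hv
      rw [ord_inv (h.conjRoot_ne_zero i), h.ord_conjRoot, neg_zero]
    rw [← hN] at h1
    have := (std K x y a b).smul_mem (↑N⁻¹ : 𝒪[K]) h1
    rwa [smul_smul, Units.inv_mul, one_smul] at this
  · rintro _ ⟨α, hα, β, hβ, rfl⟩
    exact add_mem ((ha α).mpr hα) ((hb β).mpr hβ)

/-- `𝒪_E` sends `x` into layer 0 and `τ x` into layer 1, whose exponents `(0, 0)` and `(f, 0)`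
require precisely the two inequalities. -/
lemma isStable_std {a b : ℤ} (hba : b ≤ a) (hab : a ≤ b + resDeg K E) :
    IsStable φ (std K x (φ τ *ᵥ x) a b) := by
  refine ⟨fun t ht v hv => ?_, fun v hv c hc => by simpa using op_smul_mem_std hv hc⟩
  obtain ⟨α, hα, β, hβ, rfl⟩ := hv
  rw [Matrix.mulVec_add, mulVec_op_smul, mulVec_op_smul]
  refine add_mem ?_ ?_
  · have h1 := h.mem_std_of_mem_layer_zero hn hE hX hlat hx hx0 hx1 hτ hτ1
      (map_mulVec_mem_eigenSpace t hx) (by simpa using map_mulVec_mem_layer ht hx0)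
    exact std_anti _ _ (by omega) (by omega) (op_smul_mem_std h1 hα)
  · have hy1 : φ τ *ᵥ x ∈ layer φ X 1 := (map_mulVec_mem_layer_iff (c := 0) hτ hτ1).mpr hx0
    have h1 := h.mem_std_of_mem_layer_one hn hE hX hlat hx hx0 hx1 hτ hτ1
      (map_mulVec_mem_eigenSpace t (map_mulVec_mem_eigenSpace τ hx))
      (by simpa using map_mulVec_mem_layer ht hy1)
    exact std_anti _ _ (by omega) (by omega) (op_smul_mem_std h1 hβ)

/-- The classification does not presuppose a basis; applied to `X` itself, it shows that the two
vectors span. -/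
lemma isRightBasis : IsRightBasis x (φ τ *ᵥ x) := by
  refine isRightBasis_of_exists_eq K fun v => ?_
  obtain ⟨a, b, -, -, hX'⟩ := h.exists_eq_std hn hE hX hlat hx hx0 hx1 hτ hτ1 hlat hX
  obtain ⟨t, ht, htv⟩ := exists_smul_mem_of_span_eq_top hlat.2.1 v
  rw [hX'] at htv
  obtain ⟨α, -, β, -, hαβ⟩ := htv
  have ht0 : algebraMap 𝒪[K] K t ≠ 0 := by simpa using ht
  set r := algebraMap 𝒪[K] K t with hr
  refine ⟨α * algebraMap K B r⁻¹, β * algebraMap K B r⁻¹, ?_⟩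
  rw [← op_smul_op_smul, ← op_smul_op_smul, ← smul_add, ← hαβ, rsmul_algebraMap,
    algebra_compatible_smul K t, inv_smul_smul₀ ht0]

end EigenData

/-- If the residue degree `f` of `E` divides the degree of `B`, the maximal orders containing the
integers of `E` form a path of length `f`. -/
theorem isPathOfLength_branch_of_dvd [Algebra.IsCentral K B] {n s : ℕ} {ζ π : B}
    (hB : CentralData K n s ζ π) (hn : Module.finrank K B = n ^ 2)
    (hE : Module.finrank K E = 2 * n) (hf : resDeg K E ∣ n)
    {H : Subalgebra 𝒪[K] (Matrix (Fin 2) (Fin 2) B)}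
    (hH : ∀ M, M ∈ H ↔ ∃ t ∈ fil K E 0, φ t = M) :
    IsPathOfLength (branch H) (resDeg K E) := by
  obtain ⟨X, hlat, hXH⟩ := exists_isLattice_le_endAlg (fg_of_mem_iff hH)
  have hX := (hlat.isStable_iff hH).mp hXH
  obtain ⟨η, θ, h⟩ := exists_eigenData (φ := φ) hB hf
  obtain ⟨τ, hτ, hτ1⟩ := exists_ord_eq_one K E
  -- A power of `τ` moves any eigenvector to level exactly 0.
  obtain ⟨x, hx, hx0, hx1⟩ :
      ∃ x ∈ eigenSpace φ η θ, x ∈ layer φ X 0 ∧ x ∉ layer φ X 1 := by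
    obtain ⟨u, hu, hu0⟩ := h.exists_mem
    obtain ⟨m, hm⟩ := hX.exists_level hlat hu0
    have hne : τ ^ (-m) ≠ 0 := zpow_ne_zero _ hτ
    have hord : ord K (τ ^ (-m)) = -m := by rw [ord_zpow hτ, hτ1, mul_one]
    have hiff : ∀ c, φ (τ ^ (-m)) *ᵥ u ∈ layer φ X c ↔ c + m ≤ m := by
      intro c
      rw [← hm, ← map_mulVec_mem_layer_iff (c := c + m) hne hord, add_neg_cancel_right]
    exact ⟨_, map_mulVec_mem_eigenSpace _ hu, (hiff 0).mpr (by omega),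
      fun h1 => by have := (hiff 1).mp h1; omega⟩
  have hxy := h.isRightBasis hn hE hX hlat hx hx0 hx1 hτ hτ1
  -- With the basis reversed, the index along the apartment is `a - b`, which runs from 0 to `f`.
  refine isPathOfLength_branch hxy.symm (resDeg K E) (fun i hi0 hi => ?_) fun Λ hΛ hΛH => ?_
  · rw [(hxy.symm.isLattice_std 0 i).isStable_iff hH, std_comm]
    exact h.isStable_std hn hE hX hlat hx hx0 hx1 hτ hτ1 hi0 (by omega)
  · obtain ⟨a, b, hba, hab, he⟩ := h.exists_eq_std hn hE hX hlat hx hx0 hx1 hτ hτ1 hΛ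
      ((hΛ.isStable_iff hH).mp hΛH)
    exact ⟨b, a, by omega, by omega, by rw [std_comm]; exact he⟩

end RamifiedBranch

/-! ### Integers of a subfield of the matrix algebra. -/

section Fields

variable {K : Type*} [Field K] [ValuativeRel K] [TopologicalSpace K] [IsNonarchimedeanLocalField K]
  {B : Type*} [DivisionRing B] [Algebra K B]
  (L : Subalgebra K (Matrix (Fin 2) (Fin 2) B)) [IsMulCommutative L]

/-- The integers of a subfield of the matrix algebra, in terms of the valuation of a field
isomorphic to it. -/
lemma mem_ringOfIntegers_iff_fil {E : Type*} [Field E] [Algebra K E] [FiniteDimensional K E]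
    (φ : E →ₐ[K] Matrix (Fin 2) (Fin 2) B) (hφ : φ.range = L)
    (M : Matrix (Fin 2) (Fin 2) B) :
    M ∈ ringOfIntegers K L ↔ ∃ t ∈ fil K E 0, φ t = M := by
  have hintegral : ∀ t : E, IsIntegral 𝒪[K] (φ t) ↔ t ∈ fil K E 0 := by
    intro t
    rw [← mem_integers_iff_fil, mem_integers]
    exact isIntegral_algHom_iff (φ.restrictScalars 𝒪[K]) (RingHom.injective φ.toRingHom)
  rw [mem_ringOfIntegers, ← hφ, AlgHom.mem_range]
  constructor
  · rintro ⟨⟨t, rfl⟩, ht⟩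
    exact ⟨t, (hintegral t).mp ht, rfl⟩
  · rintro ⟨t, ht, rfl⟩
    exact ⟨⟨t, rfl⟩, (hintegral t).mpr ht⟩

end Fields

end LocalOrders

/-! ### The main theorem. -/

theorem mainTheorem2 {K : Type*} [Field K] [ValuativeRel K] [TopologicalSpace K]
    [IsNonarchimedeanLocalField K] {B : Type*} [DivisionRing B] [Algebra K B]
    [FiniteDimensional K B] [Algebra.IsCentral K B] (n : ℕ) (hn : Module.finrank K B = n ^ 2)
    (L : Subalgebra K (Matrix (Fin 2) (Fin 2) B)) [IsMulCommutative L] [IsSemisimpleRing L]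
    (hL : Module.finrank K L = 2 * n) :
    (IsField L → Odd (LocalOrders.ramificationIndex (Algebra.ofId K L)) →
      ∃! D : Subalgebra 𝒪[K] (Matrix (Fin 2) (Fin 2) B),
        LocalOrders.IsMaximalOrder K D ∧ LocalOrders.ringOfIntegers K L ≤ D) ∧
    (IsField L → ∀ F : Subalgebra K L, Module.finrank K F = n →
      LocalOrders.ramificationIndex (K := K) (F := F) (L := L) F.val = 2 →
      ∃ l : ℕ, l * LocalOrders.ramificationIndex (Algebra.ofId K L) = 2 * n ∧
        LocalOrders.IsPathOfLength (LocalOrders.branch (LocalOrders.ringOfIntegers K L)) l) ∧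
    (¬ IsField L →
      LocalOrders.IsMaximalPath (LocalOrders.branch (LocalOrders.ringOfIntegers K L))) := by
  obtain ⟨s, ζ, π, hB⟩ := LocalOrders.exists_centralData hn
  obtain ⟨ϖ, hϖ⟩ := IsDiscreteValuationRing.exists_irreducible 𝒪[K]
  have hn0 : n ≠ 0 := by
    rintro rfl
    have : 0 < Module.finrank K B := Module.finrank_pos
    simp [hn] at this
  refine ⟨fun hfield hodd => ?_, fun hfield F hF hFe => ?_, fun hfield => ?_⟩
  · let _ : Field L := hfield.toField
    rw [show LocalOrders.ramificationIndex (Algebra.ofId K L) = LocalOrders.ram L ϖ from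
      LocalOrders.ramificationIndex_ofId hϖ] at hodd
    have hef := LocalOrders.ram_mul_resDeg (D := L) hϖ
    rw [hL] at hef
    refine LocalOrders.existsUnique_isMaximalOrder (φ := L.val)
      (LocalOrders.mem_ringOfIntegers_iff_fil L L.val L.range_val) hB fun ⟨m, hm⟩ => ?_
    -- If `n = f m`, then `e f = 2n` gives `e = 2m`, against the parity of `e`.
    have h1 : LocalOrders.ram L ϖ = 2 * m := by
      refine Nat.eq_of_mul_eq_mul_right (LocalOrders.resDeg_pos K L) ?_
      rw [hef]
      nth_rw 1 [hm]
      ring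
    rw [h1] at hodd
    exact Nat.not_odd_iff_even.mpr (even_two_mul m) hodd
  · let _ : Field L := hfield.toField
    let _ : Field F := (Subalgebra.isField_of_algebraic F).toField
    have hdvd : 2 ∣ LocalOrders.ram L ϖ :=
      hFe.symm.dvd.trans (LocalOrders.ramificationIndex_dvd_ram F.val hϖ)
    have hef := LocalOrders.ram_mul_resDeg (D := L) hϖ
    rw [hL] at hef
    refine ⟨LocalOrders.resDeg K L, ?_, ?_⟩
    · rw [show LocalOrders.ramificationIndex (Algebra.ofId K L) = LocalOrders.ram L ϖ from
        LocalOrders.ramificationIndex_ofId hϖ, mul_comm]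
      exact hef
    · refine LocalOrders.isPathOfLength_branch_of_dvd hB hn hL ?_
        (LocalOrders.mem_ringOfIntegers_iff_fil L L.val L.range_val)
      -- Writing `e = 2m` turns `e f = 2n` into `n = f m`.
      obtain ⟨m, hm⟩ := hdvd
      rw [hm, mul_assoc] at hef
      exact ⟨m, by rw [mul_comm]; exact (Nat.eq_of_mul_eq_mul_left two_pos hef).symm⟩
  · have hnt : Nontrivial L := Module.nontrivial_of_finrank_pos (R := K) (by omega)
    obtain ⟨ε, hidem, h0, h1⟩ := LocalOrders.exists_idempotent_of_not_isField hfield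
    exact LocalOrders.isMaximalPath_branch_of_idempotent L ε.2 (congrArg Subtype.val hidem)
      (fun h => h0 (Subtype.ext h)) (fun h => h1 (Subtype.ext h))
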